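/- Let $\mathcal X\subset[0,r]^d$ ($r>0$) be compact and convex, and let $f\sim\mathcal{GP}(0,k)$ on $\mathcal X$, where $k$ is a stationary kernel with $k(x,x)=1$. Assume that the sample paths of $f$ are almost surely differentiable on $\mathcal X$ and that there are constants $a,b>0$ such that $$\Pr\Bigl(\sup_{x\in\mathcal X}\bigl|\tfrac{\partial f}{\partial x_j}\bigr|>L\Bigr)\le a\exp\bigl(-(L/b)^2\bigr)\qquad\text{for all } L>0,\ j=1,\dots,d.$$ Fix $\eta>0$ and $\sigma>0$, and put $$s_\eta=2d\log\Bigl(\frac{2bdr(\sqrt{\log(ad)}+\sqrt\pi/2)}{\eta}\Bigr)-2\log2,\qquad C_1=\frac{2}{\log(1+\sigma^{-2})}.$$ IRGP-UCB with parameters $s_\eta$ and $\lambda=1/2$ is the following algorithm. At iteration $t=1,2,\dots$, draw $\zeta_t=s_\eta+Z_t$ with $Z_t\sim\mathrm{Exp}(1/2)$, query a point $$x_t\in\operatorname*{argmax}_{x\in\mathcal X}\ \mu_{t-1}(x)+\zeta_t^{1/2}\sigma_{t-1}(x),$$ chosen by a measurable rule from the past data and the values $\zeta_1,\dots,\zeta_t$,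 and observe $y_t=f(x_t)+\epsilon_t$, $\epsilon_t\sim\mathcal N(0,\sigma^2)$. Here $\mu_{t-1}$ and $\sigma_{t-1}^2$ are the posterior mean and variance of the Gaussian process given $(x_i,y_i)_{i<t}$ with noise variance $\sigma^2$. The $\epsilon_t$ are i.i.d., the $\zeta_t$ are i.i.d., and $f$, $(\epsilon_t)_t$, $(\zeta_t)_t$ are independent. Let $$\mathrm{BSR}_T=\mathbb E\bigl[f(x^*)-\max_{t\le T}f(x_t)\bigr],\qquad x^*\in\operatorname*{argmax}_{x\in\mathcal X}f(x),$$ and let $\gamma_T=\sup_{A\subset\mathcal X,\,|A|=T}I(y_A;f_A)$ be the maximum information gain, where $I$ is Shannon mutual information, $f_A=(f(x))_{x\in A}$, and $y_A=f_A+\epsilon_A$ with independent $\epsilon_A\sim\mathcal N(0,\sigma^2 I_T)$. (Square roots of negative numbers are read as $0$.) Then, for every $T\ge1$, $\gamma_T$ is finite, the regret in the definition of $\mathrm{BSR}_T$ is integrable, and $$\mathrm{BSR}_T\le\frac\eta2+\sqrt{\frac{C_1(2+s_\eta)\gamma_T}{T}}.$$ Consequently, if $T\ge1$ satisfies $\sqrt{C_1(2+s_\eta)\gamma_T/T}\le\eta/2$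 (in particular, if $T$ is the smallest such integer), then $\mathrm{BSR}_n\le\eta$ for every $n\ge T$. The left-hand side of this condition is $O(\sqrt{\gamma_T/T})$ in $T$, since $C_1$ and $s_\eta$ do not depend on $T$. -/

import Mathlib

open MeasureTheory ProbabilityTheory Set
open scoped NNReal ENNReal Matrix

namespace GPBandit

noncomputable section

/-- `ℝ^d`. -/
abbrev Pt (d : ℕ) : Type := EuclideanSpace ℝ (Fin d)

/-! ### Gaussian process prior -/

/-- `f ∼ GP(0, k)` on the domain `X`: `(f · z)_{z ∈ X}` is a Gaussian process on `(Ω, P)` with zero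
mean and covariance kernel `k`. Values of `f` and `k` outside `X` are irrelevant. -/
structure IsCenteredGP {Ω : Type*} [MeasurableSpace Ω] {d : ℕ} (X : Set (Pt d))
    (k : Pt d → Pt d → ℝ) (f : Ω → Pt d → ℝ) (P : Measure Ω) : Prop where
  measurable : ∀ z ∈ X, Measurable (fun ω => f ω z)
  gaussian : IsGaussianProcess (fun (z : X) (ω : Ω) => f ω z) P
  mean_zero : ∀ z ∈ X, ∫ ω, f ω z ∂P = 0
  covariance_eq : ∀ z ∈ X, ∀ w ∈ X, cov[fun ω => f ω z, fun ω => f ω w; P] = k z w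

/-- `k` is stationary on `X`: `k z w` depends on `z - w` only. -/
def IsStationaryOn {d : ℕ} (X : Set (Pt d)) (k : Pt d → Pt d → ℝ) : Prop :=
  ∃ κ : Pt d → ℝ, ∀ z ∈ X, ∀ w ∈ X, k z w = κ (z - w)

/-- The regularity assumption on domain and sample paths: `X ⊆ [0, r]^d` is compact and convex,
almost every sample path is differentiable on `X` with gradient `∇f`, and
`Pr (sup_{z ∈ X} |∂f/∂z_j| > L) ≤ a exp (-(L/b)²)` for every coordinate `j` and every `L > 0`.
(`∃ z ∈ X, L < |∂_j f(z)|` says that the supremum, possibly infinite, exceeds `L`. If `X` has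
empty interior, any gradient relative to `X` may be used.) -/
structure RegularDomain {Ω : Type*} [MeasurableSpace Ω] {d : ℕ} (X : Set (Pt d))
    (f : Ω → Pt d → ℝ) (P : Measure Ω) (r a b : ℝ) : Prop where
  r_pos : 0 < r
  a_pos : 0 < a
  b_pos : 0 < b
  subset_cube : ∀ z ∈ X, ∀ j, z j ∈ Icc 0 r
  compact : IsCompact X
  convex : Convex ℝ X
  gradient_tail : ∃ gradf : Ω → Pt d → Pt d,
    (∀ᵐ ω ∂P, ∀ z ∈ X, HasGradientWithinAt (f ω) (gradf ω z) X z) ∧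
    ∀ j : Fin d, ∀ L : ℝ, 0 < L →
      P {ω | ∃ z ∈ X, L < |gradf ω z j|} ≤ ENNReal.ofReal (a * Real.exp (-(L / b) ^ 2))

/-! ### Maximum information gain -/

/-- Shannon mutual information of the two components of a pair with joint law `ρ`: the
Kullback-Leibler divergence of `ρ` from the product of its marginals. -/
def mutualInfo {α β : Type*} [MeasurableSpace α] [MeasurableSpace β] (ρ : Measure (α × β)) :
    ℝ≥0∞ :=
  InformationTheory.klDiv ρ (ρ.fst.prod ρ.snd)

/-- `I(y_A ; f_A)` for `A = {a_1, …, a_T}`, where `f_A = (f(a_i))_i`, `y_A = f_A + ε_A`, and `ε_A`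
has i.i.d. `N(0, σ²)` entries and is independent of `f_A`. -/
def infoGain {Ω : Type*} [MeasurableSpace Ω] {d : ℕ} (f : Ω → Pt d → ℝ) (P : Measure Ω)
    (σ : ℝ≥0) {T : ℕ} (A : Fin T → Pt d) : ℝ≥0∞ :=
  mutualInfo (((P.map (fun ω i => f ω (A i))).prod
    (Measure.pi (fun _ : Fin T => gaussianReal 0 (σ ^ 2)))).map
      (fun p : (Fin T → ℝ) × (Fin T → ℝ) => (p.1 + p.2, p.1)))

/-- The maximum information gain `γ_T`: the supremum of `I(y_A ; f_A)` over the sets `A` of `T`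
(distinct) points of `X`. -/
def maxInfoGain {Ω : Type*} [MeasurableSpace Ω] {d : ℕ} (X : Set (Pt d)) (f : Ω → Pt d → ℝ)
    (P : Measure Ω) (σ : ℝ≥0) (T : ℕ) : ℝ≥0∞ :=
  ⨆ (A : Fin T → Pt d) (_ : Function.Injective A) (_ : ∀ i, A i ∈ X), infoGain f P σ A

/-! ### GP posterior and the algorithm -/

/-- Regularised kernel matrix `K + σ² I` at the points `xs`. -/
def regGram {d n : ℕ} (k : Pt d → Pt d → ℝ) (σ : ℝ≥0) (xs : Fin n → Pt d) :
    Matrix (Fin n) (Fin n) ℝ :=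
  (Matrix.of fun i j => k (xs i) (xs j)) + ((σ : ℝ) ^ 2) • (1 : Matrix (Fin n) (Fin n) ℝ)

/-- Posterior mean at `z` given the data `(xs i, ys i)`. -/
def postMean {d n : ℕ} (k : Pt d → Pt d → ℝ) (σ : ℝ≥0) (xs : Fin n → Pt d) (ys : Fin n → ℝ)
    (z : Pt d) : ℝ :=
  (fun i => k z (xs i)) ⬝ᵥ ((regGram k σ xs)⁻¹ *ᵥ ys)

/-- Posterior variance at `z` given the query points `xs`. -/
def postVar {d n : ℕ} (k : Pt d → Pt d → ℝ) (σ : ℝ≥0) (xs : Fin n → Pt d) (z : Pt d) : ℝ :=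
  k z z - (fun i => k z (xs i)) ⬝ᵥ ((regGram k σ xs)⁻¹ *ᵥ (fun i => k z (xs i)))

/-- The acquisition function `μ(z) + c^{1/2} σ(z)`. A square root of a negative number is read
as `0`. -/
def ucb {d n : ℕ} (k : Pt d → Pt d → ℝ) (σ : ℝ≥0) (xs : Fin n → Pt d) (ys : Fin n → ℝ)
    (c : ℝ) (z : Pt d) : ℝ :=
  postMean k σ xs ys z + √c * √(postVar k σ xs z)

/-- The two-parameter exponential distribution: the law of `s + Z` with `Z ∼ Exp(lam)`. -/
def twoParamExp (s lam : ℝ) : Measure ℝ :=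
  (expMeasure lam).map (fun z => s + z)

/-- The randomness of the model beside the prior: i.i.d. noise `ε_t ∼ N(0, σ²)` and i.i.d.
`ζ_t` with the two-parameter exponential distribution; `(f(z))_{z ∈ X}`, `(ε_t)_t` and `(ζ_t)_t` are
mutually independent. -/
structure IsNoiseModel {Ω : Type*} [MeasurableSpace Ω] {d : ℕ} (X : Set (Pt d))
    (f : Ω → Pt d → ℝ) (P : Measure Ω) (σ : ℝ≥0) (s lam : ℝ) (ε ζ : ℕ → Ω → ℝ) : Prop where
  measurable_ε : ∀ t, Measurable (ε t)
  measurable_ζ : ∀ t, Measurable (ζ t)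
  law_ε : ∀ t, HasLaw (ε t) (gaussianReal 0 (σ ^ 2)) P
  law_ζ : ∀ t, HasLaw (ζ t) (twoParamExp s lam) P
  indep_ε : iIndepFun ε P
  indep_ζ : iIndepFun ζ P
  indep_noise : IndepFun (fun ω t => ε t ω) (fun ω t => ζ t ω) P
  indep_prior : IndepFun (fun ω (z : X) => f ω z)
    (fun ω => ((fun t => ε t ω), (fun t => ζ t ω))) P

/-- The sequences `x` (queries) and `y` (observations) are produced by IRGP-UCB with confidence
parameters `ζ`. Time starts at `0`, so that `x t`, `y t`, `ζ t` belong to the iteration `t + 1`.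
The query is a maximiser over `X` of the acquisition function given the data obtained so far; which
maximiser is taken is decided by a measurable rule `select` that sees only what the algorithm has
seen: the past observations and the values of `ζ` generated so far (which determine the past
queries). -/
structure IsIRGPUCBRun {Ω : Type*} {d : ℕ} (X : Set (Pt d)) (k : Pt d → Pt d → ℝ)
    (f : Ω → Pt d → ℝ) (σ : ℝ≥0) (ε ζ : ℕ → Ω → ℝ) (x : ℕ → Ω → Pt d) (y : ℕ → Ω → ℝ) :
    Prop where
  observe : ∀ t ω, y t ω = f ω (x t ω) + ε t ω
  mem : ∀ t ω, x t ω ∈ X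
  argmax : ∀ t ω, IsMaxOn
    (ucb k σ (fun i : Fin t => x i ω) (fun i : Fin t => y i ω) (ζ t ω)) X (x t ω)
  nonanticipating : ∃ select : (t : ℕ) → (Fin t → ℝ) × (Fin (t + 1) → ℝ) → Pt d,
    (∀ t, Measurable (select t)) ∧
    ∀ t ω, x t ω = select t (fun i : Fin t => y i ω, fun i : Fin (t + 1) => ζ i ω)

/-! ### Simple regret -/

/-- `f(x*) - max_{t ≤ T} f(x_t)` (for `T ≥ 1`). -/
def simpleRegret {Ω : Type*} {d : ℕ} (f : Ω → Pt d → ℝ) (xstar : Ω → Pt d)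
    (x : ℕ → Ω → Pt d) (T : ℕ) (ω : Ω) : ℝ :=
  f ω (xstar ω) - ⨆ t : Fin T, f ω (x t ω)

/-- The Bayesian simple regret `BSR_T`. -/
def BSR {Ω : Type*} [MeasurableSpace Ω] {d : ℕ} (f : Ω → Pt d → ℝ) (P : Measure Ω)
    (xstar : Ω → Pt d) (x : ℕ → Ω → Pt d) (T : ℕ) : ℝ :=
  ∫ ω, simpleRegret f xstar x T ω ∂P

/-! ### Constants -/

/-- `s_η = 2 d log (2 b d r (√(log (a d)) + √π / 2) / η) - 2 log 2`. -/
def shift (d : ℕ) (r a b η : ℝ) : ℝ :=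
  2 * d * Real.log (2 * b * d * r * (√(Real.log (a * d)) + √Real.pi / 2) / η) - 2 * Real.log 2

/-- `C₁ = 2 / log (1 + σ⁻²)`. -/
def C₁ (σ : ℝ≥0) : ℝ := 2 / Real.log (1 + ((σ : ℝ) ^ 2)⁻¹)

/-- `√(C₁ (2 + s_η) γ_T / T)`; the root of a negative number is read as `0`. -/
def widthBound {Ω : Type*} [MeasurableSpace Ω] {d : ℕ} (X : Set (Pt d)) (f : Ω → Pt d → ℝ)
    (P : Measure Ω) (σ : ℝ≥0) (r a b η : ℝ) (T : ℕ) : ℝ :=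
  √(C₁ σ * (2 + shift d r a b η) * (maxInfoGain X f P σ T).toReal / T)

end

end GPBandit

/-!
Given the observations and the queries up to time `t`, each `f z` is Gaussian with the posterior
mean and variance, although the queries depend on the earlier observations: the likelihood of the
observations is the same as for a fixed design. On a finite net `S ⊆ X` with
`|S| / 2 ≤ exp (s / 2)`, a union bound over Gaussian tails is beaten by the exponential tail of
`ζ = s + Z`, so that `Pr (max_S f > c) ≤ Pr (max_X ucb > c)` for every `c`. Hence the expected
regret against `max_S f` is at most the expected width `E √ζ σ(x_t)` at each time `t`. Averaging
over `t`, the Cauchy–Schwarz inequality and `∑ σ²(x_t) ≤ C₁ γ_T` give `√(C₁ E[ζ⁺] γ_T / T)`.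

The net consists of the points of `X` nearest to the centres of `n ^ d` cubes, with
`n ≤ τ := exp ((s + 2 log 2) / (2 d))`; by the tail bound on the partial derivatives it costs at
most `τ η / (4 n)` in expectation. For `s ≥ 0` take `n = ⌊τ⌋`. For `s < 0` and `1 ≤ τ`, the mean of
`ζ⁺` is `2 exp (s / 2)`, which exceeds `2 + s`; there the bound for `n = 1` is averaged with the
bound `τ η / 2` on the oscillation of `f`. For `τ ≤ 1` the latter bound suffices.
-/

namespace GPBandit

/-! ### Tail bounds -/

section Tails

variable {Ω : Type*} [MeasurableSpace Ω] {P : Measure Ω}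

lemma lintegral_ofReal_eq_lintegral_meas_lt {W : Ω → ℝ} (hW : AEMeasurable W P) :
    ∫⁻ ω, ENNReal.ofReal (W ω) ∂P = ∫⁻ c in Ioi 0, P {ω | c < W ω} := by
  have hmax := lintegral_eq_lintegral_meas_lt P (f := fun ω => max (W ω) 0)
    (ae_of_all _ fun _ => le_max_right _ _) (hW.max aemeasurable_const)
  simp only [ENNReal.ofReal_max, ENNReal.ofReal_zero, zero_le, max_eq_left] at hmax
  rw [hmax]
  refine setLIntegral_congr_fun measurableSet_Ioi fun c hc => congrArg P ?_
  ext ω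
  exact lt_max_iff.trans (or_iff_left (not_lt.2 (mem_Ioi.1 hc).le))

lemma lintegral_ofReal_eq_lintegral_meas_le {W : Ω → ℝ} (hW : AEMeasurable W P) :
    ∫⁻ ω, ENNReal.ofReal (W ω) ∂P = ∫⁻ c in Ioi 0, P {ω | c ≤ W ω} := by
  have hmax := lintegral_eq_lintegral_meas_le P (f := fun ω => max (W ω) 0)
    (ae_of_all _ fun _ => le_max_right _ _) (hW.max aemeasurable_const)
  simp only [ENNReal.ofReal_max, ENNReal.ofReal_zero, zero_le, max_eq_left] at hmax
  rw [hmax]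
  refine setLIntegral_congr_fun measurableSet_Ioi fun c hc => congrArg P ?_
  ext ω
  exact le_max_iff.trans (or_iff_left (not_le.2 (mem_Ioi.1 hc)))

lemma integral_le_integral_of_meas_lt_le [IsProbabilityMeasure P] {U V : Ω → ℝ}
    (hU : Integrable U P) (hV : Integrable V P) (h : ∀ c, P {ω | c < U ω} ≤ P {ω | c < V ω}) :
    ∫ ω, U ω ∂P ≤ ∫ ω, V ω ∂P := by
  have hpos : ∫⁻ ω, ENNReal.ofReal (U ω) ∂P ≤ ∫⁻ ω, ENNReal.ofReal (V ω) ∂P := by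
    rw [lintegral_ofReal_eq_lintegral_meas_lt hU.aemeasurable,
      lintegral_ofReal_eq_lintegral_meas_lt hV.aemeasurable]
    exact lintegral_mono fun c => h c
  have hcompl : ∀ {W : Ω → ℝ} (_ : Integrable W P) (c : ℝ),
      P {ω | c ≤ -W ω} = 1 - P {ω | -c < W ω} := fun {W} hW c => by
    rw [← prob_compl_eq_one_sub₀ (nullMeasurableSet_lt aemeasurable_const hW.aemeasurable)]
    congr 1; ext ω
    rw [mem_ofPred_eq, mem_compl_iff, mem_ofPred_eq, not_lt, le_neg]
  have hneg : ∫⁻ ω, ENNReal.ofReal (-V ω) ∂P ≤ ∫⁻ ω, ENNReal.ofReal (-U ω) ∂P := by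
    rw [lintegral_ofReal_eq_lintegral_meas_le hU.aemeasurable.fun_neg,
      lintegral_ofReal_eq_lintegral_meas_le hV.aemeasurable.fun_neg]
    refine lintegral_mono fun c => ?_
    rw [hcompl hU, hcompl hV]
    exact tsub_le_tsub_left (h _) _
  rw [integral_eq_lintegral_pos_part_sub_lintegral_neg_part hU,
    integral_eq_lintegral_pos_part_sub_lintegral_neg_part hV]
  exact sub_le_sub (ENNReal.toReal_mono hV.lintegral_lt_top.ne hpos)
    (ENNReal.toReal_mono hU.neg.lintegral_lt_top.ne hneg)

lemma lintegral_exp_neg_sq_div_Ioi {b : ℝ} (hb : 0 < b) :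
    ∫⁻ t in Ioi (0 : ℝ), ENNReal.ofReal (Real.exp (-(t / b) ^ 2)) =
      ENNReal.ofReal (b * (√Real.pi / 2)) := by
  have hfun : ∀ t : ℝ, Real.exp (-(t / b) ^ 2) = Real.exp (-(1 / b) ^ 2 * t ^ 2) := fun t => by
    ring_nf
  simp_rw [hfun]
  rw [← ofReal_integral_eq_lintegral_ofReal
    (integrable_exp_neg_mul_sq (by positivity)).integrableOn
    (ae_of_all _ fun _ => (Real.exp_pos _).le), integral_gaussian_Ioi,
    Real.sqrt_div Real.pi_pos.le, Real.sqrt_sq (by positivity)]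
  congr 1
  field_simp

/- With `q = √(log A)`, the tail beyond `b q` is at most `exp (q² - (q + t/b)²) ≤ exp (-(t/b)²)`. -/
lemma lintegral_le_of_subgaussian_tail [IsProbabilityMeasure P] {R : Ω → ℝ}
    (hR : AEMeasurable R P) {A b : ℝ} (hb : 0 < b)
    (h : ∀ L : ℝ, 0 < L → P {ω | L < R ω} ≤ ENNReal.ofReal (A * Real.exp (-(L / b) ^ 2))) :
    ∫⁻ ω, ENNReal.ofReal (R ω) ∂P ≤
      ENNReal.ofReal (b * (√(Real.log A) + √Real.pi / 2)) := by
  set q := √(Real.log A) with hq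
  have : 0 ≤ q := Real.sqrt_nonneg _
  have hAq : A ≤ Real.exp (q ^ 2) := by
    rcases le_or_gt A 1 with h1 | h1
    · exact h1.trans (Real.one_le_exp (sq_nonneg _))
    · rw [hq, Real.sq_sqrt (Real.log_nonneg h1.le), Real.exp_log (by linarith)]
  have htail : ∀ t ∈ Ioi (0 : ℝ), P {ω | t < R ω - b * q} ≤
      ENNReal.ofReal (Real.exp (-(t / b) ^ 2)) := by
    intro t (ht : 0 < t)
    simp_rw [lt_sub_iff_add_lt]
    refine (h _ (by positivity)).trans (ENNReal.ofReal_le_ofReal ?_)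
    calc A * Real.exp (-((t + b * q) / b) ^ 2)
        ≤ Real.exp (q ^ 2) * Real.exp (-((t + b * q) / b) ^ 2) := by gcongr
      _ = Real.exp (-(t / b) ^ 2 - 2 * (q * (t / b))) := by
        rw [← Real.exp_add]
        congr 1
        field_simp
        ring
      _ ≤ Real.exp (-(t / b) ^ 2) := by
        gcongr
        have : 0 ≤ q * (t / b) := by positivity
        linarith
  calc ∫⁻ ω, ENNReal.ofReal (R ω) ∂P
      ≤ ∫⁻ ω, (ENNReal.ofReal (b * q) + ENNReal.ofReal (R ω - b * q)) ∂P :=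
        lintegral_mono fun ω => (ENNReal.ofReal_le_ofReal (by simp)).trans ENNReal.ofReal_add_le
    _ = ENNReal.ofReal (b * q) + ∫⁻ t in Ioi 0, P {ω | t < R ω - b * q} := by
        rw [lintegral_add_left measurable_const, lintegral_const, measure_univ, mul_one,
          lintegral_ofReal_eq_lintegral_meas_lt (hR.sub_const _)]
    _ ≤ ENNReal.ofReal (b * q) + ENNReal.ofReal (b * (√Real.pi / 2)) := by
        rw [← lintegral_exp_neg_sq_div_Ioi hb]
        gcongr _ + ?_
        exact setLIntegral_mono (by fun_prop) htail
    _ = ENNReal.ofReal (b * (q + √Real.pi / 2)) := by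
        rw [← ENNReal.ofReal_add (by positivity) (by positivity), mul_add]

lemma integral_sqrt_le_sqrt_integral [IsProbabilityMeasure P] {Z : Ω → ℝ} (hZ : Integrable Z P)
    (hZ0 : 0 ≤ᵐ[P] Z) : Integrable (fun ω => √(Z ω)) P ∧ ∫ ω, √(Z ω) ∂P ≤ √(∫ ω, Z ω ∂P) := by
  have hint : Integrable (fun ω => √(Z ω)) P := by
    refine (hZ.add (integrable_const 1)).mono'
      hZ.aestronglyMeasurable.aemeasurable.sqrt.aestronglyMeasurable ?_
    filter_upwards [hZ0] with ω (hω : 0 ≤ Z ω)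
    rw [Real.norm_of_nonneg (Real.sqrt_nonneg _)]
    exact Real.sqrt_le_iff.2 ⟨by simp; linarith, by simp; nlinarith⟩
  refine ⟨hint, ?_⟩
  exact Real.strictConcaveOn_sqrt.concaveOn.le_map_integral Real.continuous_sqrt.continuousOn
    isClosed_Ici (hZ0.mono fun _ h => h) hZ hint

end Tails

section Gaussian

lemma gaussianReal_zero_Ioi_zero_le (v : ℝ≥0) :
    gaussianReal 0 v (Ioi 0) ≤ ENNReal.ofReal (1 / 2) := by
  have hneg : gaussianReal 0 v (Iio 0) = gaussianReal 0 v (Ioi 0) := by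
    have hmap := gaussianReal_map_neg (μ := 0) (v := v)
    rw [neg_zero] at hmap
    conv_lhs => rw [← hmap, Measure.map_apply measurable_neg measurableSet_Iio]
    simp
  have hsum : gaussianReal 0 v (Iio 0) + gaussianReal 0 v (Ioi 0) ≤ 1 := by
    rw [← measure_union ((Iic_disjoint_Ioi le_rfl).mono_left Iio_subset_Iic_self) measurableSet_Ioi]
    exact prob_le_one
  rw [hneg, ← two_mul] at hsum
  rw [ENNReal.ofReal_div_of_pos two_pos, ENNReal.ofReal_one, ENNReal.ofReal_ofNat,
    ENNReal.le_div_iff_mul_le (by simp) (by simp), mul_comm]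
  exact hsum

lemma gaussianReal_Ioi_le (μ : ℝ) {v : ℝ≥0} (hv : v ≠ 0) {b : ℝ} (hb : 0 ≤ b) :
    gaussianReal μ v (Ioi (μ + b)) ≤ ENNReal.ofReal (1 / 2 * Real.exp (-(b ^ 2 / (2 * v)))) := by
  have htranslate : gaussianReal μ v (Ioi (μ + b)) = gaussianReal (-b) v (Ioi 0) := by
    have hmap := gaussianReal_map_const_add (μ := -b) (v := v) (μ + b)
    rw [show -b + (μ + b) = μ by ring] at hmap
    rw [← hmap, Measure.map_apply (measurable_const_add _) measurableSet_Ioi]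
    simp
  have hpdf : ∀ x ∈ Ioi (0 : ℝ), gaussianPDF (-b) v x ≤
      ENNReal.ofReal (Real.exp (-(b ^ 2 / (2 * v)))) * gaussianPDF 0 v x := by
    intro x (hx : 0 < x)
    rw [gaussianPDF, gaussianPDF, ← ENNReal.ofReal_mul (by positivity)]
    apply ENNReal.ofReal_le_ofReal
    rw [gaussianPDFReal, gaussianPDFReal, mul_left_comm, ← Real.exp_add, neg_div, neg_div,
      ← neg_add, ← add_div]
    gcongr
    nlinarith
  rw [htranslate, gaussianReal_apply _ hv]
  calc ∫⁻ x in Ioi 0, gaussianPDF (-b) v x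
      ≤ ∫⁻ x in Ioi 0, ENNReal.ofReal (Real.exp (-(b ^ 2 / (2 * v)))) * gaussianPDF 0 v x :=
        setLIntegral_mono ((measurable_gaussianPDF _ _).const_mul _) hpdf
    _ = ENNReal.ofReal (Real.exp (-(b ^ 2 / (2 * v)))) * gaussianReal 0 v (Ioi 0) := by
        rw [lintegral_const_mul _ (measurable_gaussianPDF _ _), ← gaussianReal_apply _ hv]
    _ ≤ ENNReal.ofReal (Real.exp (-(b ^ 2 / (2 * v)))) * ENNReal.ofReal (1 / 2) := by
        gcongr; exact gaussianReal_zero_Ioi_zero_le v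
    _ = _ := by rw [← ENNReal.ofReal_mul (by positivity), mul_comm]

end Gaussian

section TwoParamExp

variable {l : ℝ}

lemma isProbabilityMeasure_twoParamExp (s : ℝ) (hl : 0 < l) :
    IsProbabilityMeasure (twoParamExp s l) :=
  have := isProbabilityMeasure_expMeasure hl
  Measure.isProbabilityMeasure_map (measurable_const_add s).aemeasurable

lemma twoParamExp_Ioi (s : ℝ) (hl : 0 < l) (c : ℝ) :
    twoParamExp s l (Ioi c) =
      if s ≤ c then ENNReal.ofReal (Real.exp (-(l * (c - s)))) else 1 := by
  have := isProbabilityMeasure_expMeasure hl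
  have hpre : (fun z : ℝ => s + z) ⁻¹' Ioi c = (Iic (c - s))ᶜ := by
    ext z; simp [sub_lt_iff_lt_add']
  have hcdf := cdf_expMeasure_eq hl (c - s)
  rw [cdf_eq_real] at hcdf
  rw [twoParamExp, Measure.map_apply (measurable_const_add s) measurableSet_Ioi, hpre,
    ← ofReal_measureReal (h := measure_ne_top _ _), measureReal_compl measurableSet_Iic, hcdf]
  simp only [sub_nonneg, probReal_univ]
  split_ifs <;> simp

/-- The mean of `ζ⁺` for `ζ` with law `twoParamExp s l`. -/
noncomputable def posPartMean (s l : ℝ) : ℝ := if 0 ≤ s then s + 1 / l else Real.exp (l * s) / l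

lemma posPartMean_pos (s : ℝ) (hl : 0 < l) : 0 < posPartMean s l := by
  unfold posPartMean
  split_ifs <;> positivity

lemma lintegral_exp_neg_mul_sub_Ioi (s c : ℝ) (hl : 0 < l) :
    ∫⁻ x in Ioi c, ENNReal.ofReal (Real.exp (-(l * (x - s)))) =
      ENNReal.ofReal (Real.exp (-(l * (c - s))) / l) := by
  have hfun : ∀ x : ℝ, Real.exp (-(l * (x - s))) = Real.exp (l * s) * Real.exp (-l * x) :=
    fun x => by rw [← Real.exp_add]; ring_nf
  have hint := integrableOn_exp_mul_Ioi (neg_neg_of_pos hl) c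
  simp_rw [hfun]
  rw [← ofReal_integral_eq_lintegral_ofReal (hint.const_mul _)
    (ae_of_all _ fun _ => by positivity), integral_const_mul,
    integral_exp_mul_Ioi (neg_neg_of_pos hl), neg_div_neg_eq, mul_div_assoc]

lemma lintegral_twoParamExp (s : ℝ) (hl : 0 < l) :
    ∫⁻ z, ENNReal.ofReal z ∂twoParamExp s l = ENNReal.ofReal (posPartMean s l) := by
  have hIoi : ∀ c, s ≤ c → ∫⁻ z in Ioi c, twoParamExp s l (Ioi z) =
      ENNReal.ofReal (Real.exp (-(l * (c - s))) / l) := fun c hc => by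
    rw [← lintegral_exp_neg_mul_sub_Ioi s c hl]
    refine setLIntegral_congr_fun measurableSet_Ioi fun z hz => ?_
    rw [twoParamExp_Ioi s hl, if_pos (hc.trans (le_of_lt hz))]
  rw [lintegral_ofReal_eq_lintegral_meas_lt (W := fun z => z) aemeasurable_id, posPartMean]
  change ∫⁻ c in Ioi 0, twoParamExp s l (Ioi c) = _
  split_ifs with hs
  · have hIoc : ∫⁻ c in Ioc 0 s, twoParamExp s l (Ioi c) = ENNReal.ofReal s := by
      rw [setLIntegral_congr Ioo_ae_eq_Ioc.symm, setLIntegral_congr_fun (g := 1) measurableSet_Ioo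
        fun c hc => by rw [twoParamExp_Ioi s hl, if_neg (not_le.2 hc.2), Pi.one_apply]]
      simp
    rw [← Ioc_union_Ioi_eq_Ioi hs, lintegral_union measurableSet_Ioi
      (Set.disjoint_left.2 fun _ h h' => not_lt.2 h.2 h'), hIoc, hIoi s le_rfl,
      ← ENNReal.ofReal_add hs (by positivity)]
    simp
  · rw [hIoi 0 (not_le.1 hs).le]
    simp

end TwoParamExp

section UnionBound

variable {α : Type*} {S : Finset α} {μ : α → ℝ} {v : α → ℝ≥0} {c : ℝ}

lemma gaussianReal_Ioi_le_of_le_div_sqrt {m c q : ℝ} {v : ℝ≥0} (hmc : m ≤ c) (hq : 0 ≤ q)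
    (h : v ≠ 0 → q ≤ (c - m) / √v) :
    gaussianReal m v (Ioi c) ≤ ENNReal.ofReal (1 / 2 * Real.exp (-(q ^ 2 / 2))) := by
  rcases eq_or_ne v 0 with rfl | hv
  · rw [gaussianReal_zero_var, Measure.dirac_apply' _ measurableSet_Ioi,
      indicator_of_notMem (notMem_Ioi.2 hmc)]
    exact zero_le
  · have htail := gaussianReal_Ioi_le m hv (sub_nonneg.2 hmc)
    rw [add_sub_cancel] at htail
    refine htail.trans (ENNReal.ofReal_le_ofReal ?_)
    have hsq : (c - m) ^ 2 / (2 * v) = ((c - m) / √v) ^ 2 / 2 := by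
      rw [div_pow, Real.sq_sqrt v.coe_nonneg, div_div, mul_comm]
    rw [hsq]
    gcongr
    exact h hv

lemma sum_gaussianReal_Ioi_le {s q : ℝ} (hS : (S.card : ℝ) / 2 ≤ Real.exp (s / 2))
    (h : ∀ z ∈ S, gaussianReal (μ z) (v z) (Ioi c) ≤
      ENNReal.ofReal (1 / 2 * Real.exp (-(q ^ 2 / 2)))) :
    ∑ z ∈ S, gaussianReal (μ z) (v z) (Ioi c) ≤
      ENNReal.ofReal (Real.exp (-(1 / 2 * (q ^ 2 - s)))) := by
  refine (Finset.sum_le_card_nsmul _ _ _ h).trans ?_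
  rw [nsmul_eq_mul, ← ENNReal.ofReal_natCast, ← ENNReal.ofReal_mul (by positivity)]
  apply ENNReal.ofReal_le_ofReal
  calc (S.card : ℝ) * (1 / 2 * Real.exp (-(q ^ 2 / 2)))
      = S.card / 2 * Real.exp (-(q ^ 2 / 2)) := by ring
    _ ≤ Real.exp (s / 2) * Real.exp (-(q ^ 2 / 2)) := by gcongr
    _ = Real.exp (-(1 / 2 * (q ^ 2 - s))) := by rw [← Real.exp_add]; ring_nf

/- If `q` is the least standardised distance of `c` from the means, the right-hand side is at least
`Pr (ζ > q²)`, and each Gaussian tail is at most `exp (-q² / 2) / 2`. -/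
lemma min_sum_gaussianReal_le_twoParamExp (s : ℝ) (hS : (S.card : ℝ) / 2 ≤ Real.exp (s / 2)) :
    min 1 (∑ z ∈ S, gaussianReal (μ z) (v z) (Ioi c)) ≤
      twoParamExp s (1 / 2) {ζ | ∃ z ∈ S, c < μ z + √ζ * √(v z)} := by
  have := isProbabilityMeasure_twoParamExp s one_half_pos
  by_cases! hc : ∃ z ∈ S, c < μ z
  · obtain ⟨z, hz, hcz⟩ := hc
    have huniv : {ζ : ℝ | ∃ z ∈ S, c < μ z + √ζ * √(v z)} = univ :=
      eq_univ_of_forall fun ζ => ⟨z, hz, lt_add_of_lt_of_nonneg hcz (by positivity)⟩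
    rw [huniv, measure_univ]
    exact min_le_left _ _
  rcases (S.filter (v · ≠ 0)).eq_empty_or_nonempty with hempty | hne
  · have hzero : ∀ z ∈ S, gaussianReal (μ z) (v z) (Ioi c) = 0 := fun z hz => by
      rw [not_not.1 (Finset.filter_eq_empty_iff.1 hempty hz), gaussianReal_zero_var,
        Measure.dirac_apply' _ measurableSet_Ioi, indicator_of_notMem (notMem_Ioi.2 (hc z hz))]
    rw [Finset.sum_eq_zero hzero]
    simp
  obtain ⟨z₀, hz₀, hmin⟩ := (S.filter (v · ≠ 0)).exists_min_image (fun z => (c - μ z) / √(v z)) hne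
  obtain ⟨hz₀S, hv₀⟩ := Finset.mem_filter.1 hz₀
  set q := (c - μ z₀) / √(v z₀)
  have hq0 : 0 ≤ q := div_nonneg (sub_nonneg.2 (hc _ hz₀S)) (Real.sqrt_nonneg _)
  have hsub : Ioi (q ^ 2) ⊆ {ζ : ℝ | ∃ z ∈ S, c < μ z + √ζ * √(v z)} := fun ζ hζ => by
    refine ⟨z₀, hz₀S, sub_lt_iff_lt_add'.1 ?_⟩
    rw [← div_lt_iff₀ (by positivity)]
    exact (Real.lt_sqrt hq0).2 hζ
  refine le_trans ?_ (measure_mono hsub)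
  rw [twoParamExp_Ioi s one_half_pos]
  split_ifs
  · exact (min_le_right _ _).trans (sum_gaussianReal_Ioi_le hS fun z hz =>
      gaussianReal_Ioi_le_of_le_div_sqrt (hc z hz) hq0 fun hvz =>
        hmin z (Finset.mem_filter.2 ⟨hz, hvz⟩))
  · exact min_le_left _ _

end UnionBound

/-! ### Gaussian conditional distributions and regression -/

section Conditioning

variable {Ω 𝓧 𝓨 𝓩 : Type*} [MeasurableSpace Ω] [MeasurableSpace 𝓧] [MeasurableSpace 𝓨]
  [MeasurableSpace 𝓩] {P : Measure Ω}

lemma indepFun_prodMk_of_indepFun_prodMk [IsProbabilityMeasure P] {X : Ω → 𝓧} {Y : Ω → 𝓨}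
    {Z : Ω → 𝓩} (hX : AEMeasurable X P) (hY : AEMeasurable Y P) (hZ : AEMeasurable Z P)
    (hXY : IndepFun X Y P) (hXYZ : IndepFun (fun ω => (X ω, Y ω)) Z P) :
    IndepFun X (fun ω => (Y ω, Z ω)) P := by
  have hYZ : IndepFun Y Z P := hXYZ.comp measurable_snd measurable_id
  have := Measure.isProbabilityMeasure_map hX
  have := Measure.isProbabilityMeasure_map hY
  have := Measure.isProbabilityMeasure_map hZ
  rw [indepFun_iff_map_prod_eq_prod_map_map (hX.prodMk hY) hZ, hXY.map_prod_eq_prod_map_map hX hY]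
    at hXYZ
  rw [indepFun_iff_map_prod_eq_prod_map_map hX (hY.prodMk hZ), hYZ.map_prod_eq_prod_map_map hY hZ,
    ← Measure.prodAssoc_prod, ← hXYZ, AEMeasurable.map_map_of_aemeasurable
      MeasurableEquiv.prodAssoc.measurable.aemeasurable ((hX.prodMk hY).prodMk hZ)]
  rfl

/-- The kernel `x ↦ N(m x, v x)`. -/
noncomputable def gaussianKernel {m : 𝓧 → ℝ} {v : 𝓧 → ℝ≥0} (hm : Measurable m)
    (hv : Measurable v) : Kernel 𝓧 ℝ where
  toFun x := gaussianReal (m x) (v x)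
  measurable' := measurable_gaussianReal.comp (hm.prodMk hv)

instance {m : 𝓧 → ℝ} {v : 𝓧 → ℝ≥0} (hm : Measurable m) (hv : Measurable v) :
    IsMarkovKernel (gaussianKernel hm hv) :=
  ⟨fun x => inferInstanceAs (IsProbabilityMeasure (gaussianReal (m x) (v x)))⟩

lemma lintegral_of_hasCondDistrib [SFinite P] {X : Ω → 𝓧} {Y : Ω → 𝓨} {κ : Kernel 𝓧 𝓨}
    [IsSFiniteKernel κ] (h : HasCondDistrib Y X κ P) {G : 𝓧 × 𝓨 → ℝ≥0∞} (hG : Measurable G) :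
    ∫⁻ ω, G (X ω, Y ω) ∂P = ∫⁻ ω, ∫⁻ y, G (X ω, y) ∂κ (X ω) ∂P := by
  rw [← lintegral_map' hG.aemeasurable h.aemeasurable, HasLaw.map_eq h,
    Measure.lintegral_compProd hG,
    lintegral_map' hG.lintegral_kernel_prod_right'.aemeasurable h.aemeasurable_fst]

lemma hasCondDistrib_gaussianKernel_of_lintegral [IsProbabilityMeasure P] {X : Ω → 𝓧} {Y : Ω → ℝ}
    {m : 𝓧 → ℝ} {v : 𝓧 → ℝ≥0} (hX : AEMeasurable X P) (hY : AEMeasurable Y P) (hm : Measurable m)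
    (hv : Measurable v) (h : ∀ G : 𝓧 × ℝ → ℝ≥0∞, Measurable G → ∫⁻ ω, G (X ω, Y ω) ∂P =
      ∫⁻ ω, ∫⁻ y, G (X ω, y) ∂gaussianReal (m (X ω)) (v (X ω)) ∂P) :
    HasCondDistrib Y X (gaussianKernel hm hv) P where
  aemeasurable := hX.prodMk hY
  map_eq := by
    refine Measure.ext_of_lintegral _ fun G hG => ?_
    rw [Measure.lintegral_compProd hG, lintegral_map' hG.aemeasurable (hX.prodMk hY), h G hG,
      lintegral_map' hG.lintegral_kernel_prod_right'.aemeasurable hX]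
    rfl

lemma hasCondDistrib_of_indepFun_sub [IsProbabilityMeasure P] {X : Ω → 𝓧} {Y : Ω → ℝ} {m : 𝓧 → ℝ}
    {v : ℝ≥0} (hX : AEMeasurable X P) (hm : Measurable m)
    (hlaw : HasLaw (fun ω => Y ω - m (X ω)) (gaussianReal 0 v) P)
    (hind : IndepFun (fun ω => Y ω - m (X ω)) X P) :
    HasCondDistrib Y X (gaussianKernel hm (measurable_const (a := v))) P := by
  have hY : AEMeasurable Y P :=
    (hlaw.aemeasurable.add (hm.comp_aemeasurable hX)).congr (.of_forall fun ω => by simp)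
  refine hasCondDistrib_gaussianKernel_of_lintegral hX hY hm measurable_const fun G hG => ?_
  have hG' : Measurable fun q : ℝ × 𝓧 => G (q.2, m q.2 + q.1) := by fun_prop
  have := Measure.isProbabilityMeasure_map hX
  calc ∫⁻ ω, G (X ω, Y ω) ∂P = ∫⁻ ω, G (X ω, m (X ω) + (Y ω - m (X ω))) ∂P := by
        simp only [add_sub_cancel]
    _ = ∫⁻ q, G (q.2, m q.2 + q.1) ∂(gaussianReal 0 v).prod (P.map X) := by
        rw [← hlaw.map_eq, ← hind.map_prod_eq_prod_map_map hlaw.aemeasurable hX,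
          lintegral_map' hG'.aemeasurable (hlaw.aemeasurable.prodMk hX)]
    _ = ∫⁻ ω, ∫⁻ e, G (X ω, m (X ω) + e) ∂gaussianReal 0 v ∂P := by
        rw [lintegral_prod_symm' _ hG', lintegral_map' hG'.lintegral_prod_left'.aemeasurable hX]
    _ = ∫⁻ ω, ∫⁻ y, G (X ω, y) ∂gaussianReal (m (X ω)) v ∂P := by
        refine lintegral_congr fun ω => ?_
        have hmap := gaussianReal_map_const_add (μ := 0) (v := v) (m (X ω))
        rw [zero_add] at hmap
        rw [← hmap, lintegral_map (by fun_prop) (by fun_prop)]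

end Conditioning

section Regression

variable {Ω ι : Type*} [MeasurableSpace Ω] [Fintype ι] [DecidableEq ι] {P : Measure Ω}
  {V : Ω → ℝ} {Y : Ω → ι → ℝ} {G : Matrix ι ι ℝ} {c : ι → ℝ}

lemma covariance_sub_dotProduct_eq_zero [IsFiniteMeasure P] (hV : MemLp V 2 P)
    (hY : ∀ i, MemLp (fun ω => Y ω i) 2 P)
    (hcov : ∀ i j, cov[fun ω => Y ω i, fun ω => Y ω j; P] = G i j)
    (hcross : ∀ i, cov[V, fun ω => Y ω i; P] = c i) (hG : IsUnit G) (j : ι) :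
    cov[fun ω => V ω - c ⬝ᵥ (G⁻¹ *ᵥ Y ω), fun ω => Y ω j; P] = 0 := by
  have hw : ∀ i, MemLp (fun ω => (c ᵥ* G⁻¹) i * Y ω i) 2 P := fun i => (hY i).const_mul _
  have hinv : c ᵥ* G⁻¹ ᵥ* G = c := by
    rw [Matrix.vecMul_vecMul, Matrix.nonsing_inv_mul _ ((Matrix.isUnit_iff_isUnit_det _).1 hG),
      Matrix.vecMul_one]
  simp only [Matrix.dotProduct_mulVec]
  simp only [dotProduct]
  rw [covariance_fun_sub_left hV (memLp_finsetSum _ fun i _ => hw i) (hY j),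
    covariance_fun_sum_left hw (hY j)]
  simp only [covariance_const_mul_left, hcov, hcross]
  exact sub_eq_zero.2 (congrFun hinv j).symm

lemma variance_sub_dotProduct [IsFiniteMeasure P] (hV : MemLp V 2 P)
    (hY : ∀ i, MemLp (fun ω => Y ω i) 2 P)
    (hcov : ∀ i j, cov[fun ω => Y ω i, fun ω => Y ω j; P] = G i j)
    (hcross : ∀ i, cov[V, fun ω => Y ω i; P] = c i) (hG : IsUnit G) :
    Var[fun ω => V ω - c ⬝ᵥ (G⁻¹ *ᵥ Y ω); P] = Var[V; P] - c ⬝ᵥ (G⁻¹ *ᵥ c) := by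
  have hw : ∀ i, MemLp (fun ω => (c ᵥ* G⁻¹) i * Y ω i) 2 P := fun i => (hY i).const_mul _
  have hW := memLp_finsetSum Finset.univ fun i _ => hw i
  have hzero := covariance_sub_dotProduct_eq_zero hV hY hcov hcross hG
  simp only [Matrix.dotProduct_mulVec] at hzero ⊢
  simp only [dotProduct] at hzero ⊢
  have hR : MemLp (fun ω => V ω - ∑ i, (c ᵥ* G⁻¹) i * Y ω i) 2 P := hV.sub hW
  rw [← covariance_self hR.aestronglyMeasurable.aemeasurable, covariance_fun_sub_right hR hV hW,
    covariance_fun_sum_right hw hR, covariance_fun_sub_left hV hW hV,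
    covariance_self hV.aestronglyMeasurable.aemeasurable, covariance_fun_sum_left hw hV]
  simp only [covariance_const_mul_right, covariance_comm _ V, hcross,
    hzero, mul_zero, Finset.sum_const_zero, sub_zero]

/-- The hypotheses of Gaussian regression: `V` and `(Y i)_i` are jointly Gaussian and centered,
`Y` has the invertible covariance matrix `G`, and `c i` is the covariance of `V` and `Y i`. -/
structure IsGaussianRegression (P : Measure Ω) (V : Ω → ℝ) (Y : Ω → ι → ℝ) (G : Matrix ι ι ℝ)
    (c : ι → ℝ) : Prop where
  hasGaussianLaw : HasGaussianLaw (fun ω => (V ω, Y ω)) P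
  mean_target : ∫ ω, V ω ∂P = 0
  mean_data : ∀ i, ∫ ω, Y ω i ∂P = 0
  covariance_data : ∀ i j, cov[fun ω => Y ω i, fun ω => Y ω j; P] = G i j
  covariance_target : ∀ i, cov[V, fun ω => Y ω i; P] = c i
  isUnit : IsUnit G

namespace IsGaussianRegression

lemma memLp_target (h : IsGaussianRegression P V Y G c) : MemLp V 2 P :=
  h.hasGaussianLaw.fst.memLp_two

lemma memLp_data (h : IsGaussianRegression P V Y G c) (i : ι) : MemLp (fun ω => Y ω i) 2 P :=
  (h.hasGaussianLaw.snd.eval i).memLp_two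

lemma hasGaussianLaw_residual (h : IsGaussianRegression P V Y G c) :
    HasGaussianLaw (fun ω => (V ω - c ⬝ᵥ (G⁻¹ *ᵥ Y ω), Y ω)) P := by
  let L : ℝ × (ι → ℝ) →ₗ[ℝ] ℝ × (ι → ℝ) :=
    (LinearMap.fst ℝ ℝ (ι → ℝ) - dotProductBilin ℝ ℝ c ∘ₗ G⁻¹.mulVecLin ∘ₗ
      LinearMap.snd ℝ ℝ (ι → ℝ)).prod (LinearMap.snd ℝ ℝ (ι → ℝ))
  exact h.hasGaussianLaw.map_fun L.toContinuousLinearMap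

lemma variance_residual (h : IsGaussianRegression P V Y G c) :
    Var[fun ω => V ω - c ⬝ᵥ (G⁻¹ *ᵥ Y ω); P] = Var[V; P] - c ⬝ᵥ (G⁻¹ *ᵥ c) :=
  have := h.hasGaussianLaw.isProbabilityMeasure
  variance_sub_dotProduct h.memLp_target h.memLp_data h.covariance_data h.covariance_target h.isUnit

lemma hasLaw_residual (h : IsGaussianRegression P V Y G c) :
    HasLaw (fun ω => V ω - c ⬝ᵥ (G⁻¹ *ᵥ Y ω))
      (gaussianReal 0 (Var[V; P] - c ⬝ᵥ (G⁻¹ *ᵥ c)).toNNReal) P := by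
  have := h.hasGaussianLaw.isProbabilityMeasure
  have hgauss := h.hasGaussianLaw_residual.fst
  refine ⟨hgauss.aemeasurable, ?_⟩
  have hint : ∀ i, Integrable (fun ω => (c ᵥ* G⁻¹) i * Y ω i) P := fun i =>
    ((h.memLp_data i).integrable one_le_two).const_mul _
  have hmean : ∫ ω, V ω - c ⬝ᵥ (G⁻¹ *ᵥ Y ω) ∂P = 0 := by
    simp only [Matrix.dotProduct_mulVec]
    simp only [dotProduct]
    rw [integral_sub (h.memLp_target.integrable one_le_two)
        (integrable_finsetSum _ fun i _ => hint i),
      integral_finsetSum _ fun i _ => hint i, h.mean_target]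
    simp only [integral_const_mul, h.mean_data, mul_zero, Finset.sum_const_zero, sub_zero]
  rw [hgauss.map_eq_gaussianReal, hmean, h.variance_residual]

lemma indepFun_residual (h : IsGaussianRegression P V Y G c) :
    IndepFun (fun ω => V ω - c ⬝ᵥ (G⁻¹ *ᵥ Y ω)) Y P := by
  have := h.hasGaussianLaw.isProbabilityMeasure
  have hgauss : HasGaussianLaw (fun ω => (fun _ : Unit => V ω - c ⬝ᵥ (G⁻¹ *ᵥ Y ω), Y ω)) P :=
    h.hasGaussianLaw_residual.map_fun ((ContinuousLinearMap.pi fun _ : Unit =>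
      ContinuousLinearMap.fst ℝ ℝ (ι → ℝ)).prod (ContinuousLinearMap.snd ℝ ℝ (ι → ℝ)))
  exact (hgauss.indepFun_of_covariance_eval fun _ j =>
    covariance_sub_dotProduct_eq_zero h.memLp_target h.memLp_data h.covariance_data
      h.covariance_target h.isUnit j).comp (measurable_pi_apply ()) measurable_id

lemma measurable_prediction : Measurable fun y : ι → ℝ => c ⬝ᵥ (G⁻¹ *ᵥ y) := by
  simp only [dotProduct, Matrix.mulVec]
  fun_prop

lemma hasCondDistrib (h : IsGaussianRegression P V Y G c) :
    HasCondDistrib V Y (gaussianKernel (measurable_prediction (G := G) (c := c))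
      (measurable_const (a := (Var[V; P] - c ⬝ᵥ (G⁻¹ *ᵥ c)).toNNReal))) P :=
  have := h.hasGaussianLaw.isProbabilityMeasure
  hasCondDistrib_of_indepFun_sub h.hasGaussianLaw.snd.aemeasurable measurable_prediction
    h.hasLaw_residual h.indepFun_residual

lemma residual_variance_nonneg (h : IsGaussianRegression P V Y G c) :
    0 ≤ Var[V; P] - c ⬝ᵥ (G⁻¹ *ᵥ c) :=
  h.variance_residual ▸ variance_nonneg _ _

end IsGaussianRegression

end Regression

/-! ### Gaussian autoregressions -/

section Past

variable {α : Type*} {n : ℕ}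

/-- The first `i` entries of `y`. -/
abbrev past (y : Fin n → α) (i : Fin n) : Fin i → α := fun j => y (Fin.castLE i.is_le' j)

lemma past_castSucc (y : Fin (n + 1) → α) (i : Fin n) : past y i.castSucc = past (Fin.init y) i :=
  rfl

lemma past_last (y : Fin (n + 1) → α) : past y (Fin.last n) = Fin.init y := rfl

lemma measurable_snoc {α : Type*} [MeasurableSpace α] {Ω : Type*} [MeasurableSpace Ω]
    {h : Ω → Fin n → α} {u : Ω → α} (hh : Measurable h) (hu : Measurable u) :
    Measurable fun ω => (Fin.snoc (α := fun _ => α) (h ω) (u ω) : Fin (n + 1) → α) := by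
  refine measurable_pi_lambda _ fun i => ?_
  induction i using Fin.lastCases with
  | last => simpa using hu
  | cast j => simpa using measurable_pi_iff.1 hh j

lemma lintegral_pi_succ (μ : Measure ℝ) [SigmaFinite μ] {g : (Fin (n + 1) → ℝ) → ℝ≥0∞}
    (hg : Measurable g) :
    ∫⁻ e, g e ∂Measure.pi (fun _ : Fin (n + 1) => μ) =
      ∫⁻ h, ∫⁻ u, g (Fin.snoc (α := fun _ => ℝ) h u) ∂μ ∂Measure.pi (fun _ : Fin n => μ) := by
  have hmp := (measurePreserving_piFinSuccAbove (fun _ : Fin (n + 1) => μ) (Fin.last n)).symm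
  rw [← hmp.lintegral_comp hg]
  refine (lintegral_prod_symm' _ (hg.comp hmp.measurable)).trans ?_
  exact lintegral_congr fun h => lintegral_congr fun u => congrArg g (Fin.insertNth_last' _ _)

end Past

section Autoregression

variable {Ω Θ : Type*} [MeasurableSpace Ω] [MeasurableSpace Θ] {P : Measure Ω} {n : ℕ}

lemma measurable_gaussianPDF_comp {m x : Θ → ℝ} (hm : Measurable m) (v : ℝ≥0)
    (hx : Measurable x) : Measurable fun a => gaussianPDF (m a) v (x a) :=
  measurable_uncurry_gaussianPDF.comp (hm.prodMk (measurable_const.prodMk hx))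

/-- The conditional density at `y` of an autoregression with the parameter `θ`, conditional means
`m i (θ, y_0, …, y_{i-1})` and conditional variances `v i`. -/
noncomputable def autoregressionDensity (m : (i : Fin n) → Θ × (Fin i → ℝ) → ℝ) (v : Fin n → ℝ≥0)
    (p : Θ × (Fin n → ℝ)) : ℝ≥0∞ :=
  ∏ i, gaussianPDF (m i (p.1, past p.2 i)) (v i) (p.2 i)

/-- Given `θ` and `Y 0, …, Y (i - 1)`, the variable `Y i` is Gaussian with mean
`m i (θ, Y 0, …, Y (i - 1))` and variance `v i`. -/
structure IsGaussianAutoregression (P : Measure Ω) (θ : Ω → Θ) (Y : Fin n → Ω → ℝ)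
    (m : (i : Fin n) → Θ × (Fin i → ℝ) → ℝ) (v : Fin n → ℝ≥0) : Prop where
  aemeasurable_parameter : AEMeasurable θ P
  measurable_mean : ∀ i, Measurable (m i)
  variance_ne_zero : ∀ i, v i ≠ 0
  hasCondDistrib : ∀ i, HasCondDistrib (Y i) (fun ω => (θ ω, past (Y · ω) i))
    (gaussianKernel (measurable_mean i) (measurable_const (a := v i))) P

variable {m : (i : Fin n) → Θ × (Fin i → ℝ) → ℝ} {v : Fin n → ℝ≥0}

lemma measurable_autoregressionDensity (hm : ∀ i, Measurable (m i)) :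
    Measurable (autoregressionDensity m v) := by
  unfold autoregressionDensity
  refine Finset.measurable_fun_prod _ fun i _ => measurable_gaussianPDF_comp ?_ (v i) (by fun_prop)
  exact (hm i).comp (by fun_prop)

lemma autoregressionDensity_snoc {Θ : Type*} {m : (i : Fin (n + 1)) → Θ × (Fin i → ℝ) → ℝ}
    {v : Fin (n + 1) → ℝ≥0} (θ : Θ) (h : Fin n → ℝ) (u : ℝ) :
    autoregressionDensity m v (θ, Fin.snoc (α := fun _ => ℝ) h u) =
      autoregressionDensity (fun i : Fin n => m i.castSucc) (fun i => v i.castSucc) (θ, h) *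
        gaussianPDF (m (Fin.last n) (θ, h)) (v (Fin.last n)) u := by
  simp only [autoregressionDensity, Fin.prod_univ_castSucc, past_castSucc, past_last, Fin.init_snoc,
    Fin.snoc_castSucc, Fin.snoc_last]

namespace IsGaussianAutoregression

variable {θ : Ω → Θ}

lemma init {Y : Fin (n + 1) → Ω → ℝ} {m : (i : Fin (n + 1)) → Θ × (Fin i → ℝ) → ℝ}
    {v : Fin (n + 1) → ℝ≥0} (h : IsGaussianAutoregression P θ Y m v) :
    IsGaussianAutoregression P θ (Fin.init Y) (fun i => m i.castSucc) (fun i => v i.castSucc) where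
  aemeasurable_parameter := h.aemeasurable_parameter
  measurable_mean i := h.measurable_mean i.castSucc
  variance_ne_zero i := h.variance_ne_zero i.castSucc
  hasCondDistrib i := h.hasCondDistrib i.castSucc

lemma lintegral_eq_last [SFinite P] {Y : Fin (n + 1) → Ω → ℝ}
    {m : (i : Fin (n + 1)) → Θ × (Fin i → ℝ) → ℝ} {v : Fin (n + 1) → ℝ≥0}
    (h : IsGaussianAutoregression P θ Y m v) {G : Θ × (Fin (n + 1) → ℝ) → ℝ≥0∞}
    (hG : Measurable G) :
    ∫⁻ ω, G (θ ω, (Y · ω)) ∂P =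
      ∫⁻ ω, (∫⁻ u, G (θ ω, Fin.snoc (α := fun _ => ℝ) (Fin.init Y · ω) u) *
      gaussianPDF (m (Fin.last n) (θ ω, (Fin.init Y · ω))) (v (Fin.last n)) u) ∂P := by
  set l := Fin.last n
  have hsnoc : Measurable fun q : (Θ × (Fin n → ℝ)) × ℝ =>
      G (q.1.1, Fin.snoc (α := fun _ => ℝ) q.1.2 q.2) :=
    hG.comp ((measurable_fst.comp measurable_fst).prodMk
      (measurable_snoc (measurable_snd.comp measurable_fst) measurable_snd))
  calc ∫⁻ ω, G (θ ω, (Y · ω)) ∂P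
      = ∫⁻ ω, G (θ ω, Fin.snoc (α := fun _ => ℝ) (Fin.init Y · ω) (Y l ω)) ∂P :=
        lintegral_congr fun ω => congrArg (fun y => G (θ ω, y))
          (Fin.snoc_init_self (α := fun _ => ℝ) (Y · ω)).symm
    _ = ∫⁻ ω, ∫⁻ u, G (θ ω, Fin.snoc (α := fun _ => ℝ) (Fin.init Y · ω) u)
          ∂gaussianReal (m l (θ ω, (Fin.init Y · ω))) (v l) ∂P :=
        lintegral_of_hasCondDistrib (h.hasCondDistrib l) hsnoc
    _ = _ := by
        refine lintegral_congr fun ω => ?_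
        rw [gaussianReal_of_var_ne_zero _ (h.variance_ne_zero l)]
        exact (lintegral_withDensity_eq_lintegral_mul _ (measurable_gaussianPDF _ _)
          (hsnoc.comp (measurable_prodMk_left (x := (θ ω, (Fin.init Y · ω)))))).trans
            (lintegral_congr fun u => mul_comm _ _)

lemma lintegral_eq [SFinite P] {Y : Fin n → Ω → ℝ} (h : IsGaussianAutoregression P θ Y m v)
    {G : Θ × (Fin n → ℝ) → ℝ≥0∞} (hG : Measurable G) :
    ∫⁻ ω, G (θ ω, (Y · ω)) ∂P =
      ∫⁻ ω, (∫⁻ y, G (θ ω, y) * autoregressionDensity m v (θ ω, y)) ∂P := by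
  induction n with
  | zero =>
    refine lintegral_congr fun ω => ?_
    rw [volume_pi, Measure.pi_of_empty _ Fin.elim0, lintegral_dirac]
    simp [autoregressionDensity, Subsingleton.elim (Y · ω) Fin.elim0]
  | succ n ih =>
    set l := Fin.last n
    have hstep : Measurable fun q : (Θ × (Fin n → ℝ)) × ℝ =>
        G (q.1.1, Fin.snoc (α := fun _ => ℝ) q.1.2 q.2) * gaussianPDF (m l q.1) (v l) q.2 :=
      (hG.comp ((measurable_fst.comp measurable_fst).prodMk
        (measurable_snoc (measurable_snd.comp measurable_fst) measurable_snd))).mul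
        (measurable_gaussianPDF_comp ((h.measurable_mean l).comp measurable_fst) _ measurable_snd)
    calc ∫⁻ ω, G (θ ω, (Y · ω)) ∂P
        = ∫⁻ ω, (∫⁻ y, (∫⁻ u, G (θ ω, Fin.snoc (α := fun _ => ℝ) y u) *
            gaussianPDF (m l (θ ω, y)) (v l) u) *
              autoregressionDensity (fun i => m i.castSucc) (fun i => v i.castSucc) (θ ω, y)) ∂P :=
          (h.lintegral_eq_last hG).trans (ih h.init hstep.lintegral_prod_right')
      _ = ∫⁻ ω, (∫⁻ y, G (θ ω, y) * autoregressionDensity m v (θ ω, y)) ∂P := by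
          refine lintegral_congr fun ω => ?_
          rw [volume_pi, volume_pi, lintegral_pi_succ _ (g := fun y => G (θ ω, y) * _)
            ((hG.mul (measurable_autoregressionDensity h.measurable_mean)).comp
              measurable_prodMk_left)]
          refine lintegral_congr fun y => ?_
          refine (lintegral_mul_const _
            (hstep.comp (measurable_prodMk_left (x := (θ ω, y))))).symm.trans
            (lintegral_congr fun u => ?_)
          rw [autoregressionDensity_snoc, mul_comm (autoregressionDensity _ _ _), ← mul_assoc]
          rfl

end IsGaussianAutoregression

end Autoregression

section AdditiveNoise

variable {Ω Θ : Type*} [MeasurableSpace Ω] [MeasurableSpace Θ] {P : Measure Ω} {n : ℕ} {θ : Ω → Θ}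
  {Y E : Fin n → Ω → ℝ} {m : (i : Fin n) → Θ × (Fin i → ℝ) → ℝ} {v : Fin n → ℝ≥0}

lemma indepFun_past {α : Type*} [MeasurableSpace α] {E : Fin n → Ω → α} (hE : iIndepFun E P)
    (hm : ∀ i, AEMeasurable (E i) P) (i : Fin n) :
    IndepFun (E i) (fun ω => past (E · ω) i) P := by
  have h := hE.indepFun_finset₀ {i} (Finset.Iio i) (by simp) hm
  have heval : Measurable fun e : ({i} : Finset (Fin n)) → α =>
      e ⟨i, Finset.mem_singleton_self i⟩ :=
    measurable_pi_apply _
  have hrestrict : Measurable fun (e : Finset.Iio i → α) (j : Fin i) =>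
      e ⟨Fin.castLE i.is_le' j, Finset.mem_Iio.2 j.2⟩ :=
    measurable_pi_lambda _ fun _ => measurable_pi_apply _
  exact h.comp heval hrestrict

lemma exists_measurable_solution (hm : ∀ i, Measurable (m i))
    (hY : ∀ i, ∀ᵐ ω ∂P, Y i ω = m i (θ ω, past (Y · ω) i) + E i ω) :
    ∃ Φ : Θ × (Fin n → ℝ) → Fin n → ℝ, Measurable Φ ∧ ∀ᵐ ω ∂P, (Y · ω) = Φ (θ ω, (E · ω)) := by
  induction n with
  | zero => exact ⟨fun _ => Fin.elim0, measurable_const, .of_forall fun ω => Subsingleton.elim _ _⟩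
  | succ n ih =>
    obtain ⟨Φ, hΦ, hYΦ⟩ := ih (Y := Fin.init Y) (E := Fin.init E) (m := fun i => m i.castSucc)
      (fun i => hm i.castSucc) fun i => hY i.castSucc
    let Φ' : Θ × (Fin (n + 1) → ℝ) → Fin n → ℝ := fun p => Φ (p.1, Fin.init p.2)
    have hΦ' : Measurable Φ' := hΦ.comp (measurable_fst.prodMk
      (measurable_pi_lambda _ fun i => (measurable_pi_apply i.castSucc).comp measurable_snd))
    refine ⟨fun p => Fin.snoc (α := fun _ => ℝ) (Φ' p)
        (m (Fin.last n) (p.1, Φ' p) + p.2 (Fin.last n)),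
      measurable_snoc hΦ' (((hm (Fin.last n)).comp (measurable_fst.prodMk hΦ')).add
        ((measurable_pi_apply _).comp measurable_snd)), ?_⟩
    filter_upwards [hYΦ, hY (Fin.last n)] with ω hinit hlast
    rw [← Fin.snoc_init_self (α := fun _ => ℝ) (Y · ω)]
    have hinit' : (Fin.init (Y · ω) : Fin n → ℝ) = Φ' (θ ω, (E · ω)) := hinit
    rw [hlast, past_last, hinit']

lemma isGaussianAutoregression_of_noise [IsProbabilityMeasure P] (hθ : AEMeasurable θ P)
    (hm : ∀ i, Measurable (m i)) (hv : ∀ i, v i ≠ 0)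
    (hE : ∀ i, HasLaw (E i) (gaussianReal 0 (v i)) P) (hiE : iIndepFun E P)
    (hθE : IndepFun θ (fun ω => (E · ω)) P)
    (hY : ∀ i, ∀ᵐ ω ∂P, Y i ω = m i (θ ω, past (Y · ω) i) + E i ω) :
    IsGaussianAutoregression P θ Y m v where
  aemeasurable_parameter := hθ
  measurable_mean := hm
  variance_ne_zero := hv
  hasCondDistrib i := by
    have hEm := fun j => (hE j).aemeasurable
    have hpastE : AEMeasurable (fun ω => past (E · ω) i) P :=
      aemeasurable_pi_lambda _ fun j => hEm _
    obtain ⟨Φ, hΦ, hYΦ⟩ := exists_measurable_solution (Y := past Y i) (E := past E i)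
      (m := fun j => m (Fin.castLE i.is_le' j)) (fun j => hm _) fun j => hY _
    have hres : E i =ᵐ[P] fun ω => Y i ω - m i (θ ω, past (Y · ω) i) :=
      (hY i).mono fun ω hω => by simp [hω]
    have hpast : (fun ω => (θ ω, Φ (θ ω, past (E · ω) i))) =ᵐ[P] fun ω => (θ ω, past (Y · ω) i) :=
      hYΦ.mono fun ω hω => Prod.ext rfl hω.symm
    have hind : IndepFun (E i) (fun ω => (past (E · ω) i, θ ω)) P :=
      indepFun_prodMk_of_indepFun_prodMk (hEm i) hpastE hθ (indepFun_past hiE hEm i)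
        ((hθE.symm).comp (φ := fun e : Fin n → ℝ => (e i, past e i)) (by fun_prop) measurable_id)
    refine hasCondDistrib_of_indepFun_sub ?_ (hm i) ((hE i).congr hres.symm) ?_
    · exact (hθ.prodMk (hΦ.comp_aemeasurable (hθ.prodMk hpastE))).congr hpast
    · refine IndepFun.congr (hind.comp (φ := id)
        (ψ := fun q : (Fin i → ℝ) × Θ => (q.2, Φ (q.2, q.1)))
        measurable_id ?_) hres hpast
      exact measurable_snd.prodMk (hΦ.comp measurable_swap)

end AdditiveNoise

/-! ### Observations at a fixed design -/

section FixedDesign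

variable {Ω : Type*} [MeasurableSpace Ω] {P : Measure Ω} {d : ℕ} {X : Set (Pt d)}
  {k : Pt d → Pt d → ℝ} {f : Ω → Pt d → ℝ}

namespace IsCenteredGP

lemma comp {Ω' : Type*} [MeasurableSpace Ω'] {Q : Measure Ω'} {g : Ω' → Ω}
    (hf : IsCenteredGP X k f P) (hg : MeasurePreserving g Q P) :
    IsCenteredGP X k (fun ω => f (g ω)) Q where
  measurable z hz := (hf.measurable z hz).comp hg.measurable
  gaussian := ⟨fun I => ⟨by
    have hmeas : Measurable fun ω => I.restrict fun z : X => f ω z :=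
      measurable_pi_lambda _ fun z => hf.measurable _ z.1.2
    have h := (hf.gaussian.hasGaussianLaw I).isGaussian_map
    rwa [← hg.map_eq, Measure.map_map hmeas hg.measurable] at h⟩⟩
  mean_zero z hz := by
    rw [← hf.mean_zero z hz, ← hg.map_eq, integral_map hg.aemeasurable
      (hf.measurable z hz).aestronglyMeasurable]
  covariance_eq z hz w hw := by
    rw [← hf.covariance_eq z hz w hw]
    conv_rhs => rw [← hg.map_eq]
    rw [covariance_map_fun (hf.measurable z hz).aestronglyMeasurable
      (hf.measurable w hw).aestronglyMeasurable hg.aemeasurable]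

lemma memLp (hf : IsCenteredGP X k f P) {z : Pt d} (hz : z ∈ X) : MemLp (fun ω => f ω z) 2 P :=
  (hf.gaussian.hasGaussianLaw_eval ⟨z, hz⟩).memLp_two

lemma kernel_symm (hf : IsCenteredGP X k f P) {z w : Pt d} (hz : z ∈ X) (hw : w ∈ X) :
    k z w = k w z := by
  rw [← hf.covariance_eq z hz w hw, covariance_comm, hf.covariance_eq w hw z hz]

lemma hasGaussianLaw_pi (hf : IsCenteredGP X k f P) {ι : Type*} [Finite ι] {zs : ι → Pt d}
    (hzs : ∀ i, zs i ∈ X) : HasGaussianLaw (fun ω i => f ω (zs i)) P := by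
  have := Fintype.ofFinite ι
  have h := (hf.gaussian.comp_right fun i => (⟨zs i, hzs i⟩ : X)).hasGaussianLaw Finset.univ
  exact h.map (ContinuousLinearMap.pi fun i =>
    ContinuousLinearMap.proj (R := ℝ) (φ := fun _ : (Finset.univ : Finset ι) => ℝ)
      ⟨i, Finset.mem_univ i⟩)

variable {n : ℕ} {xs : Fin n → Pt d} {σ : ℝ≥0}

lemma posSemidef_gram [IsFiniteMeasure P] (hf : IsCenteredGP X k f P) (hxs : ∀ i, xs i ∈ X) :
    (Matrix.of fun i j => k (xs i) (xs j) : Matrix (Fin n) (Fin n) ℝ).PosSemidef := by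
  refine Matrix.PosSemidef.of_dotProduct_mulVec_nonneg ?_ fun x => ?_
  · ext i j
    exact hf.kernel_symm (hxs j) (hxs i)
  · have hm : ∀ i, MemLp (fun ω => x i * f ω (xs i)) 2 P := fun i => (hf.memLp (hxs i)).const_mul _
    have hv : Var[fun ω => ∑ i, x i * f ω (xs i); P] =
        star x ⬝ᵥ ((Matrix.of fun i j => k (xs i) (xs j)) *ᵥ x) := by
      rw [← covariance_self (memLp_finsetSum _ fun i _ => hm i).aestronglyMeasurable.aemeasurable,
        covariance_fun_sum_fun_sum hm hm]
      simp only [dotProduct, Matrix.mulVec, Matrix.of_apply, Finset.mul_sum,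
        covariance_const_mul_left, covariance_const_mul_right, star_trivial,
        hf.covariance_eq _ (hxs _) _ (hxs _)]
      exact Finset.sum_congr rfl fun i _ => Finset.sum_congr rfl fun j _ => by ring
    exact hv ▸ variance_nonneg _ _

lemma posDef_regGram [IsFiniteMeasure P] (hf : IsCenteredGP X k f P) (hxs : ∀ i, xs i ∈ X)
    (hσ : 0 < σ) : (regGram k σ xs).PosDef :=
  (Matrix.PosDef.one.smul (by positivity : (0 : ℝ) < (σ : ℝ) ^ 2)).posSemidef_add
    (hf.posSemidef_gram hxs)

lemma postVar_le [IsFiniteMeasure P] (hf : IsCenteredGP X k f P) (hxs : ∀ i, xs i ∈ X)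
    (hσ : 0 < σ) (z : Pt d) : postVar k σ xs z ≤ k z z :=
  sub_le_self _ ((hf.posDef_regGram hxs hσ).inv.posSemidef.dotProduct_mulVec_nonneg _)

end IsCenteredGP

/-- The joint law of the process and of `n` independent noise variables of variance `σ²`. -/
noncomputable def designMeasure (P : Measure Ω) (σ : ℝ≥0) (n : ℕ) : Measure (Ω × (Fin n → ℝ)) :=
  P.prod (Measure.pi fun _ : Fin n => gaussianReal 0 (σ ^ 2))

instance [IsProbabilityMeasure P] (σ : ℝ≥0) (n : ℕ) :
    IsProbabilityMeasure (designMeasure P σ n) := by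
  unfold designMeasure
  infer_instance

/-- The noisy observations at the points `xs`, as functions on the space of `designMeasure`. -/
def noisyObs {n : ℕ} (f : Ω → Pt d → ℝ) (xs : Fin n → Pt d) (p : Ω × (Fin n → ℝ)) (i : Fin n) : ℝ :=
  f p.1 (xs i) + p.2 i

variable {n : ℕ} {xs : Fin n → Pt d} {σ : ℝ≥0}

lemma measurePreserving_fst_designMeasure [SFinite P] :
    MeasurePreserving Prod.fst (designMeasure P σ n) P :=
  measurePreserving_fst

lemma hasLaw_noise [IsProbabilityMeasure P] (i : Fin n) :
    HasLaw (fun p : Ω × (Fin n → ℝ) => p.2 i) (gaussianReal 0 (σ ^ 2)) (designMeasure P σ n) :=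
  ((measurePreserving_eval (fun _ : Fin n => gaussianReal 0 (σ ^ 2)) i).comp
    measurePreserving_snd).hasLaw

lemma iIndepFun_noise [IsProbabilityMeasure P] :
    iIndepFun (fun (i : Fin n) (p : Ω × (Fin n → ℝ)) => p.2 i) (designMeasure P σ n) := by
  rw [iIndepFun_iff_map_fun_eq_pi_map fun i => (hasLaw_noise i).aemeasurable]
  simp only [(hasLaw_noise _).map_eq]
  exact measurePreserving_snd.map_eq

lemma indepFun_process_noise [IsProbabilityMeasure P] {β : Type*} [MeasurableSpace β] {g : Ω → β}
    (hg : Measurable g) :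
    IndepFun (fun p : Ω × (Fin n → ℝ) => g p.1) (fun p => p.2) (designMeasure P σ n) :=
  indepFun_prod (Y := id) hg measurable_id

lemma hasGaussianLaw_noise [IsProbabilityMeasure P] :
    HasGaussianLaw (fun p : Ω × (Fin n → ℝ) => p.2) (designMeasure P σ n) :=
  iIndepFun_noise.hasGaussianLaw fun i => (hasLaw_noise i).hasGaussianLaw

namespace IsCenteredGP

variable [IsProbabilityMeasure P]

lemma hasGaussianLaw_design (hf : IsCenteredGP X k f P) {ι : Type*} [Finite ι] {zs : ι → Pt d}
    (hzs : ∀ i, zs i ∈ X) :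
    HasGaussianLaw (fun p => (fun i => f p.1 (zs i), p.2)) (designMeasure P σ n) := by
  have := Fintype.ofFinite ι
  have hfst := hf.comp (measurePreserving_fst_designMeasure (σ := σ) (n := n))
  exact IndepFun.hasGaussianLaw (hfst.hasGaussianLaw_pi hzs) hasGaussianLaw_noise
    (indepFun_process_noise (measurable_pi_lambda _ fun i => hf.measurable _ (hzs i)))

lemma memLp_noisyObs (hf : IsCenteredGP X k f P) (hxs : ∀ i, xs i ∈ X) (i : Fin n) :
    MemLp (fun p => noisyObs f xs p i) 2 (designMeasure P σ n) :=
  ((hf.comp measurePreserving_fst_designMeasure).memLp (hxs i)).add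
    (hasLaw_noise i).hasGaussianLaw.memLp_two

lemma integral_noisyObs (hf : IsCenteredGP X k f P) (hxs : ∀ i, xs i ∈ X) (i : Fin n) :
    ∫ p, noisyObs f xs p i ∂designMeasure P σ n = 0 := by
  have hfst := hf.comp (measurePreserving_fst_designMeasure (σ := σ) (n := n))
  have hnoise := hasLaw_noise (P := P) (σ := σ) i
  have hmean : ∫ p, p.2 i ∂designMeasure P σ n = 0 := by
    rw [hnoise.integral_eq, integral_id_gaussianReal]
  refine (integral_add ((hfst.memLp (hxs i)).integrable one_le_two)
    (hnoise.hasGaussianLaw.memLp_two.integrable one_le_two)).trans ?_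
  rw [hfst.mean_zero _ (hxs i), hmean, add_zero]

lemma covariance_noisyObs_right (hf : IsCenteredGP X k f P) (hxs : ∀ i, xs i ∈ X) {z : Pt d}
    (hz : z ∈ X) (i : Fin n) :
    cov[fun p => f p.1 z, fun p => noisyObs f xs p i; designMeasure P σ n] = k z (xs i) := by
  have hfst := hf.comp (measurePreserving_fst_designMeasure (σ := σ) (n := n))
  have hnoise : MemLp (fun p : Ω × (Fin n → ℝ) => p.2 i) 2 (designMeasure P σ n) :=
    (hasLaw_noise i).hasGaussianLaw.memLp_two
  have hind := (indepFun_process_noise (P := P) (σ := σ) (n := n) (hf.measurable z hz)).comp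
    measurable_id (measurable_pi_apply i)
  refine (covariance_add_right (hfst.memLp hz) (hfst.memLp (hxs i)) hnoise).trans ?_
  rw [hfst.covariance_eq z hz _ (hxs i)]
  exact add_eq_left.2 (hind.covariance_eq_zero (hfst.memLp hz) hnoise)

lemma covariance_noisyObs (hf : IsCenteredGP X k f P) (hxs : ∀ i, xs i ∈ X) (i j : Fin n) :
    cov[fun p => noisyObs f xs p i, fun p => noisyObs f xs p j; designMeasure P σ n] =
      regGram k σ xs i j := by
  have hfst := hf.comp (measurePreserving_fst_designMeasure (σ := σ) (n := n))
  have hnoise : ∀ i, MemLp (fun p : Ω × (Fin n → ℝ) => p.2 i) 2 (designMeasure P σ n) :=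
    fun i => (hasLaw_noise i).hasGaussianLaw.memLp_two
  have hind := (indepFun_process_noise (P := P) (σ := σ) (n := n)
    (hf.measurable _ (hxs j))).symm.comp (measurable_pi_apply i) measurable_id
  have hcross : cov[fun p => p.2 i, fun p => f p.1 (xs j); designMeasure P σ n] = 0 :=
    hind.covariance_eq_zero (hnoise i) (hfst.memLp (hxs j))
  have hcov : cov[fun p => p.2 i, fun p => p.2 j; designMeasure P σ n] =
      if i = j then (σ : ℝ) ^ 2 else 0 := by
    split_ifs with hij
    · rw [← hij, covariance_self (hnoise i).aestronglyMeasurable.aemeasurable,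
        (hasLaw_noise i).variance_eq, variance_id_gaussianReal, NNReal.coe_pow]
    · exact (iIndepFun_noise.indepFun hij).covariance_eq_zero (hnoise i) (hnoise j)
  calc cov[fun p => noisyObs f xs p i, fun p => noisyObs f xs p j; designMeasure P σ n]
      = cov[fun p => f p.1 (xs i), fun p => noisyObs f xs p j; designMeasure P σ n] +
          cov[fun p => p.2 i, fun p => noisyObs f xs p j; designMeasure P σ n] :=
        covariance_add_left (hfst.memLp (hxs i)) (hnoise i) (hf.memLp_noisyObs hxs j)
    _ = k (xs i) (xs j) + (0 + if i = j then (σ : ℝ) ^ 2 else 0) := by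
        rw [hf.covariance_noisyObs_right hxs (hxs i)]
        exact congrArg _ ((covariance_add_right (hnoise i) (hfst.memLp (hxs j)) (hnoise j)).trans
          (congrArg₂ (· + ·) hcross hcov))
    _ = regGram k σ xs i j := by simp [regGram, Matrix.one_apply]

lemma isGaussianRegression_posterior (hf : IsCenteredGP X k f P) (hxs : ∀ i, xs i ∈ X)
    (hσ : 0 < σ) {z : Pt d} (hz : z ∈ X) :
    IsGaussianRegression (designMeasure P σ n) (fun p => f p.1 z) (noisyObs f xs)
      (regGram k σ xs) (fun i => k z (xs i)) where
  hasGaussianLaw := by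
    have h := hf.hasGaussianLaw_design (σ := σ) (n := n) (zs := Fin.cons z xs)
      (Fin.cases hz hxs)
    let L : ((Fin (n + 1) → ℝ) × (Fin n → ℝ)) →ₗ[ℝ] ℝ × (Fin n → ℝ) :=
      { toFun := fun q => (q.1 0, fun i => q.1 i.succ + q.2 i)
        map_add' := fun q q' => Prod.ext rfl (funext fun i => add_add_add_comm _ _ _ _)
        map_smul' := fun c q => Prod.ext rfl (funext fun i => (mul_add _ _ _).symm) }
    exact h.map_fun L.toContinuousLinearMap
  mean_target := (hf.comp measurePreserving_fst_designMeasure).mean_zero z hz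
  mean_data := hf.integral_noisyObs hxs
  covariance_data := hf.covariance_noisyObs hxs
  covariance_target := hf.covariance_noisyObs_right hxs hz
  isUnit := (hf.posDef_regGram hxs hσ).isUnit

lemma isGaussianRegression_innovation (hf : IsCenteredGP X k f P) (hxs : ∀ i, xs i ∈ X)
    (hσ : 0 < σ) (i : Fin n) :
    IsGaussianRegression (designMeasure P σ n) (fun p => noisyObs f xs p i)
      (fun p => past (noisyObs f xs p) i) (regGram k σ (past xs i))
      (fun j => k (xs i) (past xs i j)) where
  hasGaussianLaw := by
    have h := hf.hasGaussianLaw_design (σ := σ) (n := n) hxs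
    let L : ((Fin n → ℝ) × (Fin n → ℝ)) →ₗ[ℝ] ℝ × (Fin i → ℝ) :=
      { toFun := fun q => (q.1 i + q.2 i, past (q.1 + q.2) i)
        map_add' := fun q q' => Prod.ext (add_add_add_comm _ _ _ _)
          (funext fun j => add_add_add_comm _ _ _ _)
        map_smul' := fun c q => Prod.ext (mul_add _ _ _).symm
          (funext fun j => (mul_add _ _ _).symm) }
    exact h.map_fun L.toContinuousLinearMap
  mean_target := hf.integral_noisyObs hxs i
  mean_data j := hf.integral_noisyObs hxs _
  covariance_data j l := by
    refine (hf.covariance_noisyObs hxs _ _).trans ?_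
    simp [regGram, Matrix.one_apply]
  covariance_target j := by
    have hne : i ≠ Fin.castLE i.is_le' j := (Fin.ne_of_lt j.2).symm
    refine (hf.covariance_noisyObs hxs _ _).trans ?_
    simp [regGram, hne]
  isUnit := (hf.posDef_regGram (fun j => hxs _) hσ).isUnit

lemma variance_residual_posterior (hf : IsCenteredGP X k f P) (xs : Fin n → Pt d)
    {z : Pt d} (hz : z ∈ X) :
    Var[fun p => f p.1 z; designMeasure P σ n] -
      (fun i => k z (xs i)) ⬝ᵥ ((regGram k σ xs)⁻¹ *ᵥ fun i => k z (xs i)) = postVar k σ xs z := by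
  have hfst := hf.comp (measurePreserving_fst_designMeasure (σ := σ) (n := n))
  rw [← covariance_self (hfst.measurable z hz).aemeasurable, hfst.covariance_eq z hz z hz, postVar]

lemma variance_residual_innovation (hf : IsCenteredGP X k f P) (hxs : ∀ i, xs i ∈ X)
    (i : Fin n) :
    Var[fun p => noisyObs f xs p i; designMeasure P σ n] - (fun j => k (xs i) (past xs i j)) ⬝ᵥ
      ((regGram k σ (past xs i))⁻¹ *ᵥ fun j => k (xs i) (past xs i j)) =
      postVar k σ (past xs i) (xs i) + σ ^ 2 := by
  have hvar : Var[fun p => noisyObs f xs p i; designMeasure P σ n] = k (xs i) (xs i) + σ ^ 2 := by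
    rw [← covariance_self (hf.memLp_noisyObs hxs i).aestronglyMeasurable.aemeasurable,
      hf.covariance_noisyObs hxs]
    simp [regGram]
  rw [hvar, postVar]
  ring

lemma postVar_nonneg (hf : IsCenteredGP X k f P) (hxs : ∀ i, xs i ∈ X) (hσ : 0 < σ) {z : Pt d}
    (hz : z ∈ X) : 0 ≤ postVar k σ xs z :=
  hf.variance_residual_posterior (σ := σ) xs hz ▸
    (hf.isGaussianRegression_posterior hxs hσ hz).residual_variance_nonneg

end IsCenteredGP

end FixedDesign

/-! ### Bayes' rule at a fixed design -/

lemma continuous_lintegral_of_le_const {α β : Type*} [TopologicalSpace α]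
    [FirstCountableTopology α] [MeasurableSpace β] {μ : Measure β} [IsFiniteMeasure μ]
    {F : α → β → ℝ≥0∞} {C : ℝ≥0∞} (hF : ∀ a, Measurable (F a)) (hcont : ∀ b, Continuous (F · b))
    (hC : C ≠ ∞) (hle : ∀ a b, F a b ≤ C) : Continuous fun a => ∫⁻ b, F a b ∂μ := by
  refine continuous_iff_continuousAt.2 fun a =>
    tendsto_lintegral_filter_of_dominated_convergence (fun _ => C) (.of_forall hF)
      (.of_forall fun a => .of_forall (hle a)) ?_ (.of_forall fun b => (hcont b).tendsto a)
  rw [lintegral_const]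
  exact ENNReal.mul_ne_top hC (measure_ne_top _ _)

lemma continuous_lintegral_gaussianReal (v : ℝ≥0) (h : BoundedContinuousFunction ℝ ℝ≥0) :
    Continuous fun m : ℝ => ∫⁻ u, h u ∂gaussianReal m v := by
  have hshift : ∀ m : ℝ, ∫⁻ u, h u ∂gaussianReal m v = ∫⁻ u, h (m + u) ∂gaussianReal 0 v := by
    intro m
    have hmap := gaussianReal_map_const_add (μ := 0) (v := v) m
    rw [zero_add] at hmap
    rw [← hmap, lintegral_map h.continuous.measurable.coe_nnreal_ennreal (measurable_const_add _)]
  simp only [hshift]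
  exact continuous_lintegral_of_le_const (C := nndist h 0)
    (fun m => (h.continuous.measurable.comp (measurable_const_add m)).coe_nnreal_ennreal)
    (fun u => ENNReal.continuous_coe.comp (h.continuous.comp (by fun_prop))) ENNReal.coe_ne_top
    fun m u => ENNReal.coe_le_coe.2 (BoundedContinuousFunction.NNReal.upper_bound h _)

lemma gaussianPDF_le (m : ℝ) (v : ℝ≥0) (x : ℝ) :
    gaussianPDF m v x ≤ ENNReal.ofReal (√(2 * Real.pi * v))⁻¹ := by
  refine ENNReal.ofReal_le_ofReal (mul_le_of_le_one_right (by positivity)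
    (Real.exp_le_one_iff.2 ?_))
  exact div_nonpos_of_nonpos_of_nonneg (neg_nonpos.2 (sq_nonneg _)) (by positivity)

section Bayes

variable {Ω : Type*} {d n : ℕ}

/-- The density at `y` of the observations at the points `xs`, given the process. -/
noncomputable def likelihood (f : Ω → Pt d → ℝ) (σ : ℝ≥0) (xs : Fin n → Pt d) (y : Fin n → ℝ)
    (ω : Ω) : ℝ≥0∞ :=
  ∏ i, gaussianPDF (f ω (xs i)) (σ ^ 2) (y i)

/-- The density of the observations at the points `xs`. -/
noncomputable def evidence [MeasurableSpace Ω] (f : Ω → Pt d → ℝ) (P : Measure Ω) (σ : ℝ≥0)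
    (xs : Fin n → Pt d) (y : Fin n → ℝ) : ℝ≥0∞ :=
  ∫⁻ ω, likelihood f σ xs y ω ∂P

variable {X : Set (Pt d)} {k : Pt d → Pt d → ℝ} {f : Ω → Pt d → ℝ} {xs : Fin n → Pt d} {σ : ℝ≥0}
  {z : Pt d}

lemma likelihood_le (y : Fin n → ℝ) (ω : Ω) :
    likelihood f σ xs y ω ≤ ENNReal.ofReal (√(2 * Real.pi * (σ ^ 2 : ℝ≥0)))⁻¹ ^ n := by
  refine (Finset.prod_le_pow_card _ _ _ fun i _ => gaussianPDF_le _ _ _).trans_eq ?_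
  rw [Finset.card_univ, Fintype.card_fin]

lemma continuous_likelihood (ω : Ω) : Continuous fun y => likelihood f σ xs y ω := by
  have h : ∀ y, likelihood f σ xs y ω =
      ENNReal.ofReal (∏ i, gaussianPDFReal (f ω (xs i)) (σ ^ 2) (y i)) := fun y =>
    (ENNReal.ofReal_prod_of_nonneg fun i _ => gaussianPDFReal_nonneg _ _ _).symm
  simp only [h]
  refine ENNReal.continuous_ofReal.comp (continuous_finsetProd _ fun i _ => ?_)
  unfold gaussianPDFReal
  fun_prop

variable [MeasurableSpace Ω] {P : Measure Ω}

lemma evidence_ne_top [IsFiniteMeasure P] (y : Fin n → ℝ) : evidence f P σ xs y ≠ ∞ := by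
  refine ((lintegral_mono (likelihood_le y)).trans_lt ?_).ne
  rw [lintegral_const]
  exact ENNReal.mul_lt_top (ENNReal.pow_lt_top ENNReal.ofReal_lt_top) (measure_lt_top _ _)

namespace IsCenteredGP

lemma measurable_likelihood (hf : IsCenteredGP X k f P) (hxs : ∀ i, xs i ∈ X) :
    Measurable fun q : Ω × (Fin n → ℝ) => likelihood f σ xs q.2 q.1 := by
  unfold likelihood
  exact Finset.measurable_fun_prod _ fun i _ => measurable_gaussianPDF_comp
    ((hf.measurable _ (hxs i)).comp measurable_fst) _ (by fun_prop)

lemma measurable_likelihood_const (hf : IsCenteredGP X k f P) (hxs : ∀ i, xs i ∈ X)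
    (y : Fin n → ℝ) : Measurable (likelihood f σ xs y) := by
  unfold likelihood
  exact Finset.measurable_fun_prod _ fun i _ =>
    measurable_gaussianPDF_comp (hf.measurable _ (hxs i)) _ measurable_const

lemma continuous_lintegral_mul_likelihood [IsFiniteMeasure P] (hf : IsCenteredGP X k f P)
    (hxs : ∀ i, xs i ∈ X) (hz : z ∈ X) (h : BoundedContinuousFunction ℝ ℝ≥0) :
    Continuous fun y => ∫⁻ ω, h (f ω z) * likelihood f σ xs y ω ∂P :=
  continuous_lintegral_of_le_const
    (C := nndist h 0 * ENNReal.ofReal (√(2 * Real.pi * (σ ^ 2 : ℝ≥0)))⁻¹ ^ n)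
    (fun y => (h.continuous.measurable.comp (hf.measurable z hz)).coe_nnreal_ennreal.mul
      (hf.measurable_likelihood_const hxs y))
    (fun ω => ENNReal.continuous_const_mul ENNReal.coe_ne_top |>.comp (continuous_likelihood ω))
    (ENNReal.mul_ne_top ENNReal.coe_ne_top (ENNReal.pow_ne_top ENNReal.ofReal_ne_top))
    fun y ω => mul_le_mul' (ENNReal.coe_le_coe.2 (BoundedContinuousFunction.NNReal.upper_bound h _))
      (likelihood_le y ω)

variable [IsProbabilityMeasure P]

lemma isGaussianAutoregression_noisyObs (hf : IsCenteredGP X k f P) (hxs : ∀ i, xs i ∈ X)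
    (hσ : 0 < σ) :
    IsGaussianAutoregression (designMeasure P σ n) Prod.fst (fun i p => noisyObs f xs p i)
      (fun i q => f q.1 (xs i)) (fun _ => σ ^ 2) :=
  isGaussianAutoregression_of_noise measurable_fst.aemeasurable
    (fun i => (hf.measurable _ (hxs i)).comp measurable_fst) (fun _ => by positivity)
    hasLaw_noise iIndepFun_noise (indepFun_process_noise measurable_id)
    fun _ => .of_forall fun _ => rfl

lemma lintegral_noisyObs (hf : IsCenteredGP X k f P) (hxs : ∀ i, xs i ∈ X) (hσ : 0 < σ)
    {G : Ω × (Fin n → ℝ) → ℝ≥0∞} (hG : Measurable G) :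
    ∫⁻ p, G (p.1, noisyObs f xs p) ∂designMeasure P σ n =
      ∫⁻ y, ∫⁻ ω, G (ω, y) * likelihood f σ xs y ω ∂P := by
  have hGL : Measurable fun q : Ω × (Fin n → ℝ) => G q * likelihood f σ xs q.2 q.1 :=
    hG.mul (hf.measurable_likelihood hxs)
  calc ∫⁻ p, G (p.1, noisyObs f xs p) ∂designMeasure P σ n
      = ∫⁻ p, (∫⁻ y, G (p.1, y) * likelihood f σ xs y p.1) ∂designMeasure P σ n :=
        (hf.isGaussianAutoregression_noisyObs hxs hσ).lintegral_eq hG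
    _ = ∫⁻ ω, (∫⁻ y, G (ω, y) * likelihood f σ xs y ω) ∂P :=
        measurePreserving_fst_designMeasure.lintegral_comp hGL.lintegral_prod_right'
    _ = ∫⁻ y, ∫⁻ ω, G (ω, y) * likelihood f σ xs y ω ∂P :=
        lintegral_lintegral_swap (f := fun ω y => G (ω, y) * likelihood f σ xs y ω) hGL.aemeasurable

lemma measurable_lintegral_posterior (xs : Fin n → Pt d) (z : Pt d) {h : ℝ → ℝ≥0∞}
    (hh : Measurable h) :
    Measurable fun y => ∫⁻ u, h u ∂gaussianReal (postMean k σ xs y z)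
      (postVar k σ xs z).toNNReal :=
  hh.lintegral_kernel (κ := gaussianKernel
    (IsGaussianRegression.measurable_prediction (G := regGram k σ xs) (c := fun i => k z (xs i)))
    (measurable_const (a := (postVar k σ xs z).toNNReal)))

lemma lintegral_mul_noisyObs (hf : IsCenteredGP X k f P) (hxs : ∀ i, xs i ∈ X) (hσ : 0 < σ)
    (hz : z ∈ X) {h : ℝ → ℝ≥0∞} (hh : Measurable h) {g : (Fin n → ℝ) → ℝ≥0∞} (hg : Measurable g) :
    ∫⁻ p, g (noisyObs f xs p) * h (f p.1 z) ∂designMeasure P σ n =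
      ∫⁻ p, g (noisyObs f xs p) * (∫⁻ u, h u ∂gaussianReal (postMean k σ xs (noisyObs f xs p) z)
        (postVar k σ xs z).toNNReal) ∂designMeasure P σ n := by
  have hcond := (hf.isGaussianRegression_posterior hxs hσ hz).hasCondDistrib
  simp only [hf.variance_residual_posterior xs hz] at hcond
  refine (lintegral_of_hasCondDistrib (G := fun q => g q.1 * h q.2) hcond
    ((hg.comp measurable_fst).mul (hh.comp measurable_snd))).trans (lintegral_congr fun p => ?_)
  change ∫⁻ u, g (noisyObs f xs p) * h u ∂gaussianReal (postMean k σ xs (noisyObs f xs p) z)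
    (postVar k σ xs z).toNNReal = _
  exact lintegral_const_mul _ hh

lemma lintegral_mul_likelihood_ae (hf : IsCenteredGP X k f P) (hxs : ∀ i, xs i ∈ X)
    (hσ : 0 < σ) (hz : z ∈ X) {h : ℝ → ℝ≥0∞} (hh : Measurable h) :
    (fun y => ∫⁻ ω, h (f ω z) * likelihood f σ xs y ω ∂P) =ᵐ[volume] fun y =>
      evidence f P σ xs y * ∫⁻ u, h u ∂gaussianReal (postMean k σ xs y z)
        (postVar k σ xs z).toNNReal := by
  have hpost := measurable_lintegral_posterior (k := k) (σ := σ) xs z hh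
  have hL := hf.measurable_likelihood (σ := σ) hxs
  have hfz : Measurable fun q : Ω × (Fin n → ℝ) => h (f q.1 z) :=
    hh.comp ((hf.measurable z hz).comp measurable_fst)
  refine ae_eq_of_forall_setLIntegral_eq_of_sigmaFinite (hfz.mul hL).lintegral_prod_left'
    (hL.lintegral_prod_left'.mul hpost) fun B hB _ => ?_
  have hg : Measurable (B.indicator (1 : (Fin n → ℝ) → ℝ≥0∞)) := measurable_one.indicator hB
  have hindicator : ∀ (G : (Fin n → ℝ) → ℝ≥0∞) y, B.indicator G y = B.indicator 1 y * G y :=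
    fun G y => by by_cases hy : y ∈ B <;> simp [hy]
  have key := ((hf.lintegral_noisyObs hxs hσ ((hg.comp measurable_snd).mul hfz)).symm.trans
    (hf.lintegral_mul_noisyObs hxs hσ hz hh hg)).trans
      (hf.lintegral_noisyObs hxs hσ ((hg.comp measurable_snd).mul (hpost.comp measurable_snd)))
  rw [← lintegral_indicator hB, ← lintegral_indicator hB]
  refine (lintegral_congr fun y => ?_).trans (key.trans (lintegral_congr fun y => ?_))
  · rw [hindicator]
    simp only [Pi.mul_apply, Function.comp_apply, mul_assoc]
    exact (lintegral_const_mul _ ((hh.comp (hf.measurable z hz)).mul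
      (hf.measurable_likelihood_const hxs y))).symm
  · simp only [Pi.mul_apply, Function.comp_apply]
    rw [lintegral_const_mul _ (hf.measurable_likelihood_const hxs y), mul_right_comm, mul_assoc,
      hindicator fun y => evidence f P σ xs y * _]
    rfl

lemma lintegral_mul_likelihood_of_continuous (hf : IsCenteredGP X k f P) (hxs : ∀ i, xs i ∈ X)
    (hσ : 0 < σ) (hz : z ∈ X) (y : Fin n → ℝ) (h : BoundedContinuousFunction ℝ ℝ≥0) :
    ∫⁻ ω, h (f ω z) * likelihood f σ xs y ω ∂P =
      evidence f P σ xs y * ∫⁻ u, h u ∂gaussianReal (postMean k σ xs y z)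
        (postVar k σ xs z).toNNReal := by
  have hmean : Continuous fun y => postMean k σ xs y z := by
    simp only [postMean, dotProduct, Matrix.mulVec]
    fun_prop
  have hpost := (continuous_lintegral_gaussianReal (postVar k σ xs z).toNNReal h).comp hmean
  have hpost_ne_top : ∀ y, ∫⁻ u, h u ∂gaussianReal (postMean k σ xs y z)
      (postVar k σ xs z).toNNReal ≠ ∞ := fun y => (h.lintegral_lt_top_of_nnreal _).ne
  have hevidence : Continuous (evidence f P σ xs) := by
    unfold evidence
    simpa using hf.continuous_lintegral_mul_likelihood (σ := σ) hxs hz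
      (BoundedContinuousFunction.const ℝ 1)
  have hright : Continuous fun y => evidence f P σ xs y * ∫⁻ u, h u ∂gaussianReal
      (postMean k σ xs y z) (postVar k σ xs z).toNNReal :=
    continuous_iff_continuousAt.2 fun y => ENNReal.Tendsto.mul hevidence.continuousAt
      (.inr (hpost_ne_top y)) hpost.continuousAt (.inr (evidence_ne_top y))
  exact congrFun ((Continuous.ae_eq_iff_eq volume
    (hf.continuous_lintegral_mul_likelihood hxs hz h) hright).1
      (hf.lintegral_mul_likelihood_ae hxs hσ hz h.continuous.measurable.coe_nnreal_ennreal)) y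

lemma map_withDensity_likelihood (hf : IsCenteredGP X k f P) (hxs : ∀ i, xs i ∈ X) (hσ : 0 < σ)
    (hz : z ∈ X) (y : Fin n → ℝ) :
    (P.withDensity (likelihood f σ xs y)).map (fun ω => f ω z) =
      evidence f P σ xs y • gaussianReal (postMean k σ xs y z) (postVar k σ xs z).toNNReal := by
  have hL := hf.measurable_likelihood_const (σ := σ) hxs y
  have : IsFiniteMeasure (P.withDensity (likelihood f σ xs y)) :=
    isFiniteMeasure_withDensity (evidence_ne_top y)
  refine ext_of_forall_lintegral_eq_of_IsFiniteMeasure fun h => ?_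
  have hh := h.continuous.measurable.coe_nnreal_ennreal
  have hhz : Measurable fun ω => (h (f ω z) : ℝ≥0∞) := hh.comp (hf.measurable z hz)
  rw [lintegral_map hh (hf.measurable z hz), lintegral_smul_measure, smul_eq_mul,
    ← hf.lintegral_mul_likelihood_of_continuous hxs hσ hz y h,
    lintegral_withDensity_eq_lintegral_mul _ hL hhz]
  exact lintegral_congr fun ω => mul_comm _ _

theorem lintegral_mul_likelihood (hf : IsCenteredGP X k f P) (hxs : ∀ i, xs i ∈ X) (hσ : 0 < σ)
    (hz : z ∈ X) (y : Fin n → ℝ) {h : ℝ → ℝ≥0∞} (hh : Measurable h) :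
    ∫⁻ ω, h (f ω z) * likelihood f σ xs y ω ∂P =
      evidence f P σ xs y * ∫⁻ u, h u ∂gaussianReal (postMean k σ xs y z)
        (postVar k σ xs z).toNNReal := by
  have hhz : Measurable fun ω => h (f ω z) := hh.comp (hf.measurable z hz)
  rw [← smul_eq_mul (evidence _ _ _ _ _), ← lintegral_smul_measure,
    ← hf.map_withDensity_likelihood hxs hσ hz y, lintegral_map hh (hf.measurable z hz),
    lintegral_withDensity_eq_lintegral_mul _ (hf.measurable_likelihood_const hxs y) hhz]
  exact lintegral_congr fun ω => mul_comm _ _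

end IsCenteredGP

end Bayes

/-! ### Mutual information -/

section Autoregression

variable {Ω Θ : Type*} [MeasurableSpace Ω] [MeasurableSpace Θ] {P : Measure Ω} {n : ℕ}
  {θ : Ω → Θ} {Y : Fin n → Ω → ℝ} {m : (i : Fin n) → Θ × (Fin i → ℝ) → ℝ} {v : Fin n → ℝ≥0}

lemma mutualInfo_eq_integral_log {α β : Type*} [MeasurableSpace α] [MeasurableSpace β]
    {ρ : Measure (α × β)} [IsProbabilityMeasure ρ] {D : α × β → ℝ≥0∞} (hD : Measurable D)
    (hρ : ρ = (ρ.fst.prod ρ.snd).withDensity D)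
    (hint : Integrable (fun q => Real.log (D q).toReal) ρ) :
    mutualInfo ρ = ENNReal.ofReal (∫ q, Real.log (D q).toReal ∂ρ) := by
  have hac : ρ ≪ ρ.fst.prod ρ.snd := by
    conv_lhs => rw [hρ]
    exact withDensity_absolutelyContinuous _ _
  have hllr : llr ρ (ρ.fst.prod ρ.snd) =ᵐ[ρ] fun q => Real.log (D q).toReal := by
    have hderiv := Measure.rnDeriv_withDensity (ρ.fst.prod ρ.snd) hD
    rw [← hρ] at hderiv
    filter_upwards [hac.ae_le hderiv] with q hq
    rw [llr, hq]
  rw [mutualInfo, InformationTheory.klDiv_of_ac_of_integrable hac (hint.congr hllr.symm),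
    integral_congr_ae hllr, probReal_univ, probReal_univ, add_sub_cancel_right]

lemma log_toReal_gaussianPDF (m : ℝ) {v : ℝ≥0} (hv : v ≠ 0) (x : ℝ) :
    Real.log (gaussianPDF m v x).toReal =
      -(1 / 2) * Real.log (2 * Real.pi * v) - (x - m) ^ 2 / (2 * v) := by
  have hpi : 0 < 2 * Real.pi * v := by positivity
  rw [toReal_gaussianPDF, gaussianPDFReal, Real.log_mul (by positivity) (Real.exp_pos _).ne',
    Real.log_exp, Real.log_inv, Real.log_sqrt hpi.le]
  ring

lemma autoregressionDensity_ne_zero {Θ : Type*} {m : (i : Fin n) → Θ × (Fin i → ℝ) → ℝ}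
    (hv : ∀ i, v i ≠ 0) (p : Θ × (Fin n → ℝ)) :
    autoregressionDensity m v p ≠ 0 :=
  Finset.prod_ne_zero_iff.2 fun i _ => (gaussianPDF_pos _ (hv i) _).ne'

lemma autoregressionDensity_ne_top {Θ : Type*} {m : (i : Fin n) → Θ × (Fin i → ℝ) → ℝ}
    (p : Θ × (Fin n → ℝ)) : autoregressionDensity m v p ≠ ∞ :=
  ENNReal.prod_ne_top fun _ _ => gaussianPDF_ne_top

lemma toReal_autoregressionDensity_ne_zero {Θ : Type*} {m : (i : Fin n) → Θ × (Fin i → ℝ) → ℝ}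
    (hv : ∀ i, v i ≠ 0) (p : Θ × (Fin n → ℝ)) : (autoregressionDensity m v p).toReal ≠ 0 :=
  (ENNReal.toReal_pos (autoregressionDensity_ne_zero hv p) (autoregressionDensity_ne_top p)).ne'

lemma log_toReal_autoregressionDensity {Θ : Type*} {m : (i : Fin n) → Θ × (Fin i → ℝ) → ℝ}
    (hv : ∀ i, v i ≠ 0) (p : Θ × (Fin n → ℝ)) :
    Real.log (autoregressionDensity m v p).toReal =
      ∑ i, (-(1 / 2) * Real.log (2 * Real.pi * v i) -
        (p.2 i - m i (p.1, past p.2 i)) ^ 2 / (2 * v i)) := by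
  rw [autoregressionDensity, ENNReal.toReal_prod, Real.log_prod fun i _ =>
    (ENNReal.toReal_pos (gaussianPDF_pos _ (hv i) _).ne' gaussianPDF_ne_top).ne']
  exact Finset.sum_congr rfl fun i _ => log_toReal_gaussianPDF _ (hv i) _

namespace IsGaussianAutoregression

lemma aemeasurable (h : IsGaussianAutoregression P θ Y m v) : AEMeasurable (fun ω => (Y · ω)) P :=
  aemeasurable_pi_lambda _ fun i => (h.hasCondDistrib i).aemeasurable_snd

lemma aemeasurable_residual (h : IsGaussianAutoregression P θ Y m v) (i : Fin n) :
    AEMeasurable (fun ω => Y i ω - m i (θ ω, past (Y · ω) i)) P :=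
  (h.hasCondDistrib i).aemeasurable_snd.sub
    ((h.measurable_mean i).comp_aemeasurable (h.hasCondDistrib i).aemeasurable_fst)

variable [IsProbabilityMeasure P]

lemma hasLaw_residual (h : IsGaussianAutoregression P θ Y m v) (i : Fin n) :
    HasLaw (fun ω => Y i ω - m i (θ ω, past (Y · ω) i)) (gaussianReal 0 (v i)) P := by
  refine ⟨h.aemeasurable_residual i, Measure.ext_of_lintegral _ fun g hg => ?_⟩
  have hG : Measurable fun q : (Θ × (Fin i → ℝ)) × ℝ => g (q.2 - m i q.1) :=
    hg.comp (measurable_snd.sub ((h.measurable_mean i).comp measurable_fst))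
  have hcenter : ∀ c : ℝ, ∫⁻ u, g (u - c) ∂gaussianReal c (v i) = ∫⁻ u, g u ∂gaussianReal 0 (v i) :=
    fun c => by
      rw [← lintegral_map (f := g) (g := (· - c)) hg (measurable_id.sub_const c),
        gaussianReal_map_sub_const, sub_self]
  rw [lintegral_map' hg.aemeasurable (h.aemeasurable_residual i),
    lintegral_of_hasCondDistrib (h.hasCondDistrib i) hG]
  refine (lintegral_congr fun ω => hcenter (m i (θ ω, past (Y · ω) i))).trans ?_
  rw [lintegral_const, measure_univ, mul_one]

lemma integrable_residual_sq (h : IsGaussianAutoregression P θ Y m v) (i : Fin n) :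
    Integrable (fun ω => (Y i ω - m i (θ ω, past (Y · ω) i)) ^ 2) P :=
  (h.hasLaw_residual i).hasGaussianLaw.memLp_two.integrable_sq

lemma integral_residual_sq (h : IsGaussianAutoregression P θ Y m v) (i : Fin n) :
    ∫ ω, (Y i ω - m i (θ ω, past (Y · ω) i)) ^ 2 ∂P = v i := by
  have hlaw := h.hasLaw_residual i
  rw [← variance_of_integral_eq_zero hlaw.aemeasurable
    (by rw [hlaw.integral_eq, integral_id_gaussianReal]), hlaw.variance_eq,
    variance_id_gaussianReal]

lemma integrable_log_density_term (h : IsGaussianAutoregression P θ Y m v) (i : Fin n) :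
    Integrable (fun ω => -(1 / 2) * Real.log (2 * Real.pi * v i) -
      (Y i ω - m i (θ ω, past (Y · ω) i)) ^ 2 / (2 * v i)) P :=
  (integrable_const _).sub ((h.integrable_residual_sq i).div_const _)

lemma integrable_log_density (h : IsGaussianAutoregression P θ Y m v) :
    Integrable (fun ω => Real.log (autoregressionDensity m v (θ ω, (Y · ω))).toReal) P := by
  simp only [log_toReal_autoregressionDensity h.variance_ne_zero]
  exact integrable_finsetSum _ fun i _ => h.integrable_log_density_term i

lemma integral_log_density (h : IsGaussianAutoregression P θ Y m v) :
    ∫ ω, Real.log (autoregressionDensity m v (θ ω, (Y · ω))).toReal ∂P =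
      ∑ i, (-(1 / 2) * Real.log (2 * Real.pi * v i) - 1 / 2) := by
  simp only [log_toReal_autoregressionDensity h.variance_ne_zero]
  rw [integral_finsetSum _ fun i _ => h.integrable_log_density_term i]
  refine Finset.sum_congr rfl fun i _ => ?_
  have hv : (v i : ℝ) ≠ 0 := NNReal.coe_ne_zero.2 (h.variance_ne_zero i)
  rw [integral_sub (integrable_const _) ((h.integrable_residual_sq i).div_const _), integral_div,
    h.integral_residual_sq, integral_const, probReal_univ, one_smul]
  field_simp

lemma map_eq_withDensity (h : IsGaussianAutoregression P θ Y m v) :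
    P.map (fun ω => ((Y · ω), θ ω)) =
      (volume.prod (P.map θ)).withDensity fun q => autoregressionDensity m v q.swap := by
  have hdens : Measurable fun q : (Fin n → ℝ) × Θ => autoregressionDensity m v q.swap :=
    (measurable_autoregressionDensity h.measurable_mean).comp measurable_swap
  refine Measure.ext_of_lintegral _ fun g hg => ?_
  rw [lintegral_map' hg.aemeasurable (h.aemeasurable.prodMk h.aemeasurable_parameter),
    lintegral_withDensity_eq_lintegral_mul _ hdens hg, lintegral_prod_symm' _ (hdens.mul hg),
    lintegral_map' (hdens.mul hg).lintegral_prod_left'.aemeasurable h.aemeasurable_parameter]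
  refine (h.lintegral_eq (hg.comp measurable_swap)).trans ?_
  exact lintegral_congr fun ω => lintegral_congr fun y => mul_comm _ _

variable {m' : (i : Fin n) → Unit × (Fin i → ℝ) → ℝ} {v' : Fin n → ℝ≥0}

lemma map_data_eq_withDensity (h' : IsGaussianAutoregression P (fun _ => ()) Y m' v') :
    P.map (fun ω => (Y · ω)) = volume.withDensity fun y => autoregressionDensity m' v' ((), y) := by
  have hdens : Measurable fun y : Fin n → ℝ => autoregressionDensity m' v' ((), y) :=
    (measurable_autoregressionDensity h'.measurable_mean).comp measurable_prodMk_left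
  refine Measure.ext_of_lintegral _ fun g hg => ?_
  rw [lintegral_map' hg.aemeasurable h'.aemeasurable,
    lintegral_withDensity_eq_lintegral_mul _ hdens hg]
  refine (h'.lintegral_eq (G := fun q => g q.2) (hg.comp measurable_snd)).trans ?_
  rw [lintegral_const, measure_univ, mul_one]
  exact lintegral_congr fun y => mul_comm _ _

lemma map_eq_withDensity_prod (h : IsGaussianAutoregression P θ Y m v)
    (h' : IsGaussianAutoregression P (fun _ => ()) Y m' v') :
    P.map (fun ω => ((Y · ω), θ ω)) =
      ((P.map fun ω => (Y · ω)).prod (P.map θ)).withDensity fun q =>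
        autoregressionDensity m v q.swap / autoregressionDensity m' v' ((), q.1) := by
  have hdens : Measurable fun q : (Fin n → ℝ) × Θ => autoregressionDensity m v q.swap :=
    (measurable_autoregressionDensity h.measurable_mean).comp measurable_swap
  have hdens' : Measurable fun y : Fin n → ℝ => autoregressionDensity m' v' ((), y) :=
    (measurable_autoregressionDensity h'.measurable_mean).comp measurable_prodMk_left
  rw [h'.map_data_eq_withDensity, prod_withDensity_left hdens', h.map_eq_withDensity]
  refine Eq.trans ?_ (withDensity_mul _ (hdens'.comp measurable_fst)
    (hdens.div (hdens'.comp measurable_fst)))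
  congr 1
  funext q
  exact (ENNReal.mul_div_cancel (autoregressionDensity_ne_zero h'.variance_ne_zero _)
    (autoregressionDensity_ne_top _)).symm

/-- The mutual information is the expected logarithm of the ratio of the conditional density of the
data to their marginal density, and both are densities of Gaussian autoregressions. -/
theorem mutualInfo_eq (h : IsGaussianAutoregression P θ Y m v)
    (h' : IsGaussianAutoregression P (fun _ => ()) Y m' v') :
    mutualInfo (P.map fun ω => ((Y · ω), θ ω)) =
      ENNReal.ofReal (∑ i, 1 / 2 * Real.log (v' i / v i)) := by
  have hpair := h.aemeasurable.prodMk h.aemeasurable_parameter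
  have := Measure.isProbabilityMeasure_map hpair
  set D : (Fin n → ℝ) × Θ → ℝ≥0∞ := fun q =>
    autoregressionDensity m v q.swap / autoregressionDensity m' v' ((), q.1)
  have hD : Measurable D :=
    ((measurable_autoregressionDensity h.measurable_mean).comp measurable_swap).div
      ((measurable_autoregressionDensity h'.measurable_mean).comp (by fun_prop))
  have hlog : ∀ ω, Real.log (D ((Y · ω), θ ω)).toReal =
      Real.log (autoregressionDensity m v (θ ω, (Y · ω))).toReal -
        Real.log (autoregressionDensity m' v' ((), (Y · ω))).toReal := fun ω => by
    rw [ENNReal.toReal_div]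
    exact Real.log_div (toReal_autoregressionDensity_ne_zero h.variance_ne_zero _)
      (toReal_autoregressionDensity_ne_zero h'.variance_ne_zero _)
  have hlogD : AEStronglyMeasurable (fun q => Real.log (D q).toReal)
      (P.map fun ω => ((Y · ω), θ ω)) :=
    (Real.measurable_log.comp hD.ennreal_toReal).aestronglyMeasurable
  have hint := h.integrable_log_density.sub h'.integrable_log_density
  rw [mutualInfo_eq_integral_log hD, integral_map hpair hlogD]
  · simp only [hlog]
    rw [integral_sub h.integrable_log_density h'.integrable_log_density, h.integral_log_density,
      h'.integral_log_density, ← Finset.sum_sub_distrib]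
    refine congrArg _ (Finset.sum_congr rfl fun i _ => ?_)
    have hv := NNReal.coe_ne_zero.2 (h.variance_ne_zero i)
    have hv' := NNReal.coe_ne_zero.2 (h'.variance_ne_zero i)
    rw [Real.log_mul (by positivity) hv, Real.log_mul (by positivity) hv', Real.log_div hv' hv]
    ring
  · rw [Measure.fst, Measure.snd, AEMeasurable.map_map_of_aemeasurable (by fun_prop) hpair,
      AEMeasurable.map_map_of_aemeasurable (by fun_prop) hpair]
    exact h.map_eq_withDensity_prod h'
  · rw [integrable_map_measure hlogD hpair]
    exact hint.congr (.of_forall fun ω => (hlog ω).symm)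

end IsGaussianAutoregression

end Autoregression

section InformationGain

variable {Ω : Type*} {d n : ℕ} {X : Set (Pt d)} {k : Pt d → Pt d → ℝ} {f : Ω → Pt d → ℝ}
  {xs : Fin n → Pt d} {σ : ℝ≥0}

/-- The variance of the process at the `i`-th point, given the observations at the earlier ones. -/
noncomputable def predVar (k : Pt d → Pt d → ℝ) (σ : ℝ≥0) (xs : Fin n → Pt d) (i : Fin n) : ℝ :=
  postVar k σ (past xs i) (xs i)

/-- The mutual information between the process and its observations at the points `xs`, in closed
form. -/
noncomputable def designInfo (k : Pt d → Pt d → ℝ) (σ : ℝ≥0) (xs : Fin n → Pt d) : ℝ :=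
  ∑ i, 1 / 2 * Real.log (1 + ((σ : ℝ) ^ 2)⁻¹ * predVar k σ xs i)

namespace IsCenteredGP

variable [MeasurableSpace Ω] {P : Measure Ω} [IsProbabilityMeasure P]

lemma predVar_nonneg (hf : IsCenteredGP X k f P) (hxs : ∀ i, xs i ∈ X) (hσ : 0 < σ) (i : Fin n) :
    0 ≤ predVar k σ xs i :=
  hf.postVar_nonneg (fun _ => hxs _) hσ (hxs i)

lemma isGaussianAutoregression_prediction (hf : IsCenteredGP X k f P) (hxs : ∀ i, xs i ∈ X)
    (hσ : 0 < σ) :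
    IsGaussianAutoregression (designMeasure P σ n) (fun _ => ()) (fun i p => noisyObs f xs p i)
      (fun i q => postMean k σ (past xs i) q.2 (xs i))
      (fun i => (predVar k σ xs i + σ ^ 2).toNNReal) where
  aemeasurable_parameter := aemeasurable_const
  measurable_mean i := IsGaussianRegression.measurable_prediction.comp measurable_snd
  variance_ne_zero i := by
    have := hf.predVar_nonneg hxs hσ i
    exact (Real.toNNReal_pos.2 (by positivity)).ne'
  hasCondDistrib i := by
    have h := hf.isGaussianRegression_innovation hxs hσ i
    have hvar := hf.variance_residual_innovation (σ := σ) hxs i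
    have hlaw := h.hasLaw_residual
    rw [hvar] at hlaw
    exact hasCondDistrib_of_indepFun_sub
      (aemeasurable_const.prodMk h.hasGaussianLaw.snd.aemeasurable)
      (IsGaussianRegression.measurable_prediction.comp measurable_snd) hlaw
      (h.indepFun_residual.comp measurable_id (measurable_prodMk_left (x := ())))

theorem infoGain_eq (hf : IsCenteredGP X k f P) (hxs : ∀ i, xs i ∈ X) (hσ : 0 < σ) :
    infoGain f P σ xs = ENNReal.ofReal (designInfo k σ xs) := by
  have hfxs : Measurable fun ω i => f ω (xs i) :=
    measurable_pi_lambda _ fun i => hf.measurable _ (hxs i)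
  have hobs : IsGaussianAutoregression (designMeasure P σ n) (fun p i => f p.1 (xs i))
      (fun i p => noisyObs f xs p i) (fun i q => q.1 i) (fun _ => σ ^ 2) :=
    isGaussianAutoregression_of_noise (hfxs.comp measurable_fst).aemeasurable
      (fun i => (measurable_pi_apply i).comp measurable_fst) (fun _ => by positivity)
      hasLaw_noise iIndepFun_noise (indepFun_process_noise hfxs) fun _ => .of_forall fun _ => rfl
  have hjoint :
      ((P.map fun ω i => f ω (xs i)).prod (Measure.pi fun _ => gaussianReal 0 (σ ^ 2))).map
      (fun p : (Fin n → ℝ) × (Fin n → ℝ) => (p.1 + p.2, p.1)) =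
      (designMeasure P σ n).map fun p => ((noisyObs f xs p ·), fun i => f p.1 (xs i)) := by
    have hmap := Measure.map_prod_map P (Measure.pi fun _ : Fin n => gaussianReal 0 (σ ^ 2))
      hfxs measurable_id
    rw [Measure.map_id] at hmap
    rw [hmap, Measure.map_map (by fun_prop) (hfxs.prodMap measurable_id)]
    rfl
  rw [infoGain, hjoint, hobs.mutualInfo_eq (hf.isGaussianAutoregression_prediction hxs hσ),
    designInfo]
  refine congrArg _ (Finset.sum_congr rfl fun i _ => ?_)
  have hv := hf.predVar_nonneg hxs hσ i
  rw [Real.coe_toNNReal _ (by positivity)]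
  push_cast
  congr 2
  field_simp
  ring

end IsCenteredGP

end InformationGain

/-! ### The maximum information gain -/

section KernelContinuity

variable {Ω : Type*} [MeasurableSpace Ω] {P : Measure Ω}

lemma integral_cos_of_hasLaw_gaussianReal {U : Ω → ℝ} {v : ℝ≥0}
    (hU : HasLaw U (gaussianReal 0 v) P) : ∫ ω, Real.cos (U ω) ∂P = Real.exp (-v / 2) := by
  have hcos : ∀ u : ℝ, Complex.reCLM (Complex.exp ((1 : ℝ) * (u : ℂ) * Complex.I)) = Real.cos u :=
    fun u => by
      rw [Complex.ofReal_one, one_mul, Complex.reCLM_apply, Complex.exp_ofReal_mul_I_re]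
  have hint : Integrable (fun u : ℝ => Complex.exp ((1 : ℝ) * (u : ℂ) * Complex.I))
      (gaussianReal 0 v) := by
    refine Integrable.of_bound (C := 1) (by fun_prop) (.of_forall fun u => ?_)
    rw [Complex.ofReal_one, one_mul, Complex.norm_exp_ofReal_mul_I]
  have hchar : ∫ u : ℝ, Complex.exp ((1 : ℝ) * (u : ℂ) * Complex.I) ∂gaussianReal 0 v =
      ((Real.exp (-v / 2) : ℝ) : ℂ) := by
    rw [← charFun_apply_real, charFun_gaussianReal]
    push_cast
    congr 1
    ring
  calc ∫ ω, Real.cos (U ω) ∂P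
      = ∫ u, Real.cos u ∂gaussianReal 0 v :=
        hU.integral_comp Real.continuous_cos.aestronglyMeasurable
    _ = Complex.reCLM (∫ u : ℝ, Complex.exp ((1 : ℝ) * (u : ℂ) * Complex.I) ∂gaussianReal 0 v) := by
        rw [← ContinuousLinearMap.integral_comp_comm _ hint]
        simp only [hcos]
    _ = Real.exp (-v / 2) := by rw [hchar, Complex.reCLM_apply, Complex.ofReal_re]

lemma continuous_variance_of_hasGaussianLaw {S : Type*} [TopologicalSpace S]
    [FirstCountableTopology S] {Y : S → Ω → ℝ} (hY : ∀ s, HasGaussianLaw (Y s) P)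
    (hmean : ∀ s, ∫ ω, Y s ω ∂P = 0) (hcont : ∀ᵐ ω ∂P, Continuous fun s => Y s ω) :
    Continuous fun s => Var[Y s; P] := by
  by_cases! hS : IsEmpty S
  · exact continuous_of_discreteTopology
  have : IsProbabilityMeasure P := (hY hS.some).isProbabilityMeasure
  have hcos : ∀ s, ∫ ω, Real.cos (Y s ω) ∂P = Real.exp (-Var[Y s; P] / 2) := fun s => by
    have hlaw : HasLaw (Y s) (gaussianReal 0 Var[Y s; P].toNNReal) P :=
      ⟨(hY s).aemeasurable, by rw [(hY s).map_eq_gaussianReal, hmean]⟩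
    rw [integral_cos_of_hasLaw_gaussianReal hlaw, Real.coe_toNNReal _ (variance_nonneg _ _)]
  have hvar : (fun s => Var[Y s; P]) = fun s => -2 * Real.log (∫ ω, Real.cos (Y s ω) ∂P) := by
    funext s
    rw [hcos, Real.log_exp]
    ring
  rw [hvar]
  refine continuous_const.mul (Continuous.log ?_ fun s => (hcos s).symm ▸ (Real.exp_pos _).ne')
  refine continuous_of_dominated (bound := fun _ => 1) (fun s => ?_)
    (fun s => .of_forall fun ω => Real.abs_cos_le_one _) (integrable_const _) ?_
  · exact Real.continuous_cos.comp_aestronglyMeasurable (hY s).aemeasurable.aestronglyMeasurable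
  · filter_upwards [hcont] with ω hω
    exact Real.continuous_cos.comp hω

variable {d : ℕ} {X : Set (Pt d)} {k : Pt d → Pt d → ℝ} {f : Ω → Pt d → ℝ} {n : ℕ} {σ : ℝ≥0}

theorem IsCenteredGP.continuous_kernel (hf : IsCenteredGP X k f P)
    (hcont : ∀ᵐ ω ∂P, ContinuousOn (f ω) X) : Continuous fun q : X × X => k q.1 q.2 := by
  have hcont' : ∀ᵐ ω ∂P, Continuous fun z : X => f ω z := by
    filter_upwards [hcont] with ω hω
    exact continuousOn_iff_continuous_domRestrict.1 hω
  have hsingle : Continuous fun z : X => Var[fun ω => f ω z; P] :=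
    continuous_variance_of_hasGaussianLaw (fun z => hf.gaussian.hasGaussianLaw_eval z)
      (fun z => hf.mean_zero z z.2) hcont'
  have hdiff : Continuous fun q : X × X => Var[fun ω => f ω q.1 - f ω q.2; P] := by
    refine continuous_variance_of_hasGaussianLaw
      (fun q => hf.gaussian.hasGaussianLaw_fun_sub) (fun q => ?_) ?_
    · have : IsProbabilityMeasure P :=
        (hf.gaussian.hasGaussianLaw_eval q.1).isProbabilityMeasure
      rw [integral_sub ((hf.memLp q.1.2).integrable one_le_two)
        ((hf.memLp q.2.2).integrable one_le_two), hf.mean_zero _ q.1.2, hf.mean_zero _ q.2.2,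
        sub_zero]
    · filter_upwards [hcont'] with ω hω
      exact (hω.comp continuous_fst).sub (hω.comp continuous_snd)
  have hpolar : (fun q : X × X => k q.1 q.2) = fun q : X × X =>
      (Var[fun ω => f ω q.1; P] + Var[fun ω => f ω q.2; P] -
        Var[fun ω => f ω q.1 - f ω q.2; P]) / 2 := by
    funext q
    have : IsProbabilityMeasure P := (hf.gaussian.hasGaussianLaw_eval q.1).isProbabilityMeasure
    rw [variance_fun_sub (hf.memLp q.1.2) (hf.memLp q.2.2), hf.covariance_eq _ q.1.2 _ q.2.2]
    ring
  rw [hpolar]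
  exact (((hsingle.comp continuous_fst).add (hsingle.comp continuous_snd)).sub hdiff).div_const 2

variable [IsFiniteMeasure P]

lemma IsCenteredGP.continuous_inv_regGram (hf : IsCenteredGP X k f P) (hσ : 0 < σ)
    (hk : Continuous fun q : X × X => k q.1 q.2) :
    Continuous fun xs : Fin n → X => (regGram k σ (fun i => (xs i : Pt d)))⁻¹ := by
  have hgram : Continuous fun xs : Fin n → X => regGram k σ (fun i => (xs i : Pt d)) := by
    unfold regGram
    refine Continuous.add (continuous_matrix fun i j => ?_) continuous_const
    have hij : Continuous fun xs : Fin n → X => (xs i, xs j) := by fun_prop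
    exact hk.comp hij
  have hdet : ∀ xs : Fin n → X, (regGram k σ (fun i => (xs i : Pt d))).det ≠ 0 := fun xs =>
    ((Matrix.isUnit_iff_isUnit_det _).1 (hf.posDef_regGram (fun i => (xs i).2) hσ).isUnit).ne_zero
  simp_rw [Matrix.inv_def, Ring.inverse_eq_inv']
  exact (hgram.matrix_det.inv₀ hdet).smul hgram.matrix_adjugate

lemma continuous_kernel_vec (hk : Continuous fun q : X × X => k q.1 q.2) :
    Continuous fun q : (Fin n → X) × X => (fun i => k q.2 (q.1 i) : Fin n → ℝ) :=
  continuous_pi fun i => hk.comp (continuous_snd.prodMk ((continuous_apply i).comp continuous_fst))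

lemma IsCenteredGP.continuous_postVar (hf : IsCenteredGP X k f P) (hσ : 0 < σ)
    (hk : Continuous fun q : X × X => k q.1 q.2) :
    Continuous fun q : (Fin n → X) × X => postVar k σ (fun i => (q.1 i : Pt d)) q.2 := by
  unfold postVar
  refine (hk.comp (continuous_snd.prodMk continuous_snd)).sub ?_
  exact (continuous_kernel_vec hk).dotProduct
    (((hf.continuous_inv_regGram hσ hk).comp continuous_fst).matrix_mulVec
      (continuous_kernel_vec hk))

lemma IsCenteredGP.continuous_postMean (hf : IsCenteredGP X k f P) (hσ : 0 < σ)
    (hk : Continuous fun q : X × X => k q.1 q.2) :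
    Continuous fun q : ((Fin n → X) × (Fin n → ℝ)) × X =>
      postMean k σ (fun i => (q.1.1 i : Pt d)) q.1.2 q.2 := by
  unfold postMean
  refine ((continuous_kernel_vec hk).comp
    ((continuous_fst.comp continuous_fst).prodMk continuous_snd)).dotProduct ?_
  exact ((hf.continuous_inv_regGram hσ hk).comp
    (continuous_fst.comp continuous_fst)).matrix_mulVec (continuous_snd.comp continuous_fst)

end KernelContinuity

section InformationBounds

variable {Ω : Type*} [MeasurableSpace Ω] {P : Measure Ω} [IsProbabilityMeasure P] {d n : ℕ}
  {X : Set (Pt d)} {k : Pt d → Pt d → ℝ} {f : Ω → Pt d → ℝ} {σ : ℝ≥0}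

lemma C₁_pos (hσ : 0 < σ) : 0 < C₁ σ :=
  div_pos two_pos (Real.log_pos (lt_add_of_pos_right 1 (by positivity)))

namespace IsCenteredGP

lemma continuous_designInfo (hf : IsCenteredGP X k f P) (hσ : 0 < σ)
    (hk : Continuous fun q : X × X => k q.1 q.2) :
    Continuous fun xs : Fin n → X => designInfo k σ (fun i => (xs i : Pt d)) := by
  unfold designInfo
  refine continuous_finsetSum _ fun i _ => continuous_const.mul (Continuous.log ?_ fun xs => ?_)
  · have hpast : Continuous fun xs : Fin n → X => (past xs i, xs i) :=
      (continuous_pi fun j => continuous_apply _).prodMk (continuous_apply i)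
    exact continuous_const.add (continuous_const.mul ((hf.continuous_postVar hσ hk).comp hpast))
  · have := hf.predVar_nonneg (fun i => (xs i).2) hσ i
    positivity

variable {xs : Fin n → Pt d}

lemma predVar_le_one (hf : IsCenteredGP X k f P) (hk : ∀ z ∈ X, k z z ≤ 1) (hxs : ∀ i, xs i ∈ X)
    (hσ : 0 < σ) (i : Fin n) : predVar k σ xs i ≤ 1 :=
  (hf.postVar_le (fun _ => hxs _) hσ _).trans (hk _ (hxs i))

lemma designInfo_le (hf : IsCenteredGP X k f P) (hk : ∀ z ∈ X, k z z ≤ 1) (hxs : ∀ i, xs i ∈ X)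
    (hσ : 0 < σ) : designInfo k σ xs ≤ n * (1 / 2 * Real.log (1 + ((σ : ℝ) ^ 2)⁻¹)) := by
  have hterm : ∀ i ∈ Finset.univ, 1 / 2 * Real.log (1 + ((σ : ℝ) ^ 2)⁻¹ * predVar k σ xs i) ≤
      1 / 2 * Real.log (1 + ((σ : ℝ) ^ 2)⁻¹) := fun i _ => by
    have h0 := hf.predVar_nonneg hxs hσ i
    gcongr
    exact mul_le_of_le_one_right (by positivity) (hf.predVar_le_one hk hxs hσ i)
  exact (Finset.sum_le_sum hterm).trans_eq (by simp)

lemma sum_predVar_le (hf : IsCenteredGP X k f P) (hk : ∀ z ∈ X, k z z ≤ 1) (hxs : ∀ i, xs i ∈ X)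
    (hσ : 0 < σ) : ∑ i, predVar k σ xs i ≤ C₁ σ * designInfo k σ xs := by
  set c : ℝ := ((σ : ℝ) ^ 2)⁻¹
  have hc : 0 < c := by positivity
  have hlog : 0 < Real.log (1 + c) := Real.log_pos (by linarith)
  -- `log (1 + c v) / v` decreases in `v ∈ (0, 1]` by concavity of the logarithm.
  have hconcave : ∀ i,
      predVar k σ xs i * Real.log (1 + c) ≤ Real.log (1 + c * predVar k σ xs i) := fun i => by
    have h := strictConcaveOn_log_Ioi.concaveOn.2 (mem_Ioi.2 one_pos)
      (mem_Ioi.2 (by linarith : 0 < 1 + c)) (sub_nonneg.2 (hf.predVar_le_one hk hxs hσ i))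
      (hf.predVar_nonneg hxs hσ i) (by ring)
    simp only [Real.log_one, smul_eq_mul, mul_zero, zero_add] at h
    exact h.trans_eq (congrArg Real.log (by ring))
  unfold C₁ designInfo
  rw [div_mul_eq_mul_div, le_div_iff₀ hlog, Finset.sum_mul, Finset.mul_sum]
  exact Finset.sum_le_sum fun i _ => (hconcave i).trans_eq (by ring)

theorem maxInfoGain_ne_top (hf : IsCenteredGP X k f P) (hk : ∀ z ∈ X, k z z ≤ 1) (hσ : 0 < σ)
    (T : ℕ) : maxInfoGain X f P σ T ≠ ∞ := by
  refine ne_top_of_le_ne_top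
    (ENNReal.ofReal_ne_top (r := T * (1 / 2 * Real.log (1 + ((σ : ℝ) ^ 2)⁻¹))))
    (iSup_le fun A => iSup_le fun _ => iSup_le fun hA => ?_)
  exact (hf.infoGain_eq hA hσ).trans_le (ENNReal.ofReal_le_ofReal (hf.designInfo_le hk hA hσ))

end IsCenteredGP

lemma dense_injective {ι S : Type*} [Finite ι] [TopologicalSpace S] [T2Space S] [PerfectSpace S] :
    Dense {u : ι → S | Function.Injective u} := by
  have hinter : {u : ι → S | Function.Injective u} =
      ⋂₀ range fun p : {p : ι × ι // p.1 ≠ p.2} => {u : ι → S | u p.1.1 ≠ u p.1.2} := by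
    ext u
    simp only [sInter_range, mem_iInter, mem_ofPred_eq, Subtype.forall, Prod.forall]
    exact ⟨fun h i j hij => h.ne hij, fun h i j huij => of_not_not fun hij => h i j hij huij⟩
  rw [hinter]
  refine (finite_range _).dense_sInter (forall_mem_range.2 fun p => ?_)
    (forall_mem_range.2 fun p u => ?_)
  · exact isOpen_ne_fun (continuous_apply _) (continuous_apply _)
  · classical
    have hupdate : Continuous (Function.update u p.1.1) := continuous_const.update _ continuous_id
    have hmem := map_mem_closure hupdate (dense_compl_singleton (u p.1.2) (u p.1.1))
      (t := {u | u p.1.1 ≠ u p.1.2}) fun z hz => by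
        rw [mem_ofPred_eq, Function.update_self, Function.update_of_ne p.2.symm]
        exact hz
    rwa [Function.update_eq_self] at hmem

/-- `maxInfoGain` ranges over distinct points, `xs` may have repetitions. -/
theorem IsCenteredGP.designInfo_le_maxInfoGain (hf : IsCenteredGP X k f P)
    (hcont : ∀ᵐ ω ∂P, ContinuousOn (f ω) X) (hk : ∀ z ∈ X, k z z ≤ 1) (hconn : IsPreconnected X)
    (hnt : X.Nontrivial) (hσ : 0 < σ) (xs : Fin n → X) :
    designInfo k σ (fun i => (xs i : Pt d)) ≤ (maxInfoGain X f P σ n).toReal := by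
  have : Nontrivial X := hnt.coe_sort
  have : ConnectedSpace X := isConnected_iff_connectedSpace.1 ⟨hnt.nonempty, hconn⟩
  have hclosed : IsClosed {xs : Fin n → X |
      designInfo k σ (fun i => (xs i : Pt d)) ≤ (maxInfoGain X f P σ n).toReal} :=
    isClosed_le (hf.continuous_designInfo hσ (hf.continuous_kernel hcont)) continuous_const
  refine hclosed.closure_subset_iff.2 (fun xs hxs => ?_) (dense_injective xs)
  have hgain : infoGain f P σ (fun i => (xs i : Pt d)) ≤ maxInfoGain X f P σ n :=
    le_iSup_of_le (fun i => (xs i : Pt d)) <| le_iSup_of_le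
      (Subtype.val_injective.comp hxs) <| le_iSup_of_le (fun i => (xs i).2) le_rfl
  rw [hf.infoGain_eq (fun i => (xs i).2) hσ] at hgain
  exact (ENNReal.ofReal_le_iff_le_toReal (hf.maxInfoGain_ne_top hk hσ n)).1 hgain

end InformationBounds

/-! ### Adaptive designs -/

section Path

variable {Ω : Type*} [MeasurableSpace Ω] {P : Measure Ω} {d : ℕ} {X : Set (Pt d)}
  {k : Pt d → Pt d → ℝ} {f : Ω → Pt d → ℝ}

/-- The continuous functions on `X`, with the σ-algebra generated by the evaluations: the sample
paths of the process, as the parameter of the autoregression formed by the observations. -/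
abbrev Path (X : Set (Pt d)) : Type := {φ : X → ℝ // Continuous φ}

lemma measurable_path_eval : Measurable fun p : Path X × X => p.1.1 p.2 :=
  (measurable_uncurry_of_continuous_of_measurable (u := fun (z : X) (φ : Path X) => φ.1 z)
    (fun φ => φ.2) fun z => (measurable_pi_apply z).comp measurable_subtype_coe).comp
    measurable_swap

lemma IsCenteredGP.exists_measurable_path (hf : IsCenteredGP X k f P)
    (hcont : ∀ᵐ ω ∂P, ContinuousOn (f ω) X) :
    ∃ F : Ω → Path X, Measurable F ∧ ∀ᵐ ω ∂P, ∀ z : X, (F ω).1 z = f ω z := by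
  classical
  obtain ⟨N, hN, hNm, hN0⟩ := exists_measurable_superset_of_null (ae_iff.1 hcont)
  refine ⟨fun ω => ⟨fun z => if ω ∈ N then 0 else f ω z, ?_⟩, ?_, ?_⟩
  · split_ifs with hω
    · exact continuous_const
    · exact continuousOn_iff_continuous_domRestrict.1 (not_not.1 fun h => hω (hN h))
  · exact Measurable.subtype_mk (measurable_pi_lambda _ fun z : X =>
      Measurable.ite hNm measurable_const (hf.measurable z z.2))
  · filter_upwards [measure_eq_zero_iff_ae_notMem.1 hN0] with ω hω z
    exact if_neg hω

lemma indepFun_path {𝒲 : Type*} [MeasurableSpace 𝒲] {W : Ω → 𝒲} {F : Ω → Path X}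
    (hF : ∀ᵐ ω ∂P, ∀ z : X, (F ω).1 z = f ω z)
    (hind : IndepFun (fun ω (z : X) => f ω z) W P) : IndepFun F W P := by
  have hval : IndepFun (fun ω => (F ω).1) W P :=
    hind.congr (hF.mono fun ω h => (funext h).symm) .rfl
  rw [indepFun_iff_measure_inter_preimage_eq_mul] at hval ⊢
  rintro _ u ⟨v, hv, rfl⟩ hu
  exact hval v u hv hu

end Path

section Adaptive

variable {Ω 𝒲 𝒵 : Type*} [MeasurableSpace Ω] [MeasurableSpace 𝒲] [MeasurableSpace 𝒵]
  {P : Measure Ω} {d n : ℕ} {X : Set (Pt d)} {k : Pt d → Pt d → ℝ} {f : Ω → Pt d → ℝ} {σ : ℝ≥0}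
  {W : Ω → 𝒲} {rule : (i : Fin n) → (Fin i → ℝ) × 𝒲 → X} {E Y : Fin n → Ω → ℝ}

/-- Observations `Y i = f (x i) + E i` at points `x i` chosen by `rule i` from the earlier
observations and the internal randomness `W`, with independent noise `E i ∼ N(0, σ²)`. -/
structure IsAdaptiveDesign (X : Set (Pt d)) (f : Ω → Pt d → ℝ) (P : Measure Ω) (σ : ℝ≥0)
    (W : Ω → 𝒲) (rule : (i : Fin n) → (Fin i → ℝ) × 𝒲 → X) (E Y : Fin n → Ω → ℝ) : Prop where
  measurable_rule : ∀ i, Measurable (rule i)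
  aemeasurable_randomness : AEMeasurable W P
  hasLaw_noise : ∀ i, HasLaw (E i) (gaussianReal 0 (σ ^ 2)) P
  iIndepFun_noise : iIndepFun E P
  indepFun_randomness : IndepFun W (fun ω => (E · ω)) P
  indepFun_process : IndepFun (fun ω (z : X) => f ω z) (fun ω => (W ω, (E · ω))) P
  observe : ∀ i ω, Y i ω = f ω (rule i (past (Y · ω) i, W ω)) + E i ω

/-- The points chosen by `rule` when the observations and the internal randomness are `D`. -/
def queries (rule : (i : Fin n) → (Fin i → ℝ) × 𝒲 → X) (D : (Fin n → ℝ) × 𝒲) (i : Fin n) : X :=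
  rule i (past D.1 i, D.2)

/-- The posterior mean at the data-dependent point `ξ D`, as a function of the data `D`. -/
noncomputable def dataMean (k : Pt d → Pt d → ℝ) (σ : ℝ≥0)
    (rule : (i : Fin n) → (Fin i → ℝ) × 𝒲 → X) (ξ : (Fin n → ℝ) × 𝒲 → X)
    (D : (Fin n → ℝ) × 𝒲) : ℝ :=
  postMean k σ (fun i => (queries rule D i : Pt d)) D.1 (ξ D)

/-- The posterior variance at the data-dependent point `ξ D`, as a function of the data `D`. -/
noncomputable def dataVar (k : Pt d → Pt d → ℝ) (σ : ℝ≥0)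
    (rule : (i : Fin n) → (Fin i → ℝ) × 𝒲 → X) (ξ : (Fin n → ℝ) × 𝒲 → X)
    (D : (Fin n → ℝ) × 𝒲) : ℝ≥0 :=
  (postVar k σ (fun i => (queries rule D i : Pt d)) (ξ D)).toNNReal

lemma measurable_queries (hrule : ∀ i, Measurable (rule i)) : Measurable (queries rule) :=
  measurable_pi_lambda _ fun i => (hrule i).comp (by fun_prop)

section Measurability

variable [IsFiniteMeasure P] {ξ : (Fin n → ℝ) × 𝒲 → X}

lemma IsCenteredGP.measurable_dataMean (hf : IsCenteredGP X k f P)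
    (hcont : ∀ᵐ ω ∂P, ContinuousOn (f ω) X) (hσ : 0 < σ) (hrule : ∀ i, Measurable (rule i))
    (hξ : Measurable ξ) : Measurable (dataMean k σ rule ξ) :=
  (hf.continuous_postMean hσ (hf.continuous_kernel hcont)).measurable.comp
    (((measurable_queries hrule).prodMk measurable_fst).prodMk hξ)

lemma IsCenteredGP.measurable_dataVar (hf : IsCenteredGP X k f P)
    (hcont : ∀ᵐ ω ∂P, ContinuousOn (f ω) X) (hσ : 0 < σ) (hrule : ∀ i, Measurable (rule i))
    (hξ : Measurable ξ) : Measurable (dataVar k σ rule ξ) :=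
  ((hf.continuous_postVar hσ (hf.continuous_kernel hcont)).measurable.comp
    ((measurable_queries hrule).prodMk hξ)).real_toNNReal

end Measurability

lemma IsCenteredGP.lintegral_path_mul_density {𝒲 : Type*} [IsProbabilityMeasure P]
    (hf : IsCenteredGP X k f P) (hσ : 0 < σ) {F : Ω → Path X}
    (hFf : ∀ᵐ ω ∂P, ∀ z : X, (F ω).1 z = f ω z)
    (rule : (i : Fin n) → (Fin i → ℝ) × 𝒲 → X) {g : ℝ → ℝ≥0∞} (hg : Measurable g) (z : X)
    (y : Fin n → ℝ) (w : 𝒲) :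
    ∫⁻ ω, g ((F ω).1 z) * autoregressionDensity
        (fun i (p : (Path X × 𝒲) × (Fin i → ℝ)) => p.1.1.1 (rule i (p.2, p.1.2)))
        (fun _ => σ ^ 2) ((F ω, w), y) ∂P =
      evidence f P σ (fun i => (queries rule (y, w) i : Pt d)) y *
        ∫⁻ u, g u ∂gaussianReal (postMean k σ (fun i => (queries rule (y, w) i : Pt d)) y z)
          (postVar k σ (fun i => (queries rule (y, w) i : Pt d)) z).toNNReal := by
  rw [← hf.lintegral_mul_likelihood (fun i => (queries rule (y, w) i).2) hσ z.2 y hg]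
  refine lintegral_congr_ae (hFf.mono fun ω h => ?_)
  simp only [autoregressionDensity, likelihood, queries, h]

namespace IsAdaptiveDesign

variable {F : Ω → Path X}

lemma aemeasurable_noise (hD : IsAdaptiveDesign X f P σ W rule E Y) :
    AEMeasurable (fun ω => (E · ω)) P :=
  aemeasurable_pi_lambda _ fun i => (hD.hasLaw_noise i).aemeasurable

lemma measurable_query_value (hD : IsAdaptiveDesign X f P σ W rule E Y) (i : Fin n) :
    Measurable fun p : (Path X × 𝒲) × (Fin i → ℝ) => p.1.1.1 (rule i (p.2, p.1.2)) :=
  measurable_path_eval.comp ((measurable_fst.comp measurable_fst).prodMk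
    ((hD.measurable_rule i).comp (by fun_prop)))

lemma observe_path (hD : IsAdaptiveDesign X f P σ W rule E Y)
    (hFf : ∀ᵐ ω ∂P, ∀ z : X, (F ω).1 z = f ω z) (i : Fin n) :
    ∀ᵐ ω ∂P, Y i ω = (F ω).1 (rule i (past (Y · ω) i, W ω)) + E i ω :=
  hFf.mono fun ω h => by rw [h, hD.observe]

lemma exists_measurable_solution (hD : IsAdaptiveDesign X f P σ W rule E Y)
    (hFf : ∀ᵐ ω ∂P, ∀ z : X, (F ω).1 z = f ω z) :
    ∃ Φ : (Path X × 𝒲) × (Fin n → ℝ) → Fin n → ℝ, Measurable Φ ∧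
      ∀ᵐ ω ∂P, (Y · ω) = Φ ((F ω, W ω), (E · ω)) :=
  GPBandit.exists_measurable_solution (θ := fun ω => (F ω, W ω)) hD.measurable_query_value
    (hD.observe_path hFf)

lemma isGaussianAutoregression [IsProbabilityMeasure P]
    (hD : IsAdaptiveDesign X f P σ W rule E Y) (hσ : 0 < σ) (hF : Measurable F)
    (hFf : ∀ᵐ ω ∂P, ∀ z : X, (F ω).1 z = f ω z) :
    IsGaussianAutoregression P (fun ω => (F ω, W ω)) Y
      (fun i p => p.1.1.1 (rule i (p.2, p.1.2))) (fun _ => σ ^ 2) := by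
  have hFWE : IndepFun (fun ω => (E · ω)) (fun ω => (W ω, F ω)) P :=
    indepFun_prodMk_of_indepFun_prodMk hD.aemeasurable_noise hD.aemeasurable_randomness
      hF.aemeasurable hD.indepFun_randomness.symm
      ((indepFun_path hFf hD.indepFun_process).symm.comp measurable_swap measurable_id)
  exact isGaussianAutoregression_of_noise (hF.aemeasurable.prodMk hD.aemeasurable_randomness)
    hD.measurable_query_value (fun _ => (pow_pos hσ 2).ne') hD.hasLaw_noise hD.iIndepFun_noise
    (hFWE.symm.comp measurable_swap measurable_id) (hD.observe_path hFf)

lemma lintegral_data_value [IsProbabilityMeasure P] (hD : IsAdaptiveDesign X f P σ W rule E Y)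
    (hf : IsCenteredGP X k f P) (hσ : 0 < σ) (hF : Measurable F)
    (hFf : ∀ᵐ ω ∂P, ∀ z : X, (F ω).1 z = f ω z) {ξ : (Fin n → ℝ) × 𝒲 → X} (hξ : Measurable ξ)
    {G : ((Fin n → ℝ) × 𝒲) × ℝ → ℝ≥0∞} (hG : Measurable G) :
    ∫⁻ ω, G (((Y · ω), W ω), (F ω).1 (ξ ((Y · ω), W ω))) ∂P =
      ∫⁻ w, (∫⁻ y, evidence f P σ (fun i => (queries rule (y, w) i : Pt d)) y *
        ∫⁻ u, G ((y, w), u) ∂gaussianReal (dataMean k σ rule ξ (y, w))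
          (dataVar k σ rule ξ (y, w))) ∂P.map W := by
  set m : (i : Fin n) → (Path X × 𝒲) × (Fin i → ℝ) → ℝ := fun i p => p.1.1.1 (rule i (p.2, p.1.2))
  have hW := hD.aemeasurable_randomness
  have hsf : SFinite (P.map W) := inferInstance
  have hFW : IndepFun F W P :=
    (indepFun_path hFf hD.indepFun_process).comp measurable_id measurable_fst
  have hvalue : Measurable fun p : (Path X × 𝒲) × (Fin n → ℝ) =>
      G ((p.2, p.1.2), p.1.1.1 (ξ (p.2, p.1.2))) :=
    hG.comp (Measurable.prodMk (by fun_prop) (measurable_path_eval.comp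
      ((measurable_fst.comp measurable_fst).prodMk (hξ.comp (by fun_prop)))))
  have hjoint := hvalue.mul (measurable_autoregressionDensity (v := fun _ => σ ^ 2)
    hD.measurable_query_value)
  have hinner := hjoint.lintegral_prod_right' (ν := volume)
  calc ∫⁻ ω, G (((Y · ω), W ω), (F ω).1 (ξ ((Y · ω), W ω))) ∂P
      = ∫⁻ ω, (∫⁻ y, G ((y, W ω), (F ω).1 (ξ (y, W ω))) *
          autoregressionDensity m (fun _ => σ ^ 2) ((F ω, W ω), y)) ∂P :=
        (hD.isGaussianAutoregression hσ hF hFf).lintegral_eq hvalue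
    _ = ∫⁻ w, ∫⁻ ω, (∫⁻ y, G ((y, w), (F ω).1 (ξ (y, w))) *
          autoregressionDensity m (fun _ => σ ^ 2) ((F ω, w), y)) ∂P ∂P.map W := by
        refine (lintegral_map' hinner.aemeasurable (hF.aemeasurable.prodMk hW)).symm.trans ?_
        rw [hFW.map_prod_eq_prod_map_map hF.aemeasurable hW, lintegral_prod_symm' _ hinner]
        exact lintegral_congr fun w => lintegral_map (hinner.comp measurable_prodMk_right) hF
    _ = ∫⁻ w, (∫⁻ y, ∫⁻ ω, G ((y, w), (F ω).1 (ξ (y, w))) *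
          autoregressionDensity m (fun _ => σ ^ 2) ((F ω, w), y) ∂P) ∂P.map W :=
        lintegral_congr fun w => lintegral_lintegral_swap (hjoint.comp (Measurable.prodMk
          ((hF.comp measurable_fst).prodMk measurable_const) measurable_snd)).aemeasurable
    _ = _ := lintegral_congr fun w => lintegral_congr fun y =>
        hf.lintegral_path_mul_density hσ hFf rule (hG.comp measurable_prodMk_left) _ y w

theorem hasCondDistrib_posterior [IsProbabilityMeasure P]
    (hD : IsAdaptiveDesign X f P σ W rule E Y) (hf : IsCenteredGP X k f P)
    (hcont : ∀ᵐ ω ∂P, ContinuousOn (f ω) X) (hσ : 0 < σ) {ξ : (Fin n → ℝ) × 𝒲 → X}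
    (hξ : Measurable ξ) :
    HasCondDistrib (fun ω => f ω (ξ ((Y · ω), W ω))) (fun ω => ((Y · ω), W ω))
      (gaussianKernel (hf.measurable_dataMean hcont hσ hD.measurable_rule hξ)
        (hf.measurable_dataVar hcont hσ hD.measurable_rule hξ)) P := by
  obtain ⟨F, hF, hFf⟩ := hf.exists_measurable_path hcont
  obtain ⟨Φ, hΦ, hYΦ⟩ := hD.exists_measurable_solution hFf
  have hW := hD.aemeasurable_randomness
  have hY : AEMeasurable (fun ω => (Y · ω)) P := (hΦ.comp_aemeasurable
    ((hF.aemeasurable.prodMk hW).prodMk hD.aemeasurable_noise)).congr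
      (hYΦ.mono fun ω h => h.symm)
  have hdata := hY.prodMk hW
  have hvalue : (fun ω => f ω (ξ ((Y · ω), W ω))) =ᵐ[P] fun ω => (F ω).1 (ξ ((Y · ω), W ω)) :=
    hFf.mono fun ω h => (h _).symm
  have hvalue_meas : AEMeasurable (fun ω => (F ω).1 (ξ ((Y · ω), W ω))) P :=
    measurable_path_eval.comp_aemeasurable
      (hF.aemeasurable.prodMk (hξ.comp_aemeasurable hdata))
  refine hasCondDistrib_gaussianKernel_of_lintegral hdata (hvalue_meas.congr hvalue.symm) _ _
    fun G hG => ?_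
  have hmean := hf.measurable_dataMean hcont hσ hD.measurable_rule hξ
  have hvar := hf.measurable_dataVar hcont hσ hD.measurable_rule hξ
  have hpost : Measurable fun D => ∫⁻ u, G (D, u) ∂gaussianReal (dataMean k σ rule ξ D)
      (dataVar k σ rule ξ D) :=
    hG.lintegral_kernel_prod_right' (κ := gaussianKernel hmean hvar)
  refine (lintegral_congr_ae (hvalue.mono fun ω h =>
    congrArg (fun u => G (((Y · ω), W ω), u)) h)).trans ?_
  refine ((hD.lintegral_data_value hf hσ hF hFf hξ hG).trans ?_).trans
    (hD.lintegral_data_value hf hσ hF hFf hξ (hpost.comp measurable_fst)).symm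
  simp only [Function.comp_apply, lintegral_const, measure_univ, mul_one]

lemma indepFun_data [IsProbabilityMeasure P] (hD : IsAdaptiveDesign X f P σ W rule E Y)
    (hf : IsCenteredGP X k f P) (hcont : ∀ᵐ ω ∂P, ContinuousOn (f ω) X) {Z : Ω → 𝒵}
    (hZ : AEMeasurable Z P) (hWEZ : IndepFun (fun ω => (W ω, (E · ω))) Z P)
    (hfWEZ : IndepFun (fun ω (z : X) => f ω z) (fun ω => ((W ω, (E · ω)), Z ω)) P) :
    IndepFun (fun ω => ((Y · ω), W ω)) Z P := by
  obtain ⟨F, hF, hFf⟩ := hf.exists_measurable_path hcont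
  obtain ⟨Φ, hΦ, hYΦ⟩ := hD.exists_measurable_solution hFf
  have hWE := hD.aemeasurable_randomness.prodMk hD.aemeasurable_noise
  have hind : IndepFun Z (fun ω => ((W ω, (E · ω)), F ω)) P :=
    indepFun_prodMk_of_indepFun_prodMk hZ hWE hF.aemeasurable hWEZ.symm
      ((indepFun_path hFf hfWEZ).symm.comp measurable_swap measurable_id)
  have hrepresent : Measurable fun q : (𝒲 × (Fin n → ℝ)) × Path X =>
      (Φ ((q.2, q.1.1), q.1.2), q.1.1) := (hΦ.comp (by fun_prop)).prodMk (by fun_prop)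
  exact (hind.symm.comp hrepresent measurable_id).congr
    (hYΦ.mono fun ω h => Prod.ext h.symm rfl) .rfl

end IsAdaptiveDesign

end Adaptive

/-! ### Discretisation of the domain -/

section Net

variable {d : ℕ} {X : Set (Pt d)} {r : ℝ}

lemma norm_le_sqrt_mul {z : Pt d} {L : ℝ} (hL : 0 ≤ L) (h : ∀ j, |z j| ≤ L) : ‖z‖ ≤ √d * L := by
  rw [EuclideanSpace.norm_eq]
  refine Real.sqrt_le_iff.2 ⟨by positivity, ?_⟩
  have hsum : ∑ j, ‖z j‖ ^ 2 ≤ ∑ _j : Fin d, L ^ 2 := by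
    gcongr with j
    exact h j
  simpa [mul_pow] using hsum

lemma norm_sub_le_of_mem_cube (hr : 0 ≤ r) (hcube : ∀ z ∈ X, ∀ j, z j ∈ Icc 0 r) {z w : Pt d}
    (hz : z ∈ X) (hw : w ∈ X) : ‖z - w‖ ≤ √d * r :=
  norm_le_sqrt_mul hr fun j => by
    simpa using abs_sub_le_of_le_of_le (hcube z hz j).1 (hcube z hz j).2 (hcube w hw j).1
      (hcube w hw j).2

lemma exists_forall_norm_sub_le_norm_sub {V : Type*} [NormedAddCommGroup V]
    [InnerProductSpace ℝ V] {K : Set V} (hK : IsComplete K) (hconv : Convex ℝ K) (hne : K.Nonempty)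
    (u : V) : ∃ v ∈ K, ∀ w ∈ K, ‖w - v‖ ≤ ‖w - u‖ := by
  obtain ⟨v, hv, hmin⟩ := exists_norm_eq_iInf_of_complete_convex hne hK hconv u
  refine ⟨v, hv, fun w hw => le_of_sq_le_sq ?_ (norm_nonneg _)⟩
  have hobtuse := (norm_eq_iInf_iff_real_inner_le_zero hconv hv).1 hmin w hw
  have hexpand := norm_sub_sq_real (w - v) (u - v)
  rw [sub_sub_sub_cancel_right, real_inner_comm] at hexpand
  linarith [sq_nonneg ‖u - v‖]

lemma exists_abs_sub_midpoint_le (hr : 0 < r) {n : ℕ} (hn : 0 < n) {x : ℝ} (hx : x ∈ Icc 0 r) :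
    ∃ i : Fin n, |x - ((i : ℝ) + 1 / 2) * (r / n)| ≤ r / (2 * n) := by
  have hn' : (0 : ℝ) < n := by exact_mod_cast hn
  have hrn : 0 < r / n := by positivity
  obtain ⟨u, rfl⟩ : ∃ u, u * (r / n) = x := ⟨x / (r / n), div_mul_cancel₀ _ hrn.ne'⟩
  have hu0 : 0 ≤ u := nonneg_of_mul_nonneg_left hx.1 hrn
  have hun : u ≤ n := le_of_mul_le_mul_right (hx.2.trans_eq (mul_div_cancel₀ r hn'.ne').symm) hrn
  suffices ∃ i : Fin n, |u - ((i : ℝ) + 1 / 2)| ≤ 1 / 2 by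
    obtain ⟨i, hi⟩ := this
    refine ⟨i, ?_⟩
    rw [← sub_mul, abs_mul, abs_of_pos hrn]
    calc _ ≤ 1 / 2 * (r / n) := by gcongr
      _ = _ := by field_simp
  rcases hun.lt_or_eq with hlt | rfl
  · refine ⟨⟨⌊u⌋₊, (Nat.floor_lt hu0).2 hlt⟩, abs_le.2 ?_⟩
    constructor <;> linarith [Nat.floor_le hu0, Nat.lt_floor_add_one u]
  · refine ⟨⟨n - 1, by lia⟩, abs_le.2 ?_⟩
    rw [Nat.cast_pred hn]
    constructor <;> linarith

lemma exists_net (hX : IsCompact X) (hconv : Convex ℝ X) (hne : X.Nonempty) (hr : 0 < r)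
    (hcube : ∀ z ∈ X, ∀ j, z j ∈ Icc 0 r) {n : ℕ} (hn : 0 < n) :
    ∃ S : Finset X, S.Nonempty ∧ S.card ≤ n ^ d ∧
      ∀ z ∈ X, ∃ w ∈ S, ‖z - w‖ ≤ √d * (r / (2 * n)) := by
  classical
  have : Nonempty (Fin n) := ⟨⟨0, hn⟩⟩
  let midpoint (m : Fin d → Fin n) : Pt d := WithLp.toLp 2 fun j => ((m j : ℝ) + 1 / 2) * (r / n)
  choose p hpX hp using fun m =>
    exists_forall_norm_sub_le_norm_sub hX.isComplete hconv hne (midpoint m)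
  refine ⟨Finset.univ.image fun m => ⟨p m, hpX m⟩, Finset.univ_nonempty.image _,
    Finset.card_image_le.trans_eq (by simp), fun z hz => ?_⟩
  choose m hm using fun j => exists_abs_sub_midpoint_le hr hn (hcube z hz j)
  exact ⟨_, Finset.mem_image_of_mem _ (Finset.mem_univ m), (hp m z hz).trans
    (norm_le_sqrt_mul (by positivity) hm)⟩

end Net

/-! ### The Lipschitz constant of the sample paths -/

section Lipschitz

variable {d : ℕ} {X : Set (Pt d)}

lemma abs_sub_le_of_gradient (hconv : Convex ℝ X) {φ : Pt d → ℝ} {g : Pt d → Pt d}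
    (hg : ∀ z ∈ X, HasGradientWithinAt φ (g z) X z) {L : ℝ} (hL : 0 ≤ L)
    (h : ∀ z ∈ X, ∀ j, |g z j| ≤ L) {z w : Pt d} (hz : z ∈ X) (hw : w ∈ X) :
    |φ z - φ w| ≤ √d * L * ‖z - w‖ := by
  refine hconv.norm_image_sub_le_of_norm_hasFDerivWithin_le (𝕜 := ℝ)
    (fun x hx => (hg x hx).hasFDerivWithinAt) (fun x hx => ?_) hw hz
  rw [LinearIsometryEquiv.norm_map]
  exact norm_le_sqrt_mul hL (h x hx)

/-- The Lipschitz constant of `φ` on `X`, computed along a dense sequence, which makes it a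
measurable function of the path. It is `0` if the slopes are unbounded. -/
noncomputable def lipschitzConst (X : Set (Pt d)) [Nonempty X] (φ : Pt d → ℝ) : ℝ :=
  ⨆ p : ℕ × ℕ, |φ (TopologicalSpace.denseSeq X p.1) - φ (TopologicalSpace.denseSeq X p.2)| /
    ‖(TopologicalSpace.denseSeq X p.1 : Pt d) - TopologicalSpace.denseSeq X p.2‖

variable [Nonempty X] {φ : Pt d → ℝ} {L : ℝ}

lemma lipschitzConst_nonneg (φ : Pt d → ℝ) : 0 ≤ lipschitzConst X φ :=
  Real.iSup_nonneg fun _ => by positivity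

lemma lipschitzConst_le (hL : 0 ≤ L) (h : ∀ z ∈ X, ∀ w ∈ X, |φ z - φ w| ≤ L * ‖z - w‖) :
    lipschitzConst X φ ≤ L :=
  ciSup_le fun _ => div_le_of_le_mul₀ (norm_nonneg _) hL (h _ (Subtype.coe_prop _) _
    (Subtype.coe_prop _))

lemma abs_sub_le_lipschitzConst_mul (hφ : ContinuousOn φ X) (hL : 0 ≤ L)
    (h : ∀ z ∈ X, ∀ w ∈ X, |φ z - φ w| ≤ L * ‖z - w‖) {z w : Pt d} (hz : z ∈ X) (hw : w ∈ X) :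
    |φ z - φ w| ≤ lipschitzConst X φ * ‖z - w‖ := by
  have hφ' : Continuous fun z : X => φ z := continuousOn_iff_continuous_domRestrict.1 hφ
  have hclosed : IsClosed {q : X × X | |φ q.1 - φ q.2| ≤
      lipschitzConst X φ * ‖(q.1 : Pt d) - q.2‖} :=
    isClosed_le ((hφ'.comp continuous_fst).sub (hφ'.comp continuous_snd)).abs (by fun_prop)
  have hdense := (TopologicalSpace.denseRange_denseSeq X).prodMap
    (TopologicalSpace.denseRange_denseSeq X)
  refine hclosed.closure_subset_iff.2 ?_ (hdense (⟨z, hz⟩, ⟨w, hw⟩))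
  rintro _ ⟨p, rfl⟩
  have hbdd : BddAbove (range fun p : ℕ × ℕ => |φ (TopologicalSpace.denseSeq X p.1) -
      φ (TopologicalSpace.denseSeq X p.2)| /
        ‖(TopologicalSpace.denseSeq X p.1 : Pt d) - TopologicalSpace.denseSeq X p.2‖) :=
    ⟨L, forall_mem_range.2 fun p => div_le_of_le_mul₀ (norm_nonneg _) hL
      (h _ (Subtype.coe_prop _) _ (Subtype.coe_prop _))⟩
  rcases eq_or_ne (TopologicalSpace.denseSeq X p.1) (TopologicalSpace.denseSeq X p.2) with heq | hne
  · simp only [mem_ofPred_eq, Prod.map, heq, sub_self, abs_zero, norm_zero, mul_zero, le_refl]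
  · exact (div_le_iff₀ (norm_pos_iff.2 (sub_ne_zero.2 (Subtype.coe_injective.ne hne)))).1
      (le_ciSup hbdd p)

end Lipschitz

lemma ae_exists_abs_le_of_subgaussian_tail {Ω α : Type*} [MeasurableSpace Ω] {P : Measure Ω}
    {S : Set α} {g : Ω → α → ℝ} {a b : ℝ} (hb : 0 < b)
    (h : ∀ L, 0 < L → P {ω | ∃ z ∈ S, L < |g ω z|} ≤
      ENNReal.ofReal (a * Real.exp (-(L / b) ^ 2))) :
    ∀ᵐ ω ∂P, ∃ L, 0 < L ∧ ∀ z ∈ S, |g ω z| ≤ L := by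
  have htail : Filter.Tendsto (fun L : ℝ => ENNReal.ofReal (a * Real.exp (-(L / b) ^ 2)))
      Filter.atTop (nhds 0) := by
    have hexp := Real.tendsto_exp_neg_atTop_nhds_zero.comp
      ((Filter.tendsto_pow_atTop two_ne_zero).comp (Filter.tendsto_id.atTop_div_const hb))
    simpa using ENNReal.tendsto_ofReal (hexp.const_mul a)
  refine ae_iff.2 (le_antisymm (ge_of_tendsto htail ?_) zero_le)
  filter_upwards [Filter.eventually_gt_atTop 0] with L hL
  refine (measure_mono fun ω hω => ?_).trans (h L hL)
  by_contra! hle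
  exact hω ⟨L, hL, by simpa using hle⟩

namespace RegularDomain

variable {Ω : Type*} [MeasurableSpace Ω] {P : Measure Ω} {d : ℕ} {X : Set (Pt d)}
  {k : Pt d → Pt d → ℝ} {f : Ω → Pt d → ℝ} {r a b : ℝ}

lemma ae_continuousOn (hX : RegularDomain X f P r a b) : ∀ᵐ ω ∂P, ContinuousOn (f ω) X := by
  obtain ⟨g, hg, -⟩ := hX.gradient_tail
  exact hg.mono fun ω h z hz => (h z hz).hasFDerivWithinAt.continuousWithinAt

lemma dist_le (hX : RegularDomain X f P r a b) {z w : Pt d} (hz : z ∈ X) (hw : w ∈ X) :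
    ‖z - w‖ ≤ √d * r :=
  norm_sub_le_of_mem_cube hX.r_pos.le hX.subset_cube hz hw

lemma exists_ae_bounded_gradient (hX : RegularDomain X f P r a b) :
    ∃ g : Ω → Pt d → Pt d, (∀ᵐ ω ∂P, ∀ z ∈ X, HasGradientWithinAt (f ω) (g ω z) X z) ∧
      (∀ᵐ ω ∂P, ∃ L, 0 ≤ L ∧ ∀ z ∈ X, ∀ j, |g ω z j| ≤ L) ∧
      ∀ L, 0 < L → P {ω | ∃ j, ∃ z ∈ X, L < |g ω z j|} ≤
        ENNReal.ofReal (a * d * Real.exp (-(L / b) ^ 2)) := by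
  obtain ⟨g, hg, htail⟩ := hX.gradient_tail
  refine ⟨g, hg, ?_, fun L hL => ?_⟩
  · have hcoord : ∀ᵐ ω ∂P, ∀ j, ∃ L, 0 < L ∧ ∀ z ∈ X, |g ω z j| ≤ L :=
      ae_all_iff.2 fun j => ae_exists_abs_le_of_subgaussian_tail hX.b_pos (htail j)
    filter_upwards [hcoord] with ω hω
    choose L hL0 hL using hω
    exact ⟨∑ j, L j, Finset.sum_nonneg fun j _ => (hL0 j).le, fun z hz j => (hL j z hz).trans
      (Finset.single_le_sum (fun i _ => (hL0 i).le) (Finset.mem_univ j))⟩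
  · have hunion : {ω | ∃ j, ∃ z ∈ X, L < |g ω z j|} = ⋃ j, {ω | ∃ z ∈ X, L < |g ω z j|} := by
      ext ω
      simp only [mem_iUnion, mem_ofPred_eq]
    calc P {ω | ∃ j, ∃ z ∈ X, L < |g ω z j|}
        ≤ ∑ _j : Fin d, ENNReal.ofReal (a * Real.exp (-(L / b) ^ 2)) := by
          rw [hunion]
          exact (measure_iUnion_fintype_le P _).trans (Finset.sum_le_sum fun j _ => htail j L hL)
      _ = ENNReal.ofReal (a * d * Real.exp (-(L / b) ^ 2)) := by
          rw [← ENNReal.ofReal_sum_of_nonneg fun _ _ => mul_nonneg hX.a_pos.le (Real.exp_nonneg _)]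
          simp only [Finset.sum_const, Finset.card_univ, Fintype.card_fin, nsmul_eq_mul]
          ring_nf

variable [Nonempty X]

lemma ae_abs_sub_le (hX : RegularDomain X f P r a b) :
    ∀ᵐ ω ∂P, ∀ z ∈ X, ∀ w ∈ X, |f ω z - f ω w| ≤ lipschitzConst X (f ω) * ‖z - w‖ := by
  obtain ⟨g, hg, hbdd, -⟩ := hX.exists_ae_bounded_gradient
  filter_upwards [hg, hbdd, hX.ae_continuousOn] with ω hω ⟨L, hL0, hL⟩ hcont z hz w hw
  exact abs_sub_le_lipschitzConst_mul hcont (by positivity)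
    (fun z hz w hw => abs_sub_le_of_gradient hX.convex hω hL0 hL hz hw) hz hw

lemma meas_lt_lipschitzConst_le (hX : RegularDomain X f P r a b) (hd : 0 < d) {L : ℝ}
    (hL : 0 < L) : P {ω | L < lipschitzConst X (f ω)} ≤
      ENNReal.ofReal (a * d * Real.exp (-(L / (√d * b)) ^ 2)) := by
  obtain ⟨g, hg, -, htail⟩ := hX.exists_ae_bounded_gradient
  have hd' : 0 < √(d : ℝ) := Real.sqrt_pos.2 (by exact_mod_cast hd)
  refine (measure_mono_ae ?_).trans ((htail (L / √d) (by positivity)).trans_eq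
    (by rw [div_div]))
  filter_upwards [hg] with ω hω
  change L < lipschitzConst X (f ω) → ∃ j, ∃ z ∈ X, L / √d < |g ω z j|
  intro hlt
  by_contra! hle
  refine hlt.not_ge (lipschitzConst_le hL.le fun z hz w hw => ?_)
  refine (abs_sub_le_of_gradient hX.convex hω (by positivity) (fun z hz j => hle j z hz)
    hz hw).trans_eq ?_
  rw [mul_div_cancel₀ L hd'.ne']

end RegularDomain

section

variable {Ω : Type*} [MeasurableSpace Ω] {P : Measure Ω} {d : ℕ} {X : Set (Pt d)} [Nonempty X]
  {k : Pt d → Pt d → ℝ} {f : Ω → Pt d → ℝ} {r a b : ℝ}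

lemma measurable_lipschitzConst (hf : ∀ z ∈ X, Measurable fun ω => f ω z) :
    Measurable fun ω => lipschitzConst X (f ω) :=
  Measurable.iSup fun _ => ((hf _ (Subtype.coe_prop _)).sub
    (hf _ (Subtype.coe_prop _))).abs.div_const _

theorem RegularDomain.integral_lipschitzConst_le [IsProbabilityMeasure P]
    (hX : RegularDomain X f P r a b) (hf : ∀ z ∈ X, Measurable fun ω => f ω z) (hd : 0 < d) :
    Integrable (fun ω => lipschitzConst X (f ω)) P ∧
      ∫ ω, lipschitzConst X (f ω) ∂P ≤ √d * b * (√(Real.log (a * d)) + √Real.pi / 2) := by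
  have hb := hX.b_pos
  have hbound : ∫⁻ ω, ENNReal.ofReal (lipschitzConst X (f ω)) ∂P ≤
      ENNReal.ofReal (√d * b * (√(Real.log (a * d)) + √Real.pi / 2)) :=
    lintegral_le_of_subgaussian_tail (measurable_lipschitzConst hf).aemeasurable (by positivity)
      fun L hL => hX.meas_lt_lipschitzConst_le hd hL
  have hnonneg : 0 ≤ᵐ[P] fun ω => lipschitzConst X (f ω) :=
    .of_forall fun ω => lipschitzConst_nonneg _
  have hmeas := (measurable_lipschitzConst hf).aestronglyMeasurable (μ := P)
  refine ⟨⟨hmeas, (hasFiniteIntegral_iff_ofReal hnonneg).2 (hbound.trans_lt ENNReal.ofReal_lt_top)⟩,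
    ?_⟩
  rw [integral_eq_lintegral_of_nonneg_ae hnonneg hmeas]
  exact ENNReal.toReal_le_of_le_ofReal (by positivity) hbound

end

/-! ### Dominance of the maximum by the acquisition function -/

section Dominance

variable {Ω 𝓓 α : Type*} [MeasurableSpace Ω] [MeasurableSpace 𝓓] {P : Measure Ω}
  [IsProbabilityMeasure P] {S : Finset α} {D : Ω → 𝓓}

lemma meas_exists_lt_le_lintegral_min {V : α → Ω → ℝ} {κ : α → Kernel 𝓓 ℝ}
    [∀ z, IsMarkovKernel (κ z)] (hD : AEMeasurable D P)
    (h : ∀ z ∈ S, HasCondDistrib (V z) D (κ z) P) (c : ℝ) :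
    P {ω | ∃ z ∈ S, c < V z ω} ≤ ∫⁻ ω, min 1 (∑ z ∈ S, κ z (D ω) (Ioi c)) ∂P := by
  have hκ : ∀ z, Measurable fun d => κ z d (Ioi c) :=
    fun z => (κ z).measurable_coe measurableSet_Ioi
  set B : Set 𝓓 := {d | 1 ≤ ∑ z ∈ S, κ z d (Ioi c)}
  have hBm : MeasurableSet B :=
    measurableSet_le measurable_const (Finset.measurable_sum _ fun z _ => hκ z)
  have hBD : AEMeasurable (fun ω => B.indicator (1 : 𝓓 → ℝ≥0∞) (D ω)) P :=
    (measurable_one.indicator hBm).comp_aemeasurable hD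
  have hBV : Measurable ((Bᶜ ×ˢ Ioi c).indicator (1 : 𝓓 × ℝ → ℝ≥0∞)) :=
    measurable_one.indicator (hBm.compl.prod measurableSet_Ioi)
  have hBVω : ∀ z ∈ S, AEMeasurable
      (fun ω => (Bᶜ ×ˢ Ioi c).indicator (1 : 𝓓 × ℝ → ℝ≥0∞) (D ω, V z ω)) P :=
    fun z hz => hBV.comp_aemeasurable (hD.prodMk (h z hz).aemeasurable_snd)
  have hκD : ∀ z ∈ S, AEMeasurable (fun ω => Bᶜ.indicator (fun d => κ z d (Ioi c)) (D ω)) P :=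
    fun z _ => ((hκ z).indicator hBm.compl).comp_aemeasurable hD
  calc P {ω | ∃ z ∈ S, c < V z ω}
      ≤ ∫⁻ ω, B.indicator 1 (D ω) + ∑ z ∈ S, (Bᶜ ×ˢ Ioi c).indicator 1 (D ω, V z ω) ∂P := by
        refine meas_le_lintegral₀ (hBD.add (Finset.aemeasurable_fun_sum _ hBVω)) ?_
        rintro ω ⟨z, hz, hcz⟩
        by_cases hω : D ω ∈ B
        · exact le_add_right (indicator_of_mem hω 1).ge
        · have hmem : (D ω, V z ω) ∈ Bᶜ ×ˢ Ioi c := ⟨hω, hcz⟩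
          refine le_add_left ((indicator_of_mem hmem 1).ge.trans ?_)
          exact Finset.single_le_sum
            (f := fun z => (Bᶜ ×ˢ Ioi c).indicator (1 : 𝓓 × ℝ → ℝ≥0∞) (D ω, V z ω))
            (fun _ _ => zero_le) hz
    _ = ∫⁻ ω, B.indicator 1 (D ω) + ∑ z ∈ S, Bᶜ.indicator (fun d => κ z d (Ioi c)) (D ω) ∂P := by
        rw [lintegral_add_left' hBD, lintegral_finsetSum' _ hBVω, lintegral_add_left' hBD,
          lintegral_finsetSum' _ hκD]
        refine congrArg₂ _ rfl (Finset.sum_congr rfl fun z hz => ?_)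
        rw [lintegral_of_hasCondDistrib (h z hz) hBV]
        refine lintegral_congr fun ω => ?_
        by_cases hω : D ω ∈ B <;>
          simp [indicator, hω, ← lintegral_indicator_one measurableSet_Ioi]
    _ ≤ ∫⁻ ω, min 1 (∑ z ∈ S, κ z (D ω) (Ioi c)) ∂P := by
        refine lintegral_mono fun ω => ?_
        by_cases hω : D ω ∈ B
        · have hle : 1 ≤ ∑ z ∈ S, κ z (D ω) (Ioi c) := hω
          simp [hω, hle]
        · have hle : ∑ z ∈ S, κ z (D ω) (Ioi c) ≤ 1 := (not_le.1 hω).le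
          simp [hω, hle]

variable {m : α → 𝓓 → ℝ} {v : α → 𝓓 → ℝ≥0}

theorem meas_exists_lt_le_of_gaussianKernel {V : α → Ω → ℝ} {ζ : Ω → ℝ} {s : ℝ}
    {hm : ∀ z, Measurable (m z)} {hv : ∀ z, Measurable (v z)} (hD : AEMeasurable D P)
    (h : ∀ z ∈ S, HasCondDistrib (V z) D (gaussianKernel (hm z) (hv z)) P)
    (hζ : HasLaw ζ (twoParamExp s (1 / 2)) P) (hind : IndepFun D ζ P)
    (hS : (S.card : ℝ) / 2 ≤ Real.exp (s / 2)) (c : ℝ) :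
    P {ω | ∃ z ∈ S, c < V z ω} ≤
      P {ω | ∃ z ∈ S, c < m z (D ω) + √(ζ ω) * √(v z (D ω))} := by
  have := isProbabilityMeasure_twoParamExp s one_half_pos
  set A : Set (𝓓 × ℝ) := {p | ∃ z ∈ S, c < m z p.1 + √p.2 * √(v z p.1)} with hA
  have hAm : MeasurableSet A := by
    have hunion : A = ⋃ z ∈ S, {p : 𝓓 × ℝ | c < m z p.1 + √p.2 * √(v z p.1)} := by
      ext p
      simp only [hA, mem_ofPred_eq, mem_iUnion, exists_prop]
    rw [hunion]
    exact S.measurableSet_biUnion fun z _ => measurableSet_lt measurable_const (by fun_prop)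
  calc P {ω | ∃ z ∈ S, c < V z ω}
      ≤ ∫⁻ ω, min 1 (∑ z ∈ S, gaussianReal (m z (D ω)) (v z (D ω)) (Ioi c)) ∂P :=
        meas_exists_lt_le_lintegral_min hD h c
    _ ≤ ∫⁻ ω, twoParamExp s (1 / 2) (Prod.mk (D ω) ⁻¹' A) ∂P :=
        lintegral_mono fun ω => min_sum_gaussianReal_le_twoParamExp s hS
    _ = ((P.map D).prod (twoParamExp s (1 / 2))) A := by
        rw [Measure.prod_apply hAm,
          lintegral_map' (measurable_measure_prodMk_left hAm).aemeasurable hD]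
    _ = P {ω | ∃ z ∈ S, c < m z (D ω) + √(ζ ω) * √(v z (D ω))} := by
        rw [← hζ.map_eq, ← hind.map_prod_eq_prod_map_map hD hζ.aemeasurable,
          Measure.map_apply_of_aemeasurable (hD.prodMk hζ.aemeasurable) hAm]
        rfl

lemma integral_eq_integral_mean_of_gaussianKernel {V : Ω → ℝ} {m : 𝓓 → ℝ} {v : 𝓓 → ℝ≥0}
    {hm : Measurable m} {hv : Measurable v} (h : HasCondDistrib V D (gaussianKernel hm hv) P)
    (hV : Integrable V P) :
    Integrable (fun ω => m (D ω)) P ∧ ∫ ω, V ω ∂P = ∫ ω, m (D ω) ∂P := by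
  have hsnd : Integrable Prod.snd (P.map D ⊗ₘ gaussianKernel hm hv) := by
    rw [← HasLaw.map_eq h, integrable_map_measure measurable_snd.aestronglyMeasurable
      h.aemeasurable]
    exact hV
  have hmean : ∀ d, ∫ y, y ∂gaussianKernel hm hv d = m d := fun d => integral_id_gaussianReal
  have hint : Integrable m (P.map D) := by
    simpa only [Kernel.const_apply, Kernel.prodMkLeft_apply, hmean] using
      Integrable.integral_compProd (a := ()) hsnd
  refine ⟨(integrable_map_measure hm.aestronglyMeasurable h.aemeasurable_fst).1 hint, ?_⟩
  calc ∫ ω, V ω ∂P = ∫ p, p.2 ∂(P.map D ⊗ₘ gaussianKernel hm hv) := by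
        rw [← HasLaw.map_eq h, integral_map h.aemeasurable measurable_snd.aestronglyMeasurable]
    _ = ∫ d, m d ∂P.map D := by simp only [Measure.integral_compProd hsnd, hmean]
    _ = ∫ ω, m (D ω) ∂P := integral_map h.aemeasurable_fst hm.aestronglyMeasurable

end Dominance

/-! ### Runs of the algorithm -/

section Run

variable {Ω : Type*} {d : ℕ} {X : Set (Pt d)} {k : Pt d → Pt d → ℝ} {f : Ω → Pt d → ℝ} {σ : ℝ≥0}
  {ε ζ y : ℕ → Ω → ℝ} {x : ℕ → Ω → Pt d} {q : (t : ℕ) → (Fin t → ℝ) × (Fin (t + 1) → ℝ) → X}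
  {s : ℝ} {t m : ℕ}

/-- The first `t` steps of the query rule `q` of a run, with all of `ζ₀, …, ζₘ₋₁` drawn in advance
as internal randomness. Taking `m = t` leaves out the `ζ` of the next query, `m = t + 1` has it. -/
def runRule (q : (t : ℕ) → (Fin t → ℝ) × (Fin (t + 1) → ℝ) → X) (h : t ≤ m) (i : Fin t)
    (p : (Fin i → ℝ) × (Fin m → ℝ)) : X :=
  q i (p.1, fun j => p.2 (Fin.castLE (i.2.trans_le h) j))

/-- The confidence width `ζ^{1/2} σ(x)` of the query `x t`. -/
noncomputable def width (k : Pt d → Pt d → ℝ) (σ : ℝ≥0) (ζ : ℕ → Ω → ℝ) (x : ℕ → Ω → Pt d) (t : ℕ)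
    (ω : Ω) : ℝ :=
  √(ζ t ω) * √(postVar k σ (fun i : Fin t => x i ω) (x t ω))

lemma IsIRGPUCBRun.exists_rule [Nonempty Ω] (hrun : IsIRGPUCBRun X k f σ ε ζ x y)
    (hX : MeasurableSet X) :
    ∃ q : (t : ℕ) → (Fin t → ℝ) × (Fin (t + 1) → ℝ) → X, (∀ t, Measurable (q t)) ∧
      ∀ t ω, (q t (fun i : Fin t => y i ω, fun i : Fin (t + 1) => ζ i ω) : Pt d) = x t ω := by
  obtain ⟨select, hselect, hx⟩ := hrun.nonanticipating
  obtain ⟨π, hπ, hπX⟩ := hX.exists_measurable_proj ⟨_, hrun.mem 0 (Classical.arbitrary Ω)⟩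
  exact ⟨fun t p => π (select t p), fun t => hπ.comp (hselect t), fun t ω => by
    simp only [← hx, hπX ⟨x t ω, hrun.mem t ω⟩]⟩

variable [MeasurableSpace Ω] {P : Measure Ω}

lemma IsIRGPUCBRun.isAdaptiveDesign {lam : ℝ} (hrun : IsIRGPUCBRun X k f σ ε ζ x y)
    (hnoise : IsNoiseModel X f P σ s lam ε ζ) (hq : ∀ t, Measurable (q t))
    (hqx : ∀ t ω, (q t (fun i : Fin t => y i ω, fun i : Fin (t + 1) => ζ i ω) : Pt d) = x t ω)
    (h : t ≤ m) :
    IsAdaptiveDesign X f P σ (fun ω (i : Fin m) => ζ i ω) (runRule q h) (fun i : Fin t => ε i)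
      (fun i : Fin t => y i) where
  measurable_rule i := (hq i).comp (by fun_prop)
  aemeasurable_randomness :=
    (measurable_pi_lambda _ fun i : Fin m => hnoise.measurable_ζ i).aemeasurable
  hasLaw_noise i := hnoise.law_ε i
  iIndepFun_noise := hnoise.indep_ε.precomp Fin.val_injective
  indepFun_randomness :=
    hnoise.indep_noise.symm.comp (φ := fun (z : ℕ → ℝ) (i : Fin m) => z i)
      (ψ := fun (e : ℕ → ℝ) (i : Fin t) => e i) (by fun_prop) (by fun_prop)
  indepFun_process :=
    hnoise.indep_prior.comp (φ := id) (ψ := fun p : (ℕ → ℝ) × (ℕ → ℝ) =>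
      ((fun i : Fin m => p.2 i), fun i : Fin t => p.1 i)) measurable_id (by fun_prop)
  observe i ω := by
    change y i ω = f ω (q i (fun j : Fin i => y j ω, fun j : Fin (i + 1) => ζ j ω)) + ε i ω
    rw [hqx, hrun.observe]

lemma IsNoiseModel.indepFun_past {lam : ℝ} [IsProbabilityMeasure P]
    (hnoise : IsNoiseModel X f P σ s lam ε ζ) (t : ℕ) :
    IndepFun (fun ω => ((fun i : Fin t => ζ i ω), fun i : Fin t => ε i ω)) (ζ t) P := by
  have hζ : IndepFun (ζ t) (fun ω (i : Fin t) => ζ i ω) P :=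
    GPBandit.indepFun_past (E := fun i : Fin (t + 1) => ζ i)
      (hnoise.indep_ζ.precomp Fin.val_injective) (fun i => (hnoise.measurable_ζ i).aemeasurable)
      (Fin.last t)
  have hζε : IndepFun (fun ω => (ζ t ω, fun i : Fin t => ζ i ω)) (fun ω (i : Fin t) => ε i ω) P :=
    hnoise.indep_noise.symm.comp (φ := fun z : ℕ → ℝ => (z t, fun i : Fin t => z i))
      (ψ := fun (e : ℕ → ℝ) (i : Fin t) => e i) (by fun_prop) (by fun_prop)
  exact (indepFun_prodMk_of_indepFun_prodMk (hnoise.measurable_ζ t).aemeasurable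
    (measurable_pi_lambda _ fun i : Fin t => hnoise.measurable_ζ i).aemeasurable
    (measurable_pi_lambda _ fun i : Fin t => hnoise.measurable_ε i).aemeasurable hζ hζε).symm

lemma IsNoiseModel.integral_max_zero {lam : ℝ} (hnoise : IsNoiseModel X f P σ s lam ε ζ)
    (hlam : 0 < lam) (t : ℕ) :
    Integrable (fun ω => max (ζ t ω) 0) P ∧ ∫ ω, max (ζ t ω) 0 ∂P = posPartMean s lam := by
  have hlint : ∫⁻ ω, ENNReal.ofReal (max (ζ t ω) 0) ∂P = ENNReal.ofReal (posPartMean s lam) := by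
    simp only [ENNReal.ofReal_max, ENNReal.ofReal_zero, zero_le, max_eq_left]
    rw [← lintegral_twoParamExp s hlam, ← (hnoise.law_ζ t).map_eq,
      lintegral_map ENNReal.measurable_ofReal (hnoise.measurable_ζ t)]
  have hmeas : AEStronglyMeasurable (fun ω => max (ζ t ω) 0) P :=
    ((hnoise.measurable_ζ t).max measurable_const).aestronglyMeasurable
  have hnonneg : 0 ≤ᵐ[P] fun ω => max (ζ t ω) 0 := .of_forall fun ω => le_max_right _ _
  refine ⟨(lintegral_ofReal_ne_top_iff_integrable hmeas hnonneg).1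
    (hlint.trans_ne ENNReal.ofReal_ne_top), ?_⟩
  rw [integral_eq_lintegral_of_nonneg_ae hnonneg hmeas, hlint,
    ENNReal.toReal_ofReal (posPartMean_pos s hlam).le]

lemma sqrt_max_zero (z : ℝ) : √(max z 0) = √z := by
  simp only [← Real.coe_toNNReal', Real.sqrt, Real.toNNReal_coe]

variable [IsProbabilityMeasure P]

theorem IsIRGPUCBRun.meas_exists_lt_le_ucb (hrun : IsIRGPUCBRun X k f σ ε ζ x y)
    (hnoise : IsNoiseModel X f P σ s (1 / 2) ε ζ) (hf : IsCenteredGP X k f P)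
    (hcont : ∀ᵐ ω ∂P, ContinuousOn (f ω) X) (hX : MeasurableSet X) (hσ : 0 < σ) {S : Finset X}
    (hS : (S.card : ℝ) / 2 ≤ Real.exp (s / 2)) (c : ℝ) :
    P {ω | ∃ z ∈ S, c < f ω z} ≤
      P {ω | c < ucb k σ (fun i : Fin t => x i ω) (fun i : Fin t => y i ω) (ζ t ω) (x t ω)} := by
  have := nonempty_of_isProbabilityMeasure P
  obtain ⟨q, hq, hqx⟩ := hrun.exists_rule hX
  have hD := hrun.isAdaptiveDesign hnoise hq hqx (le_refl t)
  have hpost := fun z : X => hD.hasCondDistrib_posterior hf hcont hσ (measurable_const (a := z))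
  have hind := hD.indepFun_data hf hcont (hnoise.measurable_ζ t).aemeasurable
    (hnoise.indepFun_past t) (hnoise.indep_prior.comp (φ := id)
      (ψ := fun p : (ℕ → ℝ) × (ℕ → ℝ) =>
        (((fun i : Fin t => p.2 i), fun i : Fin t => p.1 i), p.2 t)) measurable_id (by fun_prop))
  refine (meas_exists_lt_le_of_gaussianKernel (hpost (q t 0)).aemeasurable_fst
    (fun z _ => hpost z) (hnoise.law_ζ t) hind hS c).trans (measure_mono ?_)
  rintro ω ⟨z, -, hz⟩
  have hquery : (fun i => (queries (runRule q (le_refl t))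
      ((fun i : Fin t => y i ω), fun i : Fin t => ζ i ω) i : Pt d)) = fun i : Fin t => x i ω :=
    funext fun i => hqx i ω
  rw [dataMean, dataVar, hquery,
    Real.coe_toNNReal _ (hf.postVar_nonneg (fun i : Fin t => hrun.mem i ω) hσ z.2)] at hz
  exact hz.trans_le (hrun.argmax t ω z.2)

lemma IsIRGPUCBRun.exists_hasCondDistrib_query (hrun : IsIRGPUCBRun X k f σ ε ζ x y) {lam : ℝ}
    (hnoise : IsNoiseModel X f P σ s lam ε ζ) (hf : IsCenteredGP X k f P)
    (hcont : ∀ᵐ ω ∂P, ContinuousOn (f ω) X) (hX : MeasurableSet X) (hσ : 0 < σ) (t : ℕ) :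
    ∃ (M : (Fin t → ℝ) × (Fin (t + 1) → ℝ) → ℝ) (V : (Fin t → ℝ) × (Fin (t + 1) → ℝ) → ℝ≥0)
      (hM : Measurable M) (hV : Measurable V),
      HasCondDistrib (fun ω => f ω (x t ω))
        (fun ω => ((fun i : Fin t => y i ω), fun i : Fin (t + 1) => ζ i ω))
        (gaussianKernel hM hV) P ∧
      ∀ ω, M ((fun i : Fin t => y i ω), fun i : Fin (t + 1) => ζ i ω) =
          postMean k σ (fun i : Fin t => x i ω) (fun i : Fin t => y i ω) (x t ω) ∧
        V ((fun i : Fin t => y i ω), fun i : Fin (t + 1) => ζ i ω) =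
          postVar k σ (fun i : Fin t => x i ω) (x t ω) := by
  have := nonempty_of_isProbabilityMeasure P
  obtain ⟨q, hq, hqx⟩ := hrun.exists_rule hX
  have hD := hrun.isAdaptiveDesign hnoise hq hqx t.le_succ
  have hpost := hD.hasCondDistrib_posterior hf hcont hσ (hq t)
  have hquery : ∀ ω, (fun i => (queries (runRule q t.le_succ)
      ((fun i : Fin t => y i ω), fun i : Fin (t + 1) => ζ i ω) i : Pt d)) =
        fun i : Fin t => x i ω := fun ω => funext fun i => hqx i ω
  simp only [hqx] at hpost
  refine ⟨_, _, _, _, hpost, fun ω => ⟨?_, ?_⟩⟩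
  · rw [dataMean, hquery, hqx]
  · rw [dataVar, hquery, hqx, Real.coe_toNNReal _
      (hf.postVar_nonneg (fun i : Fin t => hrun.mem i ω) hσ (hrun.mem t ω))]

lemma IsIRGPUCBRun.integrable_width {lam : ℝ} (hrun : IsIRGPUCBRun X k f σ ε ζ x y)
    (hnoise : IsNoiseModel X f P σ s lam ε ζ) (hlam : 0 < lam) (hf : IsCenteredGP X k f P)
    (hcont : ∀ᵐ ω ∂P, ContinuousOn (f ω) X) (hX : MeasurableSet X) (hσ : 0 < σ)
    (hk : ∀ z ∈ X, k z z ≤ 1) (t : ℕ) : Integrable (width k σ ζ x t) P := by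
  obtain ⟨M, V, hM, hV, hdist, hMV⟩ :=
    hrun.exists_hasCondDistrib_query hnoise hf hcont hX hσ t
  have hmeas : AEMeasurable (width k σ ζ x t) P := by
    refine ((hnoise.measurable_ζ t).sqrt.aemeasurable.mul
      (hV.comp_aemeasurable hdist.aemeasurable_fst).coe_nnreal_real.sqrt).congr
        (.of_forall fun ω => ?_)
    simp only [width, Pi.mul_apply, Function.comp_apply, (hMV ω).2]
  refine (integral_sqrt_le_sqrt_integral (hnoise.integral_max_zero hlam t).1
    (.of_forall fun ω => le_max_right _ _)).1.mono' hmeas.aestronglyMeasurable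
      (.of_forall fun ω => ?_)
  rw [width, sqrt_max_zero, Real.norm_of_nonneg (by positivity)]
  refine mul_le_of_le_one_right (Real.sqrt_nonneg _) (Real.sqrt_le_one.2 ?_)
  exact (hf.postVar_le (fun i : Fin t => hrun.mem i ω) hσ _).trans (hk _ (hrun.mem t ω))

theorem IsIRGPUCBRun.integral_sup'_sub_integral_query_le (hrun : IsIRGPUCBRun X k f σ ε ζ x y)
    (hnoise : IsNoiseModel X f P σ s (1 / 2) ε ζ) (hf : IsCenteredGP X k f P)
    (hcont : ∀ᵐ ω ∂P, ContinuousOn (f ω) X) (hX : MeasurableSet X) (hσ : 0 < σ)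
    (hk : ∀ z ∈ X, k z z ≤ 1) {S : Finset X} (hS : S.Nonempty)
    (hcard : (S.card : ℝ) / 2 ≤ Real.exp (s / 2))
    (hsup : Integrable (fun ω => S.sup' hS fun z => f ω z) P)
    (hquery : Integrable (fun ω => f ω (x t ω)) P) :
    ∫ ω, S.sup' hS (fun z => f ω z) ∂P - ∫ ω, f ω (x t ω) ∂P ≤ ∫ ω, width k σ ζ x t ω ∂P := by
  have hwidth := hrun.integrable_width hnoise one_half_pos hf hcont hX hσ hk t
  obtain ⟨M, V, hM, hV, hdist, hMV⟩ :=
    hrun.exists_hasCondDistrib_query hnoise hf hcont hX hσ t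
  obtain ⟨hmean, hmean_eq⟩ := integral_eq_integral_mean_of_gaussianKernel hdist hquery
  rw [sub_le_iff_le_add', hmean_eq, ← integral_add hmean hwidth]
  refine integral_le_integral_of_meas_lt_le hsup (hmean.add hwidth) fun c => ?_
  simp only [Finset.lt_sup'_iff, (hMV _).1]
  exact hrun.meas_exists_lt_le_ucb hnoise hf hcont hX hσ hcard c

end Run

/-! ### The regret of a run -/

section RunRegret

variable {Ω : Type*} [MeasurableSpace Ω] {P : Measure Ω} {d : ℕ} {X : Set (Pt d)}
  {k : Pt d → Pt d → ℝ} {f : Ω → Pt d → ℝ} {σ : ℝ≥0} {ε ζ y : ℕ → Ω → ℝ} {x : ℕ → Ω → Pt d}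
  {r a b s : ℝ} {T : ℕ}

lemma le_ciSup_fin (φ : Fin T → ℝ) (t : Fin T) : φ t ≤ ⨆ t, φ t :=
  le_ciSup (finite_range φ).bddAbove t

lemma IsCenteredGP.aemeasurable_max (hf : IsCenteredGP X k f P)
    (hcont : ∀ᵐ ω ∂P, ContinuousOn (f ω) X) [Nonempty X] {xstar : Ω → Pt d}
    (hstar : ∀ᵐ ω ∂P, xstar ω ∈ X ∧ IsMaxOn (f ω) X (xstar ω)) :
    AEMeasurable (fun ω => f ω (xstar ω)) P := by
  refine ⟨fun ω => ⨆ n, f ω (TopologicalSpace.denseSeq X n),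
    Measurable.iSup fun n => hf.measurable _ (Subtype.coe_prop _), ?_⟩
  filter_upwards [hstar, hcont] with ω ⟨hmem, hmax⟩ hω
  have hle : ∀ n, f ω (TopologicalSpace.denseSeq X n) ≤ f ω (xstar ω) :=
    fun n => hmax (Subtype.coe_prop _)
  have hclosed : IsClosed {z : X | f ω z ≤ ⨆ n, f ω (TopologicalSpace.denseSeq X n)} :=
    isClosed_le (continuousOn_iff_continuous_domRestrict.1 hω) continuous_const
  refine le_antisymm ?_ (ciSup_le hle)
  exact (TopologicalSpace.denseRange_denseSeq X).induction_on
    (p := fun z : X => f ω z ≤ ⨆ n, f ω (TopologicalSpace.denseSeq X n)) ⟨_, hmem⟩ hclosed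
    fun n => le_ciSup (f := fun n => f ω (TopologicalSpace.denseSeq X n))
      ⟨_, forall_mem_range.2 hle⟩ n

variable [IsProbabilityMeasure P]

lemma RegularDomain.integrable_value (hX : RegularDomain X f P r a b)
    (hf : IsCenteredGP X k f P) (hd : 0 < d) {U : Ω → ℝ} (hU : AEMeasurable U P)
    (hUX : ∀ᵐ ω ∂P, ∃ z ∈ X, U ω = f ω z) : Integrable U P := by
  obtain ⟨_, w, hw, -⟩ := hUX.exists
  have : Nonempty X := ⟨⟨w, hw⟩⟩
  have hfw := (hf.memLp hw).integrable one_le_two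
  have hsub : Integrable (fun ω => U ω - f ω w) P := by
    refine ((hX.integral_lipschitzConst_le hf.measurable hd).1.mul_const (√d * r)).mono'
      (hU.sub hfw.aemeasurable).aestronglyMeasurable ?_
    filter_upwards [hUX, hX.ae_abs_sub_le] with ω ⟨z, hz, hUz⟩ hlip
    rw [hUz]
    exact (hlip z hz w hw).trans
      (mul_le_mul_of_nonneg_left (hX.dist_le hz hw) (lipschitzConst_nonneg _))
  exact (hsub.add hfw).congr (.of_forall fun ω => sub_add_cancel _ _)

namespace IsIRGPUCBRun

lemma sum_width_le (hrun : IsIRGPUCBRun X k f σ ε ζ x y) (hf : IsCenteredGP X k f P)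
    (hcont : ∀ᵐ ω ∂P, ContinuousOn (f ω) X) (hconn : IsPreconnected X) (hnt : X.Nontrivial)
    (hσ : 0 < σ) (hk : ∀ z ∈ X, k z z ≤ 1) (T : ℕ) (ω : Ω) :
    ∑ t : Fin T, width k σ ζ x t ω ≤
      √(∑ t : Fin T, max (ζ t ω) 0) * √(C₁ σ * (maxInfoGain X f P σ T).toReal) := by
  have hmem : ∀ i : Fin T, x i ω ∈ X := fun i => hrun.mem i ω
  calc ∑ t : Fin T, width k σ ζ x t ω
      = ∑ t : Fin T, √(max (ζ t ω) 0) * √(predVar k σ (fun i : Fin T => x i ω) t) := by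
        simp only [sqrt_max_zero]
        rfl
    _ ≤ √(∑ t : Fin T, max (ζ t ω) 0) * √(∑ t, predVar k σ (fun i : Fin T => x i ω) t) :=
        Real.sum_sqrt_mul_sqrt_le _ (fun _ => le_max_right _ _)
          fun t => hf.predVar_nonneg hmem hσ t
    _ ≤ _ := by
        gcongr
        refine (hf.sum_predVar_le hk hmem hσ).trans ?_
        exact mul_le_mul_of_nonneg_left (hf.designInfo_le_maxInfoGain hcont hk hconn hnt hσ
          fun i => ⟨x i ω, hmem i⟩) (C₁_pos hσ).le

lemma sum_integral_width_le (hrun : IsIRGPUCBRun X k f σ ε ζ x y) {lam : ℝ}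
    (hnoise : IsNoiseModel X f P σ s lam ε ζ) (hlam : 0 < lam) (hf : IsCenteredGP X k f P)
    (hcont : ∀ᵐ ω ∂P, ContinuousOn (f ω) X) (hX : MeasurableSet X) (hconn : IsPreconnected X)
    (hnt : X.Nontrivial) (hσ : 0 < σ) (hk : ∀ z ∈ X, k z z ≤ 1) (T : ℕ) :
    ∑ t : Fin T, ∫ ω, width k σ ζ x t ω ∂P ≤
      √(T * posPartMean s lam) * √(C₁ σ * (maxInfoGain X f P σ T).toReal) := by
  have hζ := hnoise.integral_max_zero hlam
  have hwidth := hrun.integrable_width hnoise hlam hf hcont hX hσ hk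
  obtain ⟨hsqrt, hsqrt_le⟩ := integral_sqrt_le_sqrt_integral (P := P)
    (integrable_finsetSum Finset.univ fun t : Fin T => fun _ => (hζ t).1)
    (.of_forall fun ω => Finset.sum_nonneg fun t _ => le_max_right _ _)
  calc ∑ t : Fin T, ∫ ω, width k σ ζ x t ω ∂P
      = ∫ ω, ∑ t : Fin T, width k σ ζ x t ω ∂P :=
        (integral_finsetSum Finset.univ fun (t : Fin T) _ => hwidth t).symm
    _ ≤ ∫ ω, √(∑ t : Fin T, max (ζ t ω) 0) * √(C₁ σ * (maxInfoGain X f P σ T).toReal) ∂P :=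
        integral_mono (integrable_finsetSum _ fun t _ => hwidth t) (hsqrt.mul_const _)
          (hrun.sum_width_le hf hcont hconn hnt hσ hk T)
    _ = (∫ ω, √(∑ t : Fin T, max (ζ t ω) 0) ∂P) * √(C₁ σ * (maxInfoGain X f P σ T).toReal) :=
        integral_mul_const _ _
    _ ≤ _ := by
        refine mul_le_mul_of_nonneg_right (hsqrt_le.trans_eq (congrArg _ ?_)) (Real.sqrt_nonneg _)
        rw [integral_finsetSum _ fun t _ => (hζ _).1]
        simp only [(hζ _).2, Finset.sum_const, Finset.card_univ, Fintype.card_fin, nsmul_eq_mul]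

theorem integral_sup'_sub_integral_iSup_le (hrun : IsIRGPUCBRun X k f σ ε ζ x y)
    (hnoise : IsNoiseModel X f P σ s (1 / 2) ε ζ) (hf : IsCenteredGP X k f P)
    (hcont : ∀ᵐ ω ∂P, ContinuousOn (f ω) X) (hX : MeasurableSet X) (hconn : IsPreconnected X)
    (hnt : X.Nontrivial) (hσ : 0 < σ) (hk : ∀ z ∈ X, k z z ≤ 1) {S : Finset X} (hS : S.Nonempty)
    (hcard : (S.card : ℝ) / 2 ≤ Real.exp (s / 2))
    (hsup : Integrable (fun ω => S.sup' hS fun z => f ω z) P)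
    (hquery : ∀ t, Integrable (fun ω => f ω (x t ω)) P) (hT : 0 < T)
    (hbest : Integrable (fun ω => ⨆ t : Fin T, f ω (x t ω)) P) :
    ∫ ω, S.sup' hS (fun z => f ω z) ∂P - ∫ ω, ⨆ t : Fin T, f ω (x t ω) ∂P ≤
      √(posPartMean s (1 / 2) * (C₁ σ * (maxInfoGain X f P σ T).toReal / T)) := by
  set Δ := ∫ ω, S.sup' hS (fun z => f ω z) ∂P - ∫ ω, ⨆ t : Fin T, f ω (x t ω) ∂P
  set g := C₁ σ * (maxInfoGain X f P σ T).toReal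
  have hT' : (0 : ℝ) < T := by exact_mod_cast hT
  have hstep : ∀ t : Fin T, Δ ≤ ∫ ω, width k σ ζ x t ω ∂P := fun t =>
    (sub_le_sub_left (integral_mono (hquery t) hbest fun ω =>
      le_ciSup_fin (fun t : Fin T => f ω (x t ω)) t) _).trans
    (hrun.integral_sup'_sub_integral_query_le hnoise hf hcont hX hσ hk hS hcard hsup (hquery t))
  have hsum : T * Δ ≤ √(T * posPartMean s (1 / 2)) * √g :=
    calc T * Δ = ∑ _t : Fin T, Δ := by simp
      _ ≤ ∑ t : Fin T, ∫ ω, width k σ ζ x t ω ∂P := Finset.sum_le_sum fun t _ => hstep t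
      _ ≤ _ := hrun.sum_integral_width_le hnoise one_half_pos hf hcont hX hconn hnt hσ hk T
  refine le_of_mul_le_mul_left (hsum.trans_eq ?_) hT'
  have hmean := (posPartMean_pos s one_half_pos).le
  rw [← Real.sqrt_mul (by positivity), ← Real.sqrt_sq hT'.le, ← Real.sqrt_mul (sq_nonneg _),
    Real.sqrt_sq hT'.le]
  congr 1
  field_simp

lemma integrable_query (hrun : IsIRGPUCBRun X k f σ ε ζ x y) {lam : ℝ}
    (hnoise : IsNoiseModel X f P σ s lam ε ζ) (hf : IsCenteredGP X k f P)
    (hX : RegularDomain X f P r a b) (hd : 0 < d) (hσ : 0 < σ) (t : ℕ) :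
    Integrable (fun ω => f ω (x t ω)) P := by
  obtain ⟨_, _, _, _, hdist, -⟩ := hrun.exists_hasCondDistrib_query hnoise hf hX.ae_continuousOn
    hX.compact.measurableSet hσ t
  exact hX.integrable_value hf hd hdist.aemeasurable_snd
    (.of_forall fun ω => ⟨_, hrun.mem t ω, rfl⟩)

lemma integrable_iSup_query (hrun : IsIRGPUCBRun X k f σ ε ζ x y) {lam : ℝ}
    (hnoise : IsNoiseModel X f P σ s lam ε ζ) (hf : IsCenteredGP X k f P)
    (hX : RegularDomain X f P r a b) (hd : 0 < d) (hσ : 0 < σ) (hT : 0 < T) :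
    Integrable (fun ω => ⨆ t : Fin T, f ω (x t ω)) P := by
  have : Nonempty (Fin T) := ⟨⟨0, hT⟩⟩
  have hquery := hrun.integrable_query hnoise hf hX hd hσ
  refine hX.integrable_value hf hd (AEMeasurable.iSup fun t : Fin T => (hquery t).aemeasurable)
    (.of_forall fun ω => ?_)
  obtain ⟨t, ht⟩ := exists_eq_ciSup_of_finite (f := fun t : Fin T => f ω (x t ω))
  exact ⟨_, hrun.mem t ω, ht.symm⟩

end IsIRGPUCBRun

end RunRegret

/-! ### Choice of the net -/

section Arithmetic

variable {d : ℕ} {r a b η τ B G s w : ℝ}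

/-- The argument `τ` of the logarithm in `shift`. The expected oscillation of `f` over its domain
is at most `τ η / 2`. -/
noncomputable def oscRatio (d : ℕ) (r a b η : ℝ) : ℝ :=
  2 * b * d * r * (√(Real.log (a * d)) + √Real.pi / 2) / η

lemma oscRatio_pos (hr : 0 < r) (hb : 0 < b) (hη : 0 < η) (hd : 0 < d) :
    0 < oscRatio d r a b η := by
  unfold oscRatio
  positivity

lemma mul_sqrt_mul_eq_oscRatio (hη : η ≠ 0) :
    √d * r * (√d * b * (√(Real.log (a * d)) + √Real.pi / 2)) = oscRatio d r a b η * η / 2 := by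
  have hd : √(d : ℝ) * √d = d := Real.mul_self_sqrt d.cast_nonneg
  rw [oscRatio, div_mul_cancel₀ _ hη]
  linear_combination r * b * (√(Real.log (a * d)) + √Real.pi / 2) * hd

lemma exp_half_shift (h : 0 < oscRatio d r a b η) :
    Real.exp (shift d r a b η / 2) = oscRatio d r a b η ^ d / 2 := by
  have hshift : shift d r a b η / 2 = d * Real.log (oscRatio d r a b η) - Real.log 2 := by
    rw [shift, oscRatio]
    ring
  rw [hshift, Real.exp_sub, Real.exp_log two_pos, ← Real.log_pow, Real.exp_log (pow_pos h d)]

lemma div_add_add_log_le (h1 : 1 ≤ w) (h2 : w ≤ 2) : 4 / w + w + Real.log w ≤ 5 := by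
  have hw : 0 < w := by linarith
  have hlog := Real.log_le_sub_one_of_pos hw
  have hdiv : 4 / w ≤ 6 - 2 * w := by
    rw [div_le_iff₀ hw]
    nlinarith [mul_nonneg (sub_nonneg.2 h1) (sub_nonneg.2 h2)]
  linarith

lemma le_half_add_sqrt_of_neg (hη : 0 < η) (hG : 0 ≤ G) (hs : s ≤ 0)
    (hτs : τ ≤ 2 * Real.exp (s / 2)) (hτ : 1 ≤ τ) (hosc : B ≤ τ * η / 2)
    (hnet : B ≤ τ * η / 4 + √(2 * Real.exp (s / 2) * G)) : B ≤ η / 2 + √((2 + s) * G) := by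
  set w := Real.exp (-(s / 2)) with hwdef
  have hw : 0 < w := Real.exp_pos _
  have hexp : Real.exp (s / 2) = w⁻¹ := by rw [← Real.exp_neg, neg_neg]
  have h1 : 1 ≤ w := Real.one_le_exp (by linarith)
  have hτw : τ * w ≤ 2 := by rwa [hexp, ← div_eq_mul_inv, le_div_iff₀ hw] at hτs
  have h2 : w ≤ 2 := by nlinarith
  have hlog : s = -(2 * Real.log w) := by
    rw [hwdef, Real.log_exp]
    ring
  have hroot : (2 - w) * √(2 * Real.exp (s / 2) * G) ≤ √((2 + s) * G) := by
    refine Real.le_sqrt_of_sq_le ?_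
    rw [mul_pow, Real.sq_sqrt (by positivity), hexp, ← mul_assoc]
    refine mul_le_mul_of_nonneg_right ?_ hG
    have hsq : (2 - w) ^ 2 * (2 * w⁻¹) = 2 * (4 / w + w - 4) := by
      field_simp
      ring
    linarith [div_add_add_log_le h1 h2]
  -- The two bounds on `B` are averaged with the weights `w - 1` and `2 - w`.
  nlinarith [mul_le_mul_of_nonneg_left hosc (sub_nonneg.2 h1),
    mul_le_mul_of_nonneg_left hnet (sub_nonneg.2 h2), mul_le_mul_of_nonneg_left hτw hη.le]

lemma le_half_add_sqrt_of_nonneg (hη : 0 < η) (hs : 0 ≤ s) (hτ : 1 ≤ τ)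
    (hnet : ∀ n : ℕ, 0 < n → n ≤ τ →
      B ≤ τ * η / (4 * n) + √(posPartMean s (1 / 2) * G)) : B ≤ η / 2 + √((2 + s) * G) := by
  have hn : 0 < ⌊τ⌋₊ := Nat.floor_pos.2 hτ
  have hn' : (1 : ℝ) ≤ ⌊τ⌋₊ := by exact_mod_cast hn
  have hbound := hnet _ hn (Nat.floor_le (by linarith))
  have hmean : posPartMean s (1 / 2) = 2 + s := by
    rw [posPartMean, if_pos hs]
    norm_num [add_comm]
  have hterm : τ * η / (4 * ⌊τ⌋₊) ≤ η / 2 := by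
    rw [div_le_iff₀ (by positivity)]
    nlinarith [Nat.lt_floor_add_one τ]
  rw [hmean] at hbound
  linarith

lemma le_half_add_sqrt (hη : 0 < η) (hG : 0 ≤ G) (hd : 0 < d) (hexp : Real.exp (s / 2) = τ ^ d / 2)
    (hosc : B ≤ τ * η / 2) (hnet : ∀ n : ℕ, 0 < n → n ≤ τ →
      B ≤ τ * η / (4 * n) + √(posPartMean s (1 / 2) * G)) : B ≤ η / 2 + √((2 + s) * G) := by
  rcases le_total τ 1 with hτ | hτ
  · nlinarith [Real.sqrt_nonneg ((2 + s) * G)]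
  rcases le_or_gt 0 s with hs | hs
  · exact le_half_add_sqrt_of_nonneg hη hs hτ hnet
  refine le_half_add_sqrt_of_neg hη hG hs.le ?_ hτ hosc ?_
  · rw [hexp, mul_div_cancel₀ _ two_ne_zero]
    exact le_self_pow₀ hτ hd.ne'
  · have hmean : posPartMean s (1 / 2) = 2 * Real.exp (s / 2) := by
      rw [posPartMean, if_neg hs.not_ge]
      ring_nf
    simpa only [hmean, Nat.cast_one, mul_one] using hnet 1 one_pos (by simpa using hτ)

end Arithmetic

/-! ### Regret bounds -/

section SimpleRegret

variable {Ω : Type*} {d : ℕ} {X : Set (Pt d)} {f : Ω → Pt d → ℝ} {x : ℕ → Ω → Pt d}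
  {xstar : Ω → Pt d} {T n : ℕ}

lemma simpleRegret_anti (hT : 0 < T) (hn : T ≤ n) :
    simpleRegret f xstar x n ≤ simpleRegret f xstar x T := fun ω => by
  have : Nonempty (Fin T) := ⟨⟨0, hT⟩⟩
  exact sub_le_sub_left (ciSup_le fun t =>
    le_ciSup_fin (fun t : Fin n => f ω (x t ω)) (Fin.castLE hn t)) _

lemma simpleRegret_ae_eq_zero [MeasurableSpace Ω] {P : Measure Ω} (hX : X.Subsingleton)
    (hx : ∀ t ω, x t ω ∈ X) (hstar : ∀ᵐ ω ∂P, xstar ω ∈ X) (hT : 0 < T) :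
    simpleRegret f xstar x T =ᵐ[P] 0 := by
  have : Nonempty (Fin T) := ⟨⟨0, hT⟩⟩
  filter_upwards [hstar] with ω hω
  have hval : ∀ t : Fin T, f ω (x t ω) = f ω (xstar ω) := fun t => by rw [hX (hx t ω) hω]
  simp only [simpleRegret, hval, ciSup_const, sub_self, Pi.zero_apply]

end SimpleRegret

section Regret

variable {Ω : Type*} [MeasurableSpace Ω] {P : Measure Ω} [IsProbabilityMeasure P] {d : ℕ}
  {X : Set (Pt d)} {k : Pt d → Pt d → ℝ} {f : Ω → Pt d → ℝ} {σ : ℝ≥0} {ε ζ y : ℕ → Ω → ℝ}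
  {x : ℕ → Ω → Pt d} {xstar : Ω → Pt d} {r a b s η : ℝ} {T : ℕ}

lemma RegularDomain.integral_sub_integral_le (hX : RegularDomain X f P r a b)
    (hf : ∀ z ∈ X, Measurable fun ω => f ω z) (hd : 0 < d) {U V : Ω → ℝ} (hU : Integrable U P)
    (hV : Integrable V P) {δ : ℝ} (hδ : 0 ≤ δ)
    (h : ∀ᵐ ω ∂P, ∃ z ∈ X, ∃ w ∈ X, U ω - V ω ≤ f ω z - f ω w ∧ ‖z - w‖ ≤ δ) :
    ∫ ω, U ω ∂P - ∫ ω, V ω ∂P ≤ δ * (√d * b * (√(Real.log (a * d)) + √Real.pi / 2)) := by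
  obtain ⟨_, z, hz, -⟩ := h.exists
  have : Nonempty X := ⟨⟨z, hz⟩⟩
  obtain ⟨hint, hle⟩ := hX.integral_lipschitzConst_le hf hd
  calc ∫ ω, U ω ∂P - ∫ ω, V ω ∂P = ∫ ω, U ω - V ω ∂P := (integral_sub hU hV).symm
    _ ≤ ∫ ω, δ * lipschitzConst X (f ω) ∂P := by
        refine integral_mono_ae (hU.sub hV) (hint.const_mul δ) ?_
        filter_upwards [h, hX.ae_abs_sub_le] with ω ⟨z, hz, w, hw, hUV, hzw⟩ hlip
        calc U ω - V ω ≤ |f ω z - f ω w| := hUV.trans (le_abs_self _)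
          _ ≤ lipschitzConst X (f ω) * ‖z - w‖ := hlip z hz w hw
          _ ≤ lipschitzConst X (f ω) * δ :=
              mul_le_mul_of_nonneg_left hzw (lipschitzConst_nonneg _)
          _ = δ * lipschitzConst X (f ω) := mul_comm _ _
    _ ≤ _ := by
        rw [integral_const_mul]
        exact mul_le_mul_of_nonneg_left hle hδ

lemma RegularDomain.integrable_max (hX : RegularDomain X f P r a b) (hf : IsCenteredGP X k f P)
    (hd : 0 < d) (hstar : ∀ᵐ ω ∂P, xstar ω ∈ X ∧ IsMaxOn (f ω) X (xstar ω)) :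
    Integrable (fun ω => f ω (xstar ω)) P := by
  obtain ⟨ω, hω, -⟩ := hstar.exists
  have : Nonempty X := ⟨⟨_, hω⟩⟩
  exact hX.integrable_value hf hd (hf.aemeasurable_max hX.ae_continuousOn hstar)
    (hstar.mono fun ω h => ⟨_, h.1, rfl⟩)

lemma RegularDomain.integrable_sup' (hX : RegularDomain X f P r a b) (hf : IsCenteredGP X k f P)
    (hd : 0 < d) {S : Finset X} (hS : S.Nonempty) :
    Integrable (fun ω => S.sup' hS fun z => f ω z) P := by
  refine hX.integrable_value hf hd (Measurable.aemeasurable ?_) (.of_forall fun ω => ?_)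
  · have h := S.measurable_sup' hS (f := fun (z : X) ω => f ω z) fun z _ => hf.measurable z z.2
    convert h using 1
    ext ω
    rw [Finset.sup'_apply]
  · obtain ⟨z, -, hz⟩ := S.exists_mem_eq_sup' hS fun z : X => f ω z
    exact ⟨z, z.2, hz⟩

namespace IsIRGPUCBRun

lemma integrable_simpleRegret (hrun : IsIRGPUCBRun X k f σ ε ζ x y) {lam : ℝ}
    (hnoise : IsNoiseModel X f P σ s lam ε ζ) (hf : IsCenteredGP X k f P)
    (hX : RegularDomain X f P r a b) (hd : 0 < d) (hσ : 0 < σ)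
    (hstar : ∀ᵐ ω ∂P, xstar ω ∈ X ∧ IsMaxOn (f ω) X (xstar ω)) (hT : 0 < T) :
    Integrable (simpleRegret f xstar x T) P :=
  (hX.integrable_max hf hd hstar).sub (hrun.integrable_iSup_query hnoise hf hX hd hσ hT)

lemma BSR_eq (hrun : IsIRGPUCBRun X k f σ ε ζ x y) {lam : ℝ}
    (hnoise : IsNoiseModel X f P σ s lam ε ζ) (hf : IsCenteredGP X k f P)
    (hX : RegularDomain X f P r a b) (hd : 0 < d) (hσ : 0 < σ)
    (hstar : ∀ᵐ ω ∂P, xstar ω ∈ X ∧ IsMaxOn (f ω) X (xstar ω)) (hT : 0 < T) :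
    BSR f P xstar x T = ∫ ω, f ω (xstar ω) ∂P - ∫ ω, ⨆ t : Fin T, f ω (x t ω) ∂P :=
  integral_sub (hX.integrable_max hf hd hstar) (hrun.integrable_iSup_query hnoise hf hX hd hσ hT)

lemma BSR_le_oscRatio (hrun : IsIRGPUCBRun X k f σ ε ζ x y) {lam : ℝ}
    (hnoise : IsNoiseModel X f P σ s lam ε ζ) (hf : IsCenteredGP X k f P)
    (hX : RegularDomain X f P r a b) (hd : 0 < d) (hσ : 0 < σ)
    (hstar : ∀ᵐ ω ∂P, xstar ω ∈ X ∧ IsMaxOn (f ω) X (xstar ω)) (hT : 0 < T) (hη : η ≠ 0) :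
    BSR f P xstar x T ≤ oscRatio d r a b η * η / 2 := by
  rw [hrun.BSR_eq hnoise hf hX hd hσ hstar hT, ← mul_sqrt_mul_eq_oscRatio hη]
  refine hX.integral_sub_integral_le hf.measurable hd (hX.integrable_max hf hd hstar)
    (hrun.integrable_iSup_query hnoise hf hX hd hσ hT)
    (mul_nonneg (Real.sqrt_nonneg _) hX.r_pos.le) ?_
  filter_upwards [hstar] with ω hω
  exact ⟨_, hω.1, _, hrun.mem 0 ω, sub_le_sub_left
    (le_ciSup_fin (fun t : Fin T => f ω (x t ω)) ⟨0, hT⟩) _, hX.dist_le hω.1 (hrun.mem 0 ω)⟩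

lemma BSR_le_of_net (hrun : IsIRGPUCBRun X k f σ ε ζ x y)
    (hnoise : IsNoiseModel X f P σ (shift d r a b η) (1 / 2) ε ζ) (hf : IsCenteredGP X k f P)
    (hk : ∀ z ∈ X, k z z ≤ 1) (hX : RegularDomain X f P r a b) (hnt : X.Nontrivial) (hd : 0 < d)
    (hσ : 0 < σ) (hstar : ∀ᵐ ω ∂P, xstar ω ∈ X ∧ IsMaxOn (f ω) X (xstar ω)) (hT : 0 < T)
    (hη : 0 < η) {n : ℕ} (hn : 0 < n) (hnτ : n ≤ oscRatio d r a b η) :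
    BSR f P xstar x T ≤ oscRatio d r a b η * η / (4 * n) +
      √(posPartMean (shift d r a b η) (1 / 2) *
        (C₁ σ * (maxInfoGain X f P σ T).toReal / T)) := by
  obtain ⟨S, hS, hcard, hnet⟩ :=
    exists_net hX.compact hX.convex hnt.nonempty hX.r_pos hX.subset_cube hn
  have hcard' : (S.card : ℝ) / 2 ≤ Real.exp (shift d r a b η / 2) := by
    rw [exp_half_shift (oscRatio_pos hX.r_pos hX.b_pos hη hd)]
    have hpow : (n : ℝ) ^ d ≤ oscRatio d r a b η ^ d := by gcongr
    have hcast : (S.card : ℝ) ≤ (n : ℝ) ^ d := by exact_mod_cast hcard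
    linarith
  have hsup := hX.integrable_sup' hf hd hS
  have hmax := hX.integrable_max hf hd hstar
  have hr := hX.r_pos
  have hdiscr : ∫ ω, f ω (xstar ω) ∂P - ∫ ω, S.sup' hS (fun z => f ω z) ∂P ≤
      √d * (r / (2 * n)) * (√d * b * (√(Real.log (a * d)) + √Real.pi / 2)) := by
    refine hX.integral_sub_integral_le hf.measurable hd hmax hsup (by positivity) ?_
    filter_upwards [hstar] with ω hω
    obtain ⟨w, hw, hdist⟩ := hnet _ hω.1
    exact ⟨_, hω.1, w, w.2, sub_le_sub_left (S.le_sup' (fun z : X => f ω z) hw) _, hdist⟩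
  have hscale : √d * (r / (2 * n)) * (√d * b * (√(Real.log (a * d)) + √Real.pi / 2)) =
      oscRatio d r a b η * η / (4 * n) := by
    linear_combination (1 / (2 * n : ℝ)) * mul_sqrt_mul_eq_oscRatio (d := d) (r := r) (a := a)
      (b := b) hη.ne'
  have hbest := hrun.integral_sup'_sub_integral_iSup_le hnoise hf hX.ae_continuousOn
    hX.compact.measurableSet hX.convex.isPreconnected hnt hσ hk hS hcard' hsup
    (hrun.integrable_query hnoise hf hX hd hσ) hT
    (hrun.integrable_iSup_query hnoise hf hX hd hσ hT)
  rw [hrun.BSR_eq hnoise hf hX hd hσ hstar hT]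
  linarith

theorem BSR_le_widthBound (hrun : IsIRGPUCBRun X k f σ ε ζ x y)
    (hnoise : IsNoiseModel X f P σ (shift d r a b η) (1 / 2) ε ζ) (hf : IsCenteredGP X k f P)
    (hk : ∀ z ∈ X, k z z ≤ 1) (hX : RegularDomain X f P r a b) (hnt : X.Nontrivial) (hd : 0 < d)
    (hσ : 0 < σ) (hstar : ∀ᵐ ω ∂P, xstar ω ∈ X ∧ IsMaxOn (f ω) X (xstar ω)) (hT : 0 < T)
    (hη : 0 < η) : BSR f P xstar x T ≤ η / 2 + widthBound X f P σ r a b η T := by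
  have hG : 0 ≤ C₁ σ * (maxInfoGain X f P σ T).toReal / T :=
    div_nonneg (mul_nonneg (C₁_pos hσ).le ENNReal.toReal_nonneg) T.cast_nonneg
  have hbound := le_half_add_sqrt hη hG hd (exp_half_shift (oscRatio_pos hX.r_pos hX.b_pos hη hd))
    (hrun.BSR_le_oscRatio hnoise hf hX hd hσ hstar hT hη.ne')
    fun n hn hnτ => hrun.BSR_le_of_net hnoise hf hk hX hnt hd hσ hstar hT hη hn hnτ
  have hwidth : C₁ σ * (2 + shift d r a b η) * (maxInfoGain X f P σ T).toReal / T =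
      (2 + shift d r a b η) * (C₁ σ * (maxInfoGain X f P σ T).toReal / T) := by ring
  rwa [widthBound, hwidth]

theorem integrable_simpleRegret_and_BSR_le (hrun : IsIRGPUCBRun X k f σ ε ζ x y)
    (hnoise : IsNoiseModel X f P σ (shift d r a b η) (1 / 2) ε ζ) (hf : IsCenteredGP X k f P)
    (hk : ∀ z ∈ X, k z z ≤ 1) (hX : RegularDomain X f P r a b) (hσ : 0 < σ)
    (hstar : ∀ᵐ ω ∂P, xstar ω ∈ X ∧ IsMaxOn (f ω) X (xstar ω)) (hT : 0 < T) (hη : 0 < η) :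
    Integrable (simpleRegret f xstar x T) P ∧
      BSR f P xstar x T ≤ η / 2 + widthBound X f P σ r a b η T := by
  rcases X.subsingleton_or_nontrivial with hsub | hnt
  · have hzero := simpleRegret_ae_eq_zero (f := f) hsub hrun.mem (hstar.mono fun _ h => h.1) hT
    refine ⟨(integrable_zero Ω ℝ P).congr hzero.symm, ?_⟩
    have hBSR : BSR f P xstar x T = 0 := (integral_congr_ae hzero).trans (integral_zero' _ _)
    exact hBSR.trans_le (add_nonneg (half_pos hη).le (Real.sqrt_nonneg _))
  · have hd : 0 < d := Nat.pos_of_ne_zero fun h => by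
      subst h
      exact not_subsingleton_iff.2 hnt (subsingleton_of_subsingleton (α := Pt 0))
    exact ⟨hrun.integrable_simpleRegret hnoise hf hX hd hσ hstar hT,
      hrun.BSR_le_widthBound hnoise hf hk hX hnt hd hσ hstar hT hη⟩

end IsIRGPUCBRun

end Regret

end GPBandit

theorem corollary2_general {Ω : Type*} [MeasurableSpace Ω] (P : Measure Ω)
    [IsProbabilityMeasure P] (d : ℕ) (X : Set (GPBandit.Pt d))
    (k : GPBandit.Pt d → GPBandit.Pt d → ℝ) (f : Ω → GPBandit.Pt d → ℝ)
    (hf : GPBandit.IsCenteredGP X k f P) (hk : ∀ z ∈ X, k z z ≤ 1)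
    (r a b : ℝ) (hX : GPBandit.RegularDomain X f P r a b)
    (η : ℝ) (hη : 0 < η) (σ : ℝ≥0) (hσ : 0 < σ)
    (ε ζ : ℕ → Ω → ℝ)
    (hnoise : GPBandit.IsNoiseModel X f P σ (GPBandit.shift d r a b η) (1 / 2) ε ζ)
    (x : ℕ → Ω → GPBandit.Pt d) (y : ℕ → Ω → ℝ)
    (hrun : GPBandit.IsIRGPUCBRun X k f σ ε ζ x y)
    (xstar : Ω → GPBandit.Pt d)
    (hstar : ∀ᵐ ω ∂P, xstar ω ∈ X ∧ IsMaxOn (f ω) X (xstar ω)) :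
    (∀ T : ℕ, 1 ≤ T → GPBandit.maxInfoGain X f P σ T ≠ ∞ ∧
      Integrable (GPBandit.simpleRegret f xstar x T) P ∧
      GPBandit.BSR f P xstar x T ≤ η / 2 + GPBandit.widthBound X f P σ r a b η T) ∧
    ∀ T : ℕ, 1 ≤ T → GPBandit.widthBound X f P σ r a b η T ≤ η / 2 →
      ∀ n : ℕ, T ≤ n → GPBandit.BSR f P xstar x n ≤ η := by
  have hregret := fun (T : ℕ) (hT : 1 ≤ T) =>
    hrun.integrable_simpleRegret_and_BSR_le hnoise hf hk hX hσ hstar hT hη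
  refine ⟨fun T hT => ⟨hf.maxInfoGain_ne_top hk hσ T, hregret T hT⟩, fun T hT hwidth n hn => ?_⟩
  calc GPBandit.BSR f P xstar x n
      ≤ GPBandit.BSR f P xstar x T :=
        integral_mono (hregret n (hT.trans hn)).1 (hregret T hT).1
          (GPBandit.simpleRegret_anti hT hn)
    _ ≤ η / 2 + GPBandit.widthBound X f P σ r a b η T := (hregret T hT).2
    _ ≤ η := by linarith

theorem corollary2 {Ω : Type*} [MeasurableSpace Ω] (P : Measure Ω) [IsProbabilityMeasure P]
    (d : ℕ) (X : Set (GPBandit.Pt d)) (k : GPBandit.Pt d → GPBandit.Pt d → ℝ)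
    (f : Ω → GPBandit.Pt d → ℝ) (hf : GPBandit.IsCenteredGP X k f P)
    (hstat : GPBandit.IsStationaryOn X k) (hk : ∀ z ∈ X, k z z = 1)
    (r a b : ℝ) (hX : GPBandit.RegularDomain X f P r a b)
    (η : ℝ) (hη : 0 < η) (σ : ℝ≥0) (hσ : 0 < σ)
    (ε ζ : ℕ → Ω → ℝ)
    (hnoise : GPBandit.IsNoiseModel X f P σ (GPBandit.shift d r a b η) (1 / 2) ε ζ)
    (x : ℕ → Ω → GPBandit.Pt d) (y : ℕ → Ω → ℝ)
    (hrun : GPBandit.IsIRGPUCBRun X k f σ ε ζ x y)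
    (xstar : Ω → GPBandit.Pt d)
    (hstar : ∀ᵐ ω ∂P, xstar ω ∈ X ∧ IsMaxOn (f ω) X (xstar ω)) :
    (∀ T : ℕ, 1 ≤ T → GPBandit.maxInfoGain X f P σ T ≠ ∞ ∧
      Integrable (GPBandit.simpleRegret f xstar x T) P ∧
      GPBandit.BSR f P xstar x T ≤ η / 2 + GPBandit.widthBound X f P σ r a b η T) ∧
    ∀ T : ℕ, 1 ≤ T → GPBandit.widthBound X f P σ r a b η T ≤ η / 2 →
      ∀ n : ℕ, T ≤ n → GPBandit.BSR f P xstar x n ≤ η :=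
  corollary2_general P d X k f hf (fun z hz => (hk z hz).le) r a b hX η hη σ hσ ε ζ hnoise x y
    hrun xstar hstar
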